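/- **Theorem (Termination).** For every label environment, the non-deterministic constraint solver $\longrightarrow$ defined below (incremental instantiation and copying rules included) terminates on all inputs: there is no infinite sequence of constraints $C_0\longrightarrow C_1\longrightarrow C_2\longrightarrow\cdots$. The same holds for its unification algorithm $\rightsquigarrow$. **Types and shapes.** Types are $\tau ::= \alpha\mid 1\mid\tau_1\to\tau_2\mid\Pi_{i=1}^n\tau_i\mid T\,\bar\tau\mid[\sigma]$, with schemes $\sigma::=\tau\mid\forall\alpha.\sigma$, up to $\alpha$-conversion; a ground type has no free variable. A shape $\nu\bar\gamma.\tau$ is a type $\tau$ with holes $\bar\gamma$ that are exactly its free variables; $(\nu\bar\gamma.\tau)\,\bar\tau=\tau[\bar\gamma:=\bar\tau]$; $\nu\gamma.\gamma$ is trivial. Put $\nu\bar\gamma_1.\tau\preceq\nu\bar\gamma_2.\tau[\bar\gamma_1:=\bar\tau]$. A principal shape of $\tau$ is a $\preceq$-least one among the non-trivial shapes $S$ such that $\tau=S\,\bar\tau$ for some $\bar\tau$; it is canonical if its holes are listed in order of occurrence. Below, $s,s'$ are canonical principal shapes. A label environment is a partial map sending (label $\ell$, record name $T$) to $\forall\bar\alpha.\,T\bar\alpha\to\tau$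 with $\mathrm{fv}(\tau)\subseteq\bar\alpha$. **Constraints.** With type variables $\alpha,\beta,\gamma$, term variables $x$ and instantiation variables $i$, $$C::=\mathsf{true}\mid\mathsf{false}\mid C\wedge C\mid\exists\alpha.C\mid\forall\alpha.C\mid\epsilon\mid\mathsf{let}\,x=\lambda\alpha.C\,\mathsf{in}\,C\mid x\,\tau\mid\mathsf{match}\,\tau\,\mathsf{with}\,\overline{p\to C}\mid\mathsf{let}\,x=\lambda\alpha[\bar\alpha].C\,\mathsf{in}\,C\mid\exists i^x.C\mid i[\alpha\rightsquigarrow\tau]$$ together with $\ell/t\le\tau_1\to\tau_2$, $\mathrm{dom}\,t=\bar\ell$, $\varsigma\le\tau$, $x\le\varsigma$ for pattern variables $t$ (record names) and $\varsigma$ (schemes). A multi-equation $\epsilon$ is a finite multiset of types, written $\tau_1=\dots=\tau_n$; an equation is a two-element one. Patterns $p$: a wildcard; a tuple pattern binding $\alpha$ to the $j$-th component; a record pattern binding $t$; a polytype pattern binding $\varsigma$. In $\mathsf{let}\,x=\lambda\alpha[\bar\alpha].C_1\,\mathsf{in}\,C_2$ the region $\alpha,\bar\alpha$ (root $\alpha$)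 is bound in $C_1$ and in $C_2$, and $x$ in $C_2$. Unification problems $U$ are built from $\mathsf{true},\mathsf{false},\wedge,\exists\alpha,\epsilon$. A context $\mathcal C$ has one hole, under any constructors except match branches; $\mathrm{bv}(\mathcal C)$ are the names bound at the hole. $\#$ means "not free in / disjoint from", and $i^x[\beta\rightsquigarrow\gamma]$ in $\mathcal C$ means that $i$ is bound by $\exists i^x$ in $\mathcal C$. $\bigwedge\bar\epsilon$ is a conjunction of multi-equations; $\equiv\mathsf{true}$ means satisfied by all assignments of ground types. In patterns $C\wedge\epsilon$ and $C\wedge\bar\epsilon$ occurring in the rules Copy, Poly, Compress, Gc, Escape, Rigid and in determinacy, $C$ may be absent. Both relations rewrite under any context, modulo $\alpha$-conversion, associativity and commutativity of $\wedge$, and permutation of $\bar\alpha$ in regions. All rules respect scoping: no free name is captured, and no name leaves the scope of its binder. $\alpha\prec_C\beta$ holds if $C$ has, under conjunctions and existentials not binding $\alpha,\beta$, a multi-equation $\beta=\tau=\epsilon$ with $\alpha\in\mathrm{fv}(\tau)$; $C$ is cyclic if $\prec_C$ has a cycle going through some non-variable $\tau$. **Unifier $\rightsquigarrow$** (on unification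 problems): - $(\exists\alpha.U_1)\wedge U_2\to\exists\alpha.(U_1\wedge U_2)$ if $\alpha\#U_2$; $U\wedge\mathsf{true}\to U$; $\mathcal U[\mathsf{false}]\to\mathsf{false}$ for a non-empty context; $U\to\mathsf{false}$ if $U$ is cyclic; - $\alpha=\epsilon_1\wedge\alpha=\epsilon_2\to\alpha=\epsilon_1=\epsilon_2$; $\alpha=\alpha=\epsilon\to\alpha=\epsilon$; $\epsilon\to\mathsf{true}$ if $|\epsilon|\le1$; - $s(\bar\tau,\tau_i,\bar\tau')=\epsilon\to\exists\alpha.(\alpha=\tau_i\wedge s(\bar\tau,\alpha,\bar\tau')=\epsilon)$ if $\tau_i$ is not a variable and $\alpha\#\bar\tau,\bar\tau',\epsilon$ (here a capture of $\alpha$ in $\tau_i$ is not excluded); - $s\bar\alpha=s\bar\beta=\epsilon\to s\bar\alpha=\epsilon\wedge\bar\alpha=\bar\beta$; $s\bar\alpha=s'\bar\beta=\epsilon\to\mathsf{false}$ if $s\ne s'$. **Solver $\longrightarrow$.** Write $L[C_1;C_2]$ for $\mathsf{let}\,x=\lambda\alpha[\bar\alpha].C_1\,\mathsf{in}\,C_2$.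 - Basic: $U_1\to U_2$ if $U_1\rightsquigarrow U_2$; $C\wedge\mathsf{true}\to C$; $\mathcal C[\mathsf{false}]\to\mathsf{false}$ for a non-empty context; $\mathsf{let}\,x=\lambda\alpha.C_1\,\mathsf{in}\,C_2\to\mathsf{let}\,x=\lambda\alpha[\,].C_1\,\mathsf{in}\,C_2$; $(\exists\alpha.C_1)\wedge C_2\to\exists\alpha.(C_1\wedge C_2)$ if $\alpha\#C_2$; $L[\exists\beta.C_1;C_2]\to\mathsf{let}\,x=\lambda\alpha[\bar\alpha,\beta].C_1\,\mathsf{in}\,C_2$ if $\beta\#\alpha,\bar\alpha,C_2$; $L[C_1;\exists\beta.C_2]\to\exists\beta.L[C_1;C_2]$ if $\beta\#\alpha,\bar\alpha,C_1$; $L[C_1\wedge C_2;C_3]\to C_1\wedge L[C_2;C_3]$ if $C_1\#\alpha,\bar\alpha$; $L[C_1;C_2\wedge C_3]\to C_2\wedge L[C_1;C_3]$ if $x\#C_2$. - Match: $\mathcal C[\mathsf{match}\,\tau\,\mathsf{with}\,\bar b]\to\mathcal C[D]$ if $\vdash\mathcal C[\tau\,!\,s]$, where $D=\exists\bar\gamma.(\tau=s\bar\gamma\wedge\theta(C))$,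 $\bar\gamma$ fresh, for a branch $p\to C$ such that $p$ matches $s\bar\gamma$ with substitution $\theta$ of its pattern variable ($\alpha$ by the $j$-th $\gamma$; $t$ by $T$; $\varsigma$ by the scheme), and $D=\mathsf{false}$ if no branch matches. After substitution, $\ell/T\le\tau_1\to\tau_2$ is $\exists\bar\alpha.(\tau_1=T\bar\alpha\wedge\tau_2=\tau)$ if $\ell/T$ is declared with $\forall\bar\alpha.T\bar\alpha\to\tau$, else $\mathsf{false}$; $\mathrm{dom}\,T=\bar\ell$ is $\mathsf{true}$ or $\mathsf{false}$ according as $\bar\ell$ is the set of labels declared for $T$; $(\forall\bar\alpha.\tau')\le\tau$ is $\exists\bar\alpha.\tau'=\tau$; $x\le\forall\bar\alpha.\tau$ is $\forall\bar\alpha.x\,\tau$. The judgment $\vdash\mathcal C[\tau\,!\,s]$ is derived by: $\tau$ is not a variable and $s$ is its canonical principal shape; or $\tau=\alpha$, $\mathcal C=\mathcal C_1[\alpha=\tau'=\epsilon\wedge\mathcal C_2]$, $\alpha\#\mathrm{bv}(\mathcal C_2)$ and $s$ is the shape of the non-variable $\tau'$; or $\tau=\beta\in\{\alpha,\bar\alpha\}$,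 $\mathcal C=L[\mathcal C_1;\mathcal C_2[i^x[\beta\rightsquigarrow\gamma]]]$, $x\#\mathrm{bv}(\mathcal C_2)$, $\beta\#\mathrm{bv}(\mathcal C_1)$ and $\vdash L[\mathcal C_1[\mathsf{true}];\mathcal C_2[i^x[\beta\rightsquigarrow\gamma]\wedge\square]][\gamma\,!\,s]$. - Instantiation: $i[\alpha\rightsquigarrow\tau]\to\exists\gamma.(\gamma=\tau\wedge i[\alpha\rightsquigarrow\gamma])$ if $\tau$ is not a variable, $\gamma$ fresh; $i[\beta\rightsquigarrow\gamma_1]\wedge i[\beta\rightsquigarrow\gamma_2]\to i[\beta\rightsquigarrow\gamma_1]\wedge\gamma_1=\gamma_2$. Further, always assuming $x\#\mathrm{bv}(\mathcal C)$: - $L[C;\mathcal C[x\,\tau]]\to L[C;\mathcal C[\exists\gamma.\exists i^x.(i[\alpha\rightsquigarrow\gamma]\wedge\gamma=\tau)]]$ with $\gamma$ fresh; - (Copy) $L[C;\mathcal C[i^x[\beta\rightsquigarrow\gamma]]]\to L[C;\mathcal C[\exists\bar\beta'.(\gamma=s\bar\beta'\wedge\bigwedge_k i[\beta_k\rightsquigarrow\beta'_k])]]$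 if $C=C'\wedge\beta=s\bar\beta=\epsilon$ is not cyclic, $\beta\in\{\alpha,\bar\alpha\}$, $\bar\beta'$ fresh; - (Poly) $L[\bar\epsilon\wedge C;\mathcal C[i^x[\beta\rightsquigarrow\gamma]]]\to L[\bar\epsilon\wedge C;\mathcal C[\mathsf{true}]]$ if $\beta\in\{\alpha,\bar\alpha\}$, $\forall\beta.\exists(\{\alpha,\bar\alpha\}\setminus\beta).\bigwedge\bar\epsilon\equiv\mathsf{true}$, $\beta\#C$ and no other $i[\beta\rightsquigarrow\cdot]$ occurs in $\mathcal C$; - (Mono) $L[C;\mathcal C[i^x[\beta\rightsquigarrow\gamma]]]\to L[C;\mathcal C[\beta=\gamma]]$ if $\beta\notin\{\alpha,\bar\alpha\}$, $\beta\#\mathrm{bv}(\mathcal C)$. - Let: $L[\bar\epsilon;C]\to C$ if $\exists\alpha,\bar\alpha.\bigwedge\bar\epsilon\equiv\mathsf{true}$ and $x\#C$. (Compress) $\mathsf{let}\,x=\lambda\alpha[\bar\alpha,\beta].(C_1\wedge\beta=\gamma=\epsilon)\,\mathsf{in}\,C_2\to L[C_1[\beta:=\gamma]\wedge\gamma=\epsilon[\beta:=\gamma];C_2[\beta:=\gamma]]$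 if $\beta\ne\gamma$. (Gc) $\mathsf{let}\,x=\lambda\alpha[\bar\alpha,\beta].(C_1\wedge\beta=\epsilon)\,\mathsf{in}\,C_2\to L[C_1\wedge\epsilon;C_2]$ if $\beta\#C_1,\epsilon,C_2$. (Lower) $\mathsf{let}\,x=\lambda\alpha[\bar\alpha,\bar\beta].C_1\,\mathsf{in}\,C_2\to\exists\bar\beta.L[C_1;C_2]$ if $\bar\beta\neq\emptyset$ and $\exists\alpha,\bar\alpha.C_1$ determines $\bar\beta$. Here $\exists\bar\beta.C$ determines $\bar\alpha$ if $C=C'\wedge\gamma=\epsilon$ with $\gamma\#\bar\alpha,\bar\beta$ and $\bar\alpha\subseteq\mathrm{fv}(\epsilon)$, or $C=C'\wedge\bar\alpha=\tau=\epsilon$ with $\mathrm{fv}(\tau)\#\bar\alpha,\bar\beta$. - Instantiation binders: $\exists i^x.\exists\alpha.C\to\exists\alpha.\exists i^x.C$; $\exists i^x.(C_1\wedge C_2)\to C_1\wedge\exists i^x.C_2$ if $i\#C_1$; $L[C_1;\exists i^{x'}.C_2]\to\exists i^{x'}.L[C_1;C_2]$ if $x\ne x'$; $\exists i^x.C\to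 C$ if $i\#C$. - Universals (with $\bar\alpha\ne\emptyset$): $\forall\bar\alpha.\exists\bar\beta.(C_1\wedge C_2)\to C_1\wedge\forall\bar\alpha.\exists\bar\beta.C_2$ if $\bar\alpha,\bar\beta\#C_1$; $\forall\bar\alpha.\exists\bar\beta,\bar\gamma.C\to\exists\bar\gamma.\forall\bar\alpha.\exists\bar\beta.C$ if $\bar\gamma\ne\emptyset$ and $\exists\bar\alpha,\bar\beta.C$ determines $\bar\gamma$; (Escape) $\forall\bar\alpha.\exists\bar\beta.(C\wedge\bar\epsilon)\to\mathsf{false}$ if $\alpha\prec^*_{\bar\epsilon}\gamma$ with $\alpha\in\bar\alpha\setminus\bar\beta$, $\gamma\notin\{\alpha\}\cup\bar\beta$; (Rigid) $\forall\bar\alpha.\exists\bar\beta.(C\wedge\alpha=\tau=\epsilon)\to\mathsf{false}$ if $\alpha\in\bar\alpha\setminus\bar\beta$ and $\tau$ is not a variable; $\forall\bar\alpha.\exists\bar\beta.\bigwedge\bar\epsilon\to\mathsf{true}$ if $\exists\bar\beta.\bigwedge\bar\epsilon\equiv\mathsf{true}$. -/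

import Mathlib

namespace Omni

/-! ## Names

Every sort of variable is a countably infinite set of names. -/

abbrev TyVar := ℕ
abbrev TermVar := ℕ
abbrev InstVar := ℕ
/-- Pattern variables standing for record names. -/
abbrev RecVar := ℕ
/-- Pattern variables standing for type schemes. -/
abbrev SchVar := ℕ
abbrev RecName := ℕ
abbrev Label := ℕ

/-- A variable of any sort, tagged with its sort. -/
inductive Name where
  | tv (a : TyVar)
  | tm (x : TermVar)
  | iv (i : InstVar)
  | rv (t : RecVar)
  | sv (s : SchVar)
  deriving DecidableEq

/-- The set of (tagged) type variables of a list. -/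
def tvs (as : List TyVar) : Finset Name := (as.map Name.tv).toFinset

/-- A simultaneous, sort-preserving renaming of names. -/
structure NameMap where
  tv : TyVar → TyVar
  tm : TermVar → TermVar
  iv : InstVar → InstVar
  rv : RecVar → RecVar
  sv : SchVar → SchVar

/-- The transposition of two names of the same sort (the identity if the sorts differ). -/
def NameMap.swap : Name → Name → NameMap
  | .tv a, .tv b => ⟨Equiv.swap a b, id, id, id, id⟩
  | .tm a, .tm b => ⟨id, Equiv.swap a b, id, id, id⟩
  | .iv a, .iv b => ⟨id, id, Equiv.swap a b, id, id⟩
  | .rv a, .rv b => ⟨id, id, id, Equiv.swap a b, id⟩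
  | .sv a, .sv b => ⟨id, id, id, id, Equiv.swap a b⟩
  | _, _ => ⟨id, id, id, id, id⟩

/-- The `k`-th natural number above all elements of a finite set. -/
def fresh (s : Finset ℕ) (k : ℕ) : ℕ := s.sup id + 1 + k

/-! ## Types, type schemes and shapes -/

/-- Type constructors: unit, arrow, `n`-ary tuples, nominal record types `T` with `n` arguments. -/
inductive TyCon where
  | unit
  | arrow
  | prod (n : ℕ)
  | rcd (T : RecName) (n : ℕ)

def TyCon.arity : TyCon → ℕ
  | .unit => 0
  | .arrow => 2
  | .prod n => n
  | .rcd _ n => n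

/-- Types with free variables in `V` and with `n` variables bound by enclosing quantifiers.
`poly k body` is the polytype `[∀ β₁ … β_k. body]`; bound variables are de Bruijn levels, so that
types are identified up to `α`-conversion. -/
inductive Ty (V : Type) : ℕ → Type where
  | var {n : ℕ} (a : V) : Ty V n
  | bvar {n : ℕ} (i : Fin n) : Ty V n
  | con {n : ℕ} (c : TyCon) (args : Fin c.arity → Ty V n) : Ty V n
  | poly {n : ℕ} (k : ℕ) (body : Ty V (n + k)) : Ty V n

/-- Renaming of the quantifier-bound variables. -/
def Ty.mapB {V : Type} : {m n : ℕ} → (Fin m → Fin n) → Ty V m → Ty V n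
  | _, _, _, .var a => .var a
  | _, _, ρ, .bvar i => .bvar (ρ i)
  | _, _, ρ, .con c args => .con c (fun i => (args i).mapB ρ)
  | _, n, ρ, .poly k body =>
      .poly k (body.mapB (Fin.addCases (fun i => Fin.castAdd k (ρ i)) (fun j => Fin.natAdd n j)))

/-- Substitution for the quantifier-bound variables. -/
def Ty.substB {V : Type} : {m n : ℕ} → (Fin m → Ty V n) → Ty V m → Ty V n
  | _, _, _, .var a => .var a
  | _, _, σ, .bvar i => σ i
  | _, _, σ, .con c args => .con c (fun i => (args i).substB σ)
  | _, n, σ, .poly k body =>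
      .poly k (body.substB
        (Fin.addCases (fun i => (σ i).mapB (Fin.castAdd k)) (fun j => .bvar (Fin.natAdd n j))))

/-- Capture-avoiding substitution for the free variables. -/
def Ty.bind {V W : Type} (f : V → Ty W 0) : {n : ℕ} → Ty V n → Ty W n
  | _, .var a => (f a).mapB Fin.elim0
  | _, .bvar i => .bvar i
  | _, .con c args => .con c (fun i => (args i).bind f)
  | _, .poly k body => .poly k (body.bind f)

/-- The list of free variable occurrences, from left to right. -/
def Ty.occ {V : Type} : {n : ℕ} → Ty V n → List V
  | _, .var a => [a]
  | _, .bvar _ => []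
  | _, .con _ args => (List.ofFn (fun i => (args i).occ)).flatten
  | _, .poly _ body => body.occ

/-- The set of free variables. -/
def Ty.fv {V : Type} [DecidableEq V] {n : ℕ} (t : Ty V n) : Finset V := t.occ.toFinset

/-- Renaming of free variables. -/
def Ty.rename {V W : Type} (f : V → W) {n : ℕ} (t : Ty V n) : Ty W n := t.bind (fun a => .var (f a))

/-- The types occurring in constraints. -/
abbrev Typ := Ty TyVar 0

/-- Ground types: types without free variables. -/
abbrev Ground := Ty Empty 0

def Typ.IsVar (t : Typ) : Prop := ∃ a, t = .var a

/-- The type scheme `∀ β₁ … β_k. body`. -/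
structure Scheme where
  arity : ℕ
  body : Ty TyVar (0 + arity)

/-- The body of a scheme with its quantified variables replaced by `ts`. -/
def Scheme.inst (σ : Scheme) (ts : Fin σ.arity → Typ) : Typ :=
  σ.body.substB (fun i => ts (i.cast (Nat.zero_add _)))

/-- A shape `ν γ₁ … γ_m. body`: a type whose free variables are exactly the holes `γ₁, …, γ_m`. -/
structure Shape where
  arity : ℕ
  body : Ty (Fin arity) 0
  all_used : ∀ i, i ∈ body.fv

/-- Shape application. -/
def Shape.apply {V : Type} (s : Shape) (ts : Fin s.arity → Ty V 0) : Ty V 0 := s.body.bind ts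

def Shape.applyVars (s : Shape) (as : Fin s.arity → TyVar) : Typ := s.apply (fun i => .var (as i))

/-- The shape is not the trivial shape `ν γ. γ`. -/
def Shape.Nontrivial (s : Shape) : Prop := ∀ i, s.body ≠ .var i

/-- The instantiation order: `s ⪯ s'` when `s'` is `ν γ'. (body of s)[γ := ts]`. -/
def Shape.Le (s s' : Shape) : Prop := ∃ ts : Fin s.arity → Ty (Fin s'.arity) 0, s'.body = s.apply ts

/-- `s` is a principal shape of `t`. -/
def Shape.IsPrincipal (s : Shape) (t : Typ) : Prop :=
  s.Nontrivial ∧ (∃ ts, t = s.apply ts) ∧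
    ∀ s' : Shape, s'.Nontrivial → (∃ ts, t = s'.apply ts) → s.Le s'

/-- The holes are listed in the order in which they (first) occur in the body. -/
def Shape.Ordered (s : Shape) : Prop := s.body.occ.eraseDups = List.finRange s.arity

/-- `s` is the canonical principal shape of `t`. -/
def Shape.IsShapeOf (s : Shape) (t : Typ) : Prop := s.IsPrincipal t ∧ s.Ordered

/-- `s` is a canonical principal shape. -/
def Shape.Canonical (s : Shape) : Prop := ∃ t, s.IsShapeOf t

/-- A label environment: `Σ T ℓ = some ⟨n, t⟩` when it declares
`ℓ/T : ∀ α₁ … α_n. T α₁ … α_n → t`. -/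
abbrev LabelEnv := RecName → Label → Option (Σ n : ℕ, Ty (Fin n) 0)

/-! ## Constraints -/

/-- A multi-equation: a multiset of types. The equation `τ₁ = τ₂` is the multi-equation
with the two members `τ₁`, `τ₂`. -/
abbrev MultiEq := Multiset Typ

def MultiEq.fv (e : MultiEq) : Finset TyVar := (e.map Ty.fv).sup

/-- Shape patterns: wildcard; tuples, binding `a` to the `j`-th component (counted from 1);
records, binding the record name; polytypes, binding the scheme. -/
inductive Pat where
  | wild
  | prod (a : TyVar) (j : ℕ)
  | rcd (t : RecVar)
  | poly (s : SchVar)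

def Pat.bn : Pat → Finset Name
  | .wild => ∅
  | .prod a _ => {.tv a}
  | .rcd t => {.rv t}
  | .poly s => {.sv s}

def Pat.map (ρ : NameMap) : Pat → Pat
  | .wild => .wild
  | .prod a j => .prod (ρ.tv a) j
  | .rcd t => .rcd (ρ.rv t)
  | .poly s => .poly (ρ.sv s)

mutual
/-- Constraints, including the administrative ones used by the solver. The constraints on record
labels and schemes are primitive as long as they mention a pattern variable; once this variable is
substituted they are expanded (see `Constr.substRec` and `Constr.substSch`). -/
inductive Constr where
  | tru
  | fls
  | and (c₁ c₂ : Constr)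
  /-- `∃ a. c` -/
  | ex (a : TyVar) (c : Constr)
  /-- `∀ a. c` -/
  | all (a : TyVar) (c : Constr)
  | eqn (e : MultiEq)
  /-- `let x = λ a. c₁ in c₂` -/
  | letc (x : TermVar) (a : TyVar) (c₁ c₂ : Constr)
  /-- instantiation `x t` -/
  | app (x : TermVar) (t : Typ)
  /-- suspended match constraint -/
  | mtch (t : Typ) (bs : Branches)
  /-- regional let `let x = λ a [as]. c₁ in c₂` with root `a`; the variables of the region are
  also bound in `c₂` (for use in the domains of incremental instantiations of `x`) -/
  | letr (x : TermVar) (a : TyVar) (as : List TyVar) (c₁ c₂ : Constr)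
  /-- `∃ i^x. c` -/
  | exI (i : InstVar) (x : TermVar) (c : Constr)
  /-- incremental instantiation `i[b ↝ t]` -/
  | inst (i : InstVar) (b : TyVar) (t : Typ)
  /-- `l/T ≤ t₁ → t₂` for a record name variable `T` -/
  | labInst (l : Label) (T : RecVar) (t₁ t₂ : Typ)
  /-- `dom T = ls` for a record name variable `T` -/
  | domEq (T : RecVar) (ls : Finset Label)
  /-- `s ≤ t` for a scheme variable `s` -/
  | schLe (s : SchVar) (t : Typ)
  /-- `x ≤ s` for a scheme variable `s` -/
  | leSch (x : TermVar) (s : SchVar)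

inductive Branches where
  | nil
  | cons (p : Pat) (c : Constr) (bs : Branches)
end

def tyNames (t : Typ) : Finset Name := t.fv.image Name.tv

mutual
/-- Free names of all sorts. -/
def Constr.fv : Constr → Finset Name
  | .tru => ∅
  | .fls => ∅
  | .and c₁ c₂ => c₁.fv ∪ c₂.fv
  | .ex a c => c.fv \ {.tv a}
  | .all a c => c.fv \ {.tv a}
  | .eqn e => e.fv.image Name.tv
  | .letc x a c₁ c₂ => (c₁.fv \ {.tv a}) ∪ (c₂.fv \ {.tm x})
  | .app x t => insert (.tm x) (tyNames t)
  | .mtch t bs => tyNames t ∪ bs.fv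
  | .letr x a as c₁ c₂ => (c₁.fv ∪ (c₂.fv \ {.tm x})) \ tvs (a :: as)
  | .exI i x c => insert (.tm x) (c.fv \ {.iv i})
  | .inst i b t => insert (.iv i) (insert (.tv b) (tyNames t))
  | .labInst _ T t₁ t₂ => insert (.rv T) (tyNames t₁ ∪ tyNames t₂)
  | .domEq T _ => {.rv T}
  | .schLe s t => insert (.sv s) (tyNames t)
  | .leSch x s => {.tm x, .sv s}

def Branches.fv : Branches → Finset Name
  | .nil => ∅
  | .cons p c bs => (c.fv \ p.bn) ∪ bs.fv
end

mutual
/-- Names bound somewhere inside a constraint. -/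
def Constr.bn : Constr → Finset Name
  | .tru => ∅
  | .fls => ∅
  | .and c₁ c₂ => c₁.bn ∪ c₂.bn
  | .ex a c => insert (.tv a) c.bn
  | .all a c => insert (.tv a) c.bn
  | .eqn _ => ∅
  | .letc x a c₁ c₂ => {.tm x, .tv a} ∪ c₁.bn ∪ c₂.bn
  | .app _ _ => ∅
  | .mtch _ bs => bs.bn
  | .letr x a as c₁ c₂ => insert (.tm x) (tvs (a :: as)) ∪ c₁.bn ∪ c₂.bn
  | .exI i _ c => insert (.iv i) c.bn
  | .inst _ _ _ => ∅
  | .labInst _ _ _ _ => ∅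
  | .domEq _ _ => ∅
  | .schLe _ _ => ∅
  | .leSch _ _ => ∅

def Branches.bn : Branches → Finset Name
  | .nil => ∅
  | .cons p c bs => p.bn ∪ c.bn ∪ bs.bn
end

mutual
/-- Renaming of all names, free and bound. -/
def Constr.map (ρ : NameMap) : Constr → Constr
  | .tru => .tru
  | .fls => .fls
  | .and c₁ c₂ => .and (c₁.map ρ) (c₂.map ρ)
  | .ex a c => .ex (ρ.tv a) (c.map ρ)
  | .all a c => .all (ρ.tv a) (c.map ρ)
  | .eqn e => .eqn (Multiset.map (Ty.rename ρ.tv) e)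
  | .letc x a c₁ c₂ => .letc (ρ.tm x) (ρ.tv a) (c₁.map ρ) (c₂.map ρ)
  | .app x t => .app (ρ.tm x) (t.rename ρ.tv)
  | .mtch t bs => .mtch (t.rename ρ.tv) (bs.map ρ)
  | .letr x a as c₁ c₂ => .letr (ρ.tm x) (ρ.tv a) (as.map ρ.tv) (c₁.map ρ) (c₂.map ρ)
  | .exI i x c => .exI (ρ.iv i) (ρ.tm x) (c.map ρ)
  | .inst i b t => .inst (ρ.iv i) (ρ.tv b) (t.rename ρ.tv)
  | .labInst l T t₁ t₂ => .labInst l (ρ.rv T) (t₁.rename ρ.tv) (t₂.rename ρ.tv)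
  | .domEq T ls => .domEq (ρ.rv T) ls
  | .schLe s t => .schLe (ρ.sv s) (t.rename ρ.tv)
  | .leSch x s => .leSch (ρ.tm x) (ρ.sv s)

def Branches.map (ρ : NameMap) : Branches → Branches
  | .nil => .nil
  | .cons p c bs => .cons (p.map ρ) (c.map ρ) (bs.map ρ)
end

def Constr.swap (u v : Name) (c : Constr) : Constr := c.map (NameMap.swap u v)

def Pat.swap (u v : Name) (p : Pat) : Pat := p.map (NameMap.swap u v)

/-- `∃ as. c` -/
def Constr.exs (as : List TyVar) (c : Constr) : Constr := as.foldr Constr.ex c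

/-- `∀ as. c` -/
def Constr.alls (as : List TyVar) (c : Constr) : Constr := as.foldr Constr.all c

/-- The conjunction of a list; the empty conjunction is `true`. -/
def Constr.conj : List Constr → Constr
  | [] => .tru
  | [c] => c
  | c :: d :: cs => .and c (Constr.conj (d :: cs))

/-- The equation `t₁ = t₂`. -/
def Constr.eq (t₁ t₂ : Typ) : Constr := .eqn {t₁, t₂}

/-! ## Substitutions -/

def Ty.subst1 (b g : TyVar) (t : Typ) : Typ := t.rename (fun a => if a = b then g else a)

mutual
/-- `c[b := g]`: replaces the free occurrences of `b`. It is only used where `g` is not bound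
inside the constraint, so that no capture can happen. -/
def Constr.subst (b g : TyVar) : Constr → Constr
  | .tru => .tru
  | .fls => .fls
  | .and c₁ c₂ => .and (c₁.subst b g) (c₂.subst b g)
  | .ex a c => .ex a (if a = b then c else c.subst b g)
  | .all a c => .all a (if a = b then c else c.subst b g)
  | .eqn e => .eqn (Multiset.map (Ty.subst1 b g) e)
  | .letc x a c₁ c₂ => .letc x a (if a = b then c₁ else c₁.subst b g) (c₂.subst b g)
  | .app x t => .app x (t.subst1 b g)
  | .mtch t bs => .mtch (t.subst1 b g) (bs.subst b g)
  | .letr x a as c₁ c₂ =>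
      if b ∈ a :: as then .letr x a as c₁ c₂
      else .letr x a as (c₁.subst b g) (c₂.subst b g)
  | .exI i x c => .exI i x (c.subst b g)
  | .inst i d t => .inst i (if d = b then g else d) (t.subst1 b g)
  | .labInst l T t₁ t₂ => .labInst l T (t₁.subst1 b g) (t₂.subst1 b g)
  | .domEq T ls => .domEq T ls
  | .schLe s t => .schLe s (t.subst1 b g)
  | .leSch x s => .leSch x s

def Branches.subst (b g : TyVar) : Branches → Branches
  | .nil => .nil
  | .cons p c bs => .cons p (if .tv b ∈ p.bn then c else c.subst b g) (bs.subst b g)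
end

/-- `l/T ≤ t₁ → t₂` for a record name `T`. -/
def labInstOf (env : LabelEnv) (l : Label) (T : RecName) (t₁ t₂ : Typ) : Constr :=
  match env T l with
  | none => .fls
  | some ⟨n, t⟩ =>
      let as : Fin n → TyVar := fun i => fresh (t₁.fv ∪ t₂.fv) i
      .exs (List.ofFn as)
        (.and (.eq t₁ (.con (.rcd T n) (fun i => .var (as i)))) (.eq t₂ (t.bind (fun i => .var (as i)))))

open Classical in
/-- `dom T = ls` for a record name `T`. -/
noncomputable def domEqOf (env : LabelEnv) (T : RecName) (ls : Finset Label) : Constr :=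
  if ∀ l, l ∈ ls ↔ (env T l).isSome then .tru else .fls

/-- `(∀ as. t') ≤ t`, that is `∃ as. t' = t`. -/
def schLeOf (σ : Scheme) (t : Typ) : Constr :=
  let as : Fin σ.arity → TyVar := fun i => fresh (σ.body.fv ∪ t.fv) i
  .exs (List.ofFn as) (.eq (σ.inst (fun i => .var (as i))) t)

/-- `x ≤ (∀ as. t')`, that is `∀ as. x t'`. -/
def leSchOf (x : TermVar) (σ : Scheme) : Constr :=
  let as : Fin σ.arity → TyVar := fun i => fresh σ.body.fv i
  .alls (List.ofFn as) (.app x (σ.inst (fun i => .var (as i))))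

mutual
/-- Substitution of a record name for a record name variable. -/
noncomputable def Constr.substRec (env : LabelEnv) (R : RecVar) (T : RecName) : Constr → Constr
  | .tru => .tru
  | .fls => .fls
  | .and c₁ c₂ => .and (c₁.substRec env R T) (c₂.substRec env R T)
  | .ex a c => .ex a (c.substRec env R T)
  | .all a c => .all a (c.substRec env R T)
  | .eqn e => .eqn e
  | .letc x a c₁ c₂ => .letc x a (c₁.substRec env R T) (c₂.substRec env R T)
  | .app x t => .app x t
  | .mtch t bs => .mtch t (bs.substRec env R T)
  | .letr x a as c₁ c₂ => .letr x a as (c₁.substRec env R T) (c₂.substRec env R T)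
  | .exI i x c => .exI i x (c.substRec env R T)
  | .inst i d t => .inst i d t
  | .labInst l R' t₁ t₂ => if R' = R then labInstOf env l T t₁ t₂ else .labInst l R' t₁ t₂
  | .domEq R' ls => if R' = R then domEqOf env T ls else .domEq R' ls
  | .schLe s t => .schLe s t
  | .leSch x s => .leSch x s

noncomputable def Branches.substRec (env : LabelEnv) (R : RecVar) (T : RecName) :
    Branches → Branches
  | .nil => .nil
  | .cons p c bs =>
      .cons p (if .rv R ∈ p.bn then c else c.substRec env R T) (bs.substRec env R T)
end

mutual
/-- Substitution of a scheme for a scheme variable. It is only used where the free variables of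
the scheme are not bound inside the constraint. -/
def Constr.substSch (S : SchVar) (σ : Scheme) : Constr → Constr
  | .tru => .tru
  | .fls => .fls
  | .and c₁ c₂ => .and (c₁.substSch S σ) (c₂.substSch S σ)
  | .ex a c => .ex a (c.substSch S σ)
  | .all a c => .all a (c.substSch S σ)
  | .eqn e => .eqn e
  | .letc x a c₁ c₂ => .letc x a (c₁.substSch S σ) (c₂.substSch S σ)
  | .app x t => .app x t
  | .mtch t bs => .mtch t (bs.substSch S σ)
  | .letr x a as c₁ c₂ => .letr x a as (c₁.substSch S σ) (c₂.substSch S σ)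
  | .exI i x c => .exI i x (c.substSch S σ)
  | .inst i d t => .inst i d t
  | .labInst l R t₁ t₂ => .labInst l R t₁ t₂
  | .domEq R ls => .domEq R ls
  | .schLe s t => if s = S then schLeOf σ t else .schLe s t
  | .leSch x s => if s = S then leSchOf x σ else .leSch x s

def Branches.substSch (S : SchVar) (σ : Scheme) : Branches → Branches
  | .nil => .nil
  | .cons p c bs => .cons p (if .sv S ∈ p.bn then c else c.substSch S σ) (bs.substSch S σ)
end

/-! ## Structural equivalence -/

/-- Equality of constraints modulo `α`-conversion, associativity and commutativity of conjunction,
and permutation of the auxiliary variables of a region. -/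
inductive Constr.Equiv : Constr → Constr → Prop where
  | refl (c : Constr) : Equiv c c
  | symm {c d : Constr} : Equiv c d → Equiv d c
  | trans {c d e : Constr} : Equiv c d → Equiv d e → Equiv c e
  -- associativity, commutativity, permutation of regions
  | and_comm (c d : Constr) : Equiv (.and c d) (.and d c)
  | and_assoc (c d e : Constr) : Equiv (.and (.and c d) e) (.and c (.and d e))
  | region_perm {x : TermVar} {a : TyVar} {as bs : List TyVar} {c d : Constr} :
      as.Perm bs → Equiv (.letr x a as c d) (.letr x a bs c d)
  -- conversion of bound names
  | alpha_ex {a b : TyVar} {c : Constr} :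
      .tv b ∉ c.fv → Equiv (.ex a c) (.ex b (c.swap (.tv a) (.tv b)))
  | alpha_all {a b : TyVar} {c : Constr} :
      .tv b ∉ c.fv → Equiv (.all a c) (.all b (c.swap (.tv a) (.tv b)))
  | alpha_letc_tv {x : TermVar} {a b : TyVar} {c d : Constr} :
      .tv b ∉ c.fv → Equiv (.letc x a c d) (.letc x b (c.swap (.tv a) (.tv b)) d)
  | alpha_letc_tm {x y : TermVar} {a : TyVar} {c d : Constr} :
      .tm y ∉ d.fv → Equiv (.letc x a c d) (.letc y a c (d.swap (.tm x) (.tm y)))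
  | alpha_letr_tv {x : TermVar} {a u v : TyVar} {as : List TyVar} {c d : Constr} :
      u ∈ a :: as → v ∉ a :: as → .tv v ∉ c.fv → .tv v ∉ d.fv →
      Equiv (.letr x a as c d)
        (.letr x (_root_.Equiv.swap u v a) (as.map (_root_.Equiv.swap u v))
          (c.swap (.tv u) (.tv v)) (d.swap (.tv u) (.tv v)))
  | alpha_letr_tm {x y : TermVar} {a : TyVar} {as : List TyVar} {c d : Constr} :
      .tm y ∉ d.fv → Equiv (.letr x a as c d) (.letr y a as c (d.swap (.tm x) (.tm y)))
  | alpha_exI {i j : InstVar} {x : TermVar} {c : Constr} :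
      .iv j ∉ c.fv → Equiv (.exI i x c) (.exI j x (c.swap (.iv i) (.iv j)))
  | alpha_pat {t : Typ} {p : Pat} {c : Constr} {bs : Branches} {u v : Name} :
      u ∈ p.bn → v ∉ c.fv →
      Equiv (.mtch t (.cons p c bs)) (.mtch t (.cons (p.swap u v) (c.swap u v) bs))
  -- congruence
  | and {c c' d d' : Constr} : Equiv c c' → Equiv d d' → Equiv (.and c d) (.and c' d')
  | ex {a : TyVar} {c c' : Constr} : Equiv c c' → Equiv (.ex a c) (.ex a c')
  | all {a : TyVar} {c c' : Constr} : Equiv c c' → Equiv (.all a c) (.all a c')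
  | letc {x : TermVar} {a : TyVar} {c c' d d' : Constr} :
      Equiv c c' → Equiv d d' → Equiv (.letc x a c d) (.letc x a c' d')
  | letr {x : TermVar} {a : TyVar} {as : List TyVar} {c c' d d' : Constr} :
      Equiv c c' → Equiv d d' → Equiv (.letr x a as c d) (.letr x a as c' d')
  | exI {i : InstVar} {x : TermVar} {c c' : Constr} : Equiv c c' → Equiv (.exI i x c) (.exI i x c')
  | br_head {t : Typ} {p : Pat} {c c' : Constr} {bs : Branches} :
      Equiv c c' → Equiv (.mtch t (.cons p c bs)) (.mtch t (.cons p c' bs))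
  | br_tail {t : Typ} {p : Pat} {c : Constr} {bs bs' : Branches} :
      Equiv (.mtch t bs) (.mtch t bs') → Equiv (.mtch t (.cons p c bs)) (.mtch t (.cons p c bs'))

/-! ## Constraint contexts -/

inductive Ctx where
  | hole
  | andL (C : Ctx) (c : Constr)
  | andR (c : Constr) (C : Ctx)
  | ex (a : TyVar) (C : Ctx)
  | all (a : TyVar) (C : Ctx)
  | letcL (x : TermVar) (a : TyVar) (C : Ctx) (c : Constr)
  | letcR (x : TermVar) (a : TyVar) (c : Constr) (C : Ctx)
  | letrL (x : TermVar) (a : TyVar) (as : List TyVar) (C : Ctx) (c : Constr)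
  | letrR (x : TermVar) (a : TyVar) (as : List TyVar) (c : Constr) (C : Ctx)
  | exI (i : InstVar) (x : TermVar) (C : Ctx)

/-- Filling the hole with a constraint (names may be captured). -/
def Ctx.fill : Ctx → Constr → Constr
  | .hole, d => d
  | .andL C c, d => .and (C.fill d) c
  | .andR c C, d => .and c (C.fill d)
  | .ex a C, d => .ex a (C.fill d)
  | .all a C, d => .all a (C.fill d)
  | .letcL x a C c, d => .letc x a (C.fill d) c
  | .letcR x a c C, d => .letc x a c (C.fill d)
  | .letrL x a as C c, d => .letr x a as (C.fill d) c
  | .letrR x a as c C, d => .letr x a as c (C.fill d)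
  | .exI i x C, d => .exI i x (C.fill d)

/-- Filling the hole with a context. -/
def Ctx.comp : Ctx → Ctx → Ctx
  | .hole, D => D
  | .andL C c, D => .andL (C.comp D) c
  | .andR c C, D => .andR c (C.comp D)
  | .ex a C, D => .ex a (C.comp D)
  | .all a C, D => .all a (C.comp D)
  | .letcL x a C c, D => .letcL x a (C.comp D) c
  | .letcR x a c C, D => .letcR x a c (C.comp D)
  | .letrL x a as C c, D => .letrL x a as (C.comp D) c
  | .letrR x a as c C, D => .letrR x a as c (C.comp D)
  | .exI i x C, D => .exI i x (C.comp D)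

/-- The names bound at the hole. -/
def Ctx.bvs : Ctx → Finset Name
  | .hole => ∅
  | .andL C _ => C.bvs
  | .andR _ C => C.bvs
  | .ex a C => insert (.tv a) C.bvs
  | .all a C => insert (.tv a) C.bvs
  | .letcL _ a C _ => insert (.tv a) C.bvs
  | .letcR x _ _ C => insert (.tm x) C.bvs
  | .letrL _ a as C _ => tvs (a :: as) ∪ C.bvs
  | .letrR x a as _ C => insert (.tm x) (tvs (a :: as)) ∪ C.bvs
  | .exI i _ C => insert (.iv i) C.bvs

/-- The term variable `x` of the innermost binder `∃ i^x` of `i` above the hole, if any. -/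
def Ctx.owner (i : InstVar) : Ctx → Option TermVar
  | .hole => none
  | .andL C _ => C.owner i
  | .andR _ C => C.owner i
  | .ex _ C => C.owner i
  | .all _ C => C.owner i
  | .letcL _ _ C _ => C.owner i
  | .letcR _ _ _ C => C.owner i
  | .letrL _ _ _ C _ => C.owner i
  | .letrR _ _ _ _ C => C.owner i
  | .exI j x C => (C.owner i).or (if j = i then some x else none)

mutual
/-- The pairs `i(b)` such that an incremental instantiation `i[b ↝ t]` occurs. -/
def Constr.insts : Constr → Finset (InstVar × TyVar)
  | .tru => ∅
  | .fls => ∅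
  | .and c₁ c₂ => c₁.insts ∪ c₂.insts
  | .ex _ c => c.insts
  | .all _ c => c.insts
  | .eqn _ => ∅
  | .letc _ _ c₁ c₂ => c₁.insts ∪ c₂.insts
  | .app _ _ => ∅
  | .mtch _ bs => bs.insts
  | .letr _ _ _ c₁ c₂ => c₁.insts ∪ c₂.insts
  | .exI _ _ c => c.insts
  | .inst i b _ => {(i, b)}
  | .labInst _ _ _ _ => ∅
  | .domEq _ _ => ∅
  | .schLe _ _ => ∅
  | .leSch _ _ => ∅

def Branches.insts : Branches → Finset (InstVar × TyVar)
  | .nil => ∅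
  | .cons _ c bs => c.insts ∪ bs.insts
end

def Ctx.insts (C : Ctx) : Finset (InstVar × TyVar) := (C.fill .tru).insts

/-! ## Unification -/

/-- Unification problems. -/
def Constr.IsUnif : Constr → Prop
  | .tru => True
  | .fls => True
  | .and c d => c.IsUnif ∧ d.IsUnif
  | .ex _ c => c.IsUnif
  | .eqn _ => True
  | _ => False

/-- `c.Occurs a b` (written `a ≺ b`): the constraint `c` has, outside the scope of binders of `a`
and `b` and only under conjunctions and existentials, a multi-equation `b = t = e` such that `a` is
free in `t`. -/
inductive Constr.Occurs : Constr → TyVar → TyVar → Prop where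
  | eqn {a b : TyVar} {t : Typ} {e : MultiEq} :
      a ∈ t.fv → Occurs (.eqn (.var b ::ₘ t ::ₘ e)) a b
  | andL {c d : Constr} {a b : TyVar} : Occurs c a b → Occurs (.and c d) a b
  | andR {c d : Constr} {a b : TyVar} : Occurs d a b → Occurs (.and c d) a b
  | ex {c : Constr} {g a b : TyVar} : a ≠ g → b ≠ g → Occurs c a b → Occurs (.ex g c) a b

/-- Same as `Constr.Occurs`, with `t` not a variable. -/
inductive Constr.OccursProper : Constr → TyVar → TyVar → Prop where
  | eqn {a b : TyVar} {t : Typ} {e : MultiEq} :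
      a ∈ t.fv → ¬ t.IsVar → OccursProper (.eqn (.var b ::ₘ t ::ₘ e)) a b
  | andL {c d : Constr} {a b : TyVar} : OccursProper c a b → OccursProper (.and c d) a b
  | andR {c d : Constr} {a b : TyVar} : OccursProper d a b → OccursProper (.and c d) a b
  | ex {c : Constr} {g a b : TyVar} :
      a ≠ g → b ≠ g → OccursProper c a b → OccursProper (.ex g c) a b

/-- There is a cycle of `≺` that goes through a non-variable type (the equation `a = b` between two
variables is not a cycle). -/
def Constr.Cyclic (c : Constr) : Prop :=
  ∃ a b, c.OccursProper a b ∧ Relation.ReflTransGen c.Occurs b a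

/-- The rules of the unification algorithm. -/
inductive URule : Constr → Constr → Prop where
  | exists_ {a : TyVar} {u₁ u₂ : Constr} :
      .tv a ∉ u₂.fv → URule (.and (.ex a u₁) u₂) (.ex a (.and u₁ u₂))
  | cycle {u : Constr} : u.Cyclic → URule u .fls
  | true_ {u : Constr} : URule (.and u .tru) u
  | false_ {U : Ctx} : U ≠ .hole → URule (U.fill .fls) .fls
  | merge {a : TyVar} {e₁ e₂ : MultiEq} :
      URule (.and (.eqn (.var a ::ₘ e₁)) (.eqn (.var a ::ₘ e₂))) (.eqn (.var a ::ₘ (e₁ + e₂)))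
  | stutter {a : TyVar} {e : MultiEq} :
      URule (.eqn (.var a ::ₘ .var a ::ₘ e)) (.eqn (.var a ::ₘ e))
  | name {s : Shape} {ts : Fin s.arity → Typ} {i : Fin s.arity} {a : TyVar} {e : MultiEq} :
      s.Canonical → ¬ (ts i).IsVar → (∀ j, j ≠ i → a ∉ (ts j).fv) → a ∉ e.fv →
      URule (.eqn (s.apply ts ::ₘ e))
        (.ex a (.and (.eq (.var a) (ts i))
          (.eqn (s.apply (Function.update ts i (.var a)) ::ₘ e))))
  | decomp {s : Shape} {as bs : Fin s.arity → TyVar} {e : MultiEq} :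
      s.Canonical →
      URule (.eqn (s.applyVars as ::ₘ s.applyVars bs ::ₘ e))
        (.conj (.eqn (s.applyVars as ::ₘ e) ::
          List.ofFn (fun i => Constr.eq (.var (as i)) (.var (bs i)))))
  | clash {s s' : Shape} {as : Fin s.arity → TyVar} {bs : Fin s'.arity → TyVar} {e : MultiEq} :
      s.Canonical → s'.Canonical → s ≠ s' →
      URule (.eqn (s.applyVars as ::ₘ s'.applyVars bs ::ₘ e)) .fls
  | trivial {e : MultiEq} : Multiset.card e ≤ 1 → URule (.eqn e) .tru

/-- One step of the unifier: a rule applied to a unification problem, under a context and modulo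
structural equivalence. (All contexts around a part of a unification problem consist of
conjunctions and existentials.) -/
def Unif (u v : Constr) : Prop :=
  u.IsUnif ∧ ∃ (U : Ctx) (u' v' : Constr), u.Equiv (U.fill u') ∧ URule u' v' ∧ (U.fill v').Equiv v

/-! ## Side conditions of the solver -/

/-- Satisfaction of a multi-equation under an assignment of ground types. -/
def MultiEq.Sat (φ : TyVar → Ground) (e : MultiEq) : Prop :=
  ∃ g : Ground, ∀ t ∈ e, Ty.bind φ t = g

/-- `∃ as. ⋀ es ≡ true`: every assignment can be changed on `as` so as to satisfy all of `es`. -/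
def AlwaysSat (as : List TyVar) (es : List MultiEq) : Prop :=
  ∀ φ : TyVar → Ground, ∃ φ' : TyVar → Ground, (∀ a, a ∉ as → φ' a = φ a) ∧ ∀ e ∈ es, e.Sat φ'

/-- `⊢ (∃ bs. c) determines as`. -/
inductive Determines (bs : List TyVar) : Constr → List TyVar → Prop where
  | dom {cs : List Constr} {g : TyVar} {e : MultiEq} {as : List TyVar} :
      g ∉ bs → g ∉ as → (∀ a ∈ as, a ∈ e.fv) →
      Determines bs (.conj (cs ++ [.eqn (.var g ::ₘ e)])) as
  | esc {cs : List Constr} {t : Typ} {e : MultiEq} {as : List TyVar} :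
      (∀ a ∈ as, a ∉ t.fv) → (∀ b ∈ bs, b ∉ t.fv) →
      Determines bs (.conj (cs ++ [.eqn ((as.map Ty.var : List Typ) + (t ::ₘ e))])) as

/-- `⊢ C[t ! s]`: in the context `C` the type `t` provably has the unique shape `s`. -/
inductive Unicity : Ctx → Typ → Shape → Prop where
  | type {C : Ctx} {t : Typ} {s : Shape} : ¬ t.IsVar → s.IsShapeOf t → Unicity C t s
  | var {C₁ C₂ : Ctx} {a : TyVar} {t : Typ} {e : MultiEq} {s : Shape} :
      .tv a ∉ C₂.bvs → ¬ t.IsVar → s.IsShapeOf t →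
      Unicity (C₁.comp (.andR (.eqn (.var a ::ₘ t ::ₘ e)) C₂)) (.var a) s
  | backProp {x : TermVar} {a : TyVar} {as : List TyVar} {C₁ C₂ : Ctx} {i : InstVar}
      {b g : TyVar} {s : Shape} :
      b ∈ a :: as → C₂.owner i = some x → .tm x ∉ C₂.bvs → .tv b ∉ C₂.bvs → .tv b ∉ C₁.bvs →
      Unicity (.letrR x a as (C₁.fill .tru) (C₂.comp (.andR (.inst i b (.var g)) .hole))) (.var g) s →
      Unicity (.letrL x a as C₁ (C₂.fill (.inst i b (.var g)))) (.var b) s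
  | equiv {C C' : Ctx} {t : Typ} {s : Shape} :
      (∀ c, (C.fill c).Equiv (C'.fill c)) → Unicity C' t s → Unicity C t s

/-- `PatMatch env s as p c d`: the pattern `p` matches the canonical shape `s` applied to the
variables `as`, with a substitution `θ` such that `θ(c) = d`. -/
inductive PatMatch (env : LabelEnv) (s : Shape) (as : Fin s.arity → TyVar) :
    Pat → Constr → Constr → Prop where
  | wild {c : Constr} : PatMatch env s as .wild c c
  | prod {b : TyVar} {j : Fin s.arity} {c : Constr} :
      s.body = .con (.prod s.arity) (fun i => .var i) →
      PatMatch env s as (.prod b (j + 1)) c (c.subst b (as j))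
  | rcd {R : RecVar} {T : RecName} {c : Constr} :
      s.body = .con (.rcd T s.arity) (fun i => .var i) →
      PatMatch env s as (.rcd R) c (c.substRec env R T)
  | poly {S : SchVar} {k : ℕ} {b : Ty (Fin s.arity) (0 + k)} {c : Constr} :
      s.body = .poly k b →
      PatMatch env s as (.poly S) c (c.substSch S ⟨k, b.rename as⟩)

/-- Some branch matches, and `d` is its instantiated body. -/
inductive BranchMatch (env : LabelEnv) (s : Shape) (as : Fin s.arity → TyVar) :
    Branches → Constr → Prop where
  | head {p : Pat} {c d : Constr} {bs : Branches} :
      PatMatch env s as p c d → BranchMatch env s as (.cons p c bs) d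
  | tail {p : Pat} {c d : Constr} {bs : Branches} :
      BranchMatch env s as bs d → BranchMatch env s as (.cons p c bs) d

/-- `d` is the discharged form, for the shape `s`, of the suspended constraint on `t` with
branches `bs`. -/
inductive Discharge (env : LabelEnv) (t : Typ) (s : Shape) (bs : Branches) : Constr → Prop where
  | some {as : Fin s.arity → TyVar} {d : Constr} :
      Function.Injective as → (∀ i, .tv (as i) ∉ tyNames t ∪ bs.fv ∪ bs.bn) →
      BranchMatch env s as bs d →
      Discharge env t s bs (.exs (List.ofFn as) (.and (.eq t (s.applyVars as)) d))
  | none : (∀ as d, ¬ BranchMatch env s as bs d) → Discharge env t s bs .fls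

/-! ## The constraint solver -/

/-- The rules of the solver. -/
inductive Rule (env : LabelEnv) : Constr → Constr → Prop where
  -- basic rules
  | unif {u v : Constr} : Unif u v → Rule env u v
  | true_ {c : Constr} : Rule env (.and c .tru) c
  | false_ {C : Ctx} : C ≠ .hole → Rule env (C.fill .fls) .fls
  | let_ {x : TermVar} {a : TyVar} {c₁ c₂ : Constr} :
      .tv a ∉ c₂.fv → Rule env (.letc x a c₁ c₂) (.letr x a [] c₁ c₂)
  | exists_conj {a : TyVar} {c₁ c₂ : Constr} :
      .tv a ∉ c₂.fv → Rule env (.and (.ex a c₁) c₂) (.ex a (.and c₁ c₂))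
  | let_exists_left {x : TermVar} {a b : TyVar} {as : List TyVar} {c₁ c₂ : Constr} :
      b ∉ a :: as → .tv b ∉ c₂.fv →
      Rule env (.letr x a as (.ex b c₁) c₂) (.letr x a (as ++ [b]) c₁ c₂)
  | let_exists_right {x : TermVar} {a b : TyVar} {as : List TyVar} {c₁ c₂ : Constr} :
      b ∉ a :: as → .tv b ∉ c₁.fv →
      Rule env (.letr x a as c₁ (.ex b c₂)) (.ex b (.letr x a as c₁ c₂))
  | let_conj_left {x : TermVar} {a : TyVar} {as : List TyVar} {c₁ c₂ c₃ : Constr} :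
      Disjoint c₁.fv (tvs (a :: as)) →
      Rule env (.letr x a as (.and c₁ c₂) c₃) (.and c₁ (.letr x a as c₂ c₃))
  | let_conj_right {x : TermVar} {a : TyVar} {as : List TyVar} {c₁ c₂ c₃ : Constr} :
      .tm x ∉ c₂.fv → Disjoint c₂.fv (tvs (a :: as)) →
      Rule env (.letr x a as c₁ (.and c₂ c₃)) (.and c₂ (.letr x a as c₁ c₃))
  -- suspended match constraints
  | match_ctx {C : Ctx} {t : Typ} {bs : Branches} {s : Shape} {d : Constr} :
      Unicity C t s → Discharge env t s bs d → Rule env (C.fill (.mtch t bs)) (C.fill d)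
  -- instantiations
  | inst_name {i : InstVar} {b g : TyVar} {t : Typ} :
      ¬ t.IsVar → g ≠ b → g ∉ t.fv →
      Rule env (.inst i b t) (.ex g (.and (.eq (.var g) t) (.inst i b (.var g))))
  | let_appR {x : TermVar} {a g : TyVar} {as : List TyVar} {i : InstVar} {c : Constr} {C : Ctx}
      {t : Typ} :
      g ≠ a → g ∉ t.fv → .tm x ∉ C.bvs → .tv a ∉ C.bvs →
      Rule env (.letr x a as c (C.fill (.app x t)))
        (.letr x a as c (C.fill
          (.ex g (.exI i x (.and (.inst i a (.var g)) (.eq (.var g) t))))))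
  | inst_copy {x : TermVar} {a b g : TyVar} {as : List TyVar} {cs : List Constr} {s : Shape}
      {bs bs' : Fin s.arity → TyVar} {e : MultiEq} {i : InstVar} {c : Constr} {C : Ctx} :
      c = .conj (cs ++ [.eqn (.var b ::ₘ s.applyVars bs ::ₘ e)]) →
      s.Canonical → b ∈ a :: as → ¬ c.Cyclic →
      Function.Injective bs' → (∀ j, bs' j ≠ b ∧ bs' j ≠ g ∧ ∀ k, bs' j ≠ bs k) →
      C.owner i = some x → .tm x ∉ C.bvs → .tv b ∉ C.bvs → (∀ j, .tv (bs j) ∉ C.bvs) →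
      Rule env (.letr x a as c (C.fill (.inst i b (.var g))))
        (.letr x a as c (C.fill
          (.exs (List.ofFn bs')
            (.conj (.eq (.var g) (s.applyVars bs') ::
              List.ofFn (fun j => Constr.inst i (bs j) (.var (bs' j))))))))
  | inst_unify {i : InstVar} {b g₁ g₂ : TyVar} :
      Rule env (.and (.inst i b (.var g₁)) (.inst i b (.var g₂)))
        (.and (.inst i b (.var g₁)) (.eq (.var g₁) (.var g₂)))
  | inst_poly {x : TermVar} {a b g : TyVar} {as : List TyVar} {es : List MultiEq}
      {cs : List Constr} {i : InstVar} {C : Ctx} :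
      b ∈ a :: as →
      -- `∀ b. ∃ (the other variables of the region). ⋀ es ≡ true`
      AlwaysSat ((a :: as).filter (· ≠ b)) es →
      (∀ c ∈ cs, .tv b ∉ c.fv) → (i, b) ∉ C.insts →
      C.owner i = some x → .tm x ∉ C.bvs → .tv b ∉ C.bvs →
      Rule env (.letr x a as (.conj (es.map Constr.eqn ++ cs)) (C.fill (.inst i b (.var g))))
        (.letr x a as (.conj (es.map Constr.eqn ++ cs)) (C.fill .tru))
  | inst_mono {x : TermVar} {a b g : TyVar} {as : List TyVar} {i : InstVar} {c : Constr} {C : Ctx} :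
      b ∉ a :: as → C.owner i = some x → .tm x ∉ C.bvs → .tv b ∉ C.bvs →
      Rule env (.letr x a as c (C.fill (.inst i b (.var g))))
        (.letr x a as c (C.fill (.eq (.var b) (.var g))))
  -- regional let-constraints
  | let_solve {x : TermVar} {a : TyVar} {as : List TyVar} {es : List MultiEq} {c : Constr} :
      AlwaysSat (a :: as) es → .tm x ∉ c.fv → Disjoint c.fv (tvs (a :: as)) →
      Rule env (.letr x a as (.conj (es.map Constr.eqn)) c) c
  | compress {x : TermVar} {a b g : TyVar} {as : List TyVar} {cs : List Constr} {e : MultiEq}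
      {c₂ : Constr} :
      b ≠ g → .tv g ∉ (Constr.conj cs).bn → .tv g ∉ c₂.bn →
      Rule env
        (.letr x a (as ++ [b]) (.conj (cs ++ [.eqn (.var b ::ₘ .var g ::ₘ e)])) c₂)
        (.letr x a as
          (.conj (cs.map (Constr.subst b g) ++
            [.eqn (.var g ::ₘ Multiset.map (Ty.subst1 b g) e)]))
          (c₂.subst b g))
  | gc {x : TermVar} {a b : TyVar} {as : List TyVar} {cs : List Constr} {e : MultiEq}
      {c₂ : Constr} :
      (∀ c ∈ cs, .tv b ∉ c.fv) → b ∉ e.fv → .tv b ∉ c₂.fv →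
      Rule env (.letr x a (as ++ [b]) (.conj (cs ++ [.eqn (.var b ::ₘ e)])) c₂)
        (.letr x a as (.conj (cs ++ [.eqn e])) c₂)
  | exists_lower {x : TermVar} {a : TyVar} {as bs : List TyVar} {c₁ c₂ : Constr} :
      bs ≠ [] → Determines (a :: as) c₁ bs →
      Rule env (.letr x a (as ++ bs) c₁ c₂) (.exs bs (.letr x a as c₁ c₂))
  -- binders of instantiation variables
  | exists_exists_inst {i : InstVar} {x : TermVar} {a : TyVar} {c : Constr} :
      Rule env (.exI i x (.ex a c)) (.ex a (.exI i x c))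
  | exists_inst_conj {i : InstVar} {x : TermVar} {c₁ c₂ : Constr} :
      .iv i ∉ c₁.fv → Rule env (.exI i x (.and c₁ c₂)) (.and c₁ (.exI i x c₂))
  | exists_inst_let {i : InstVar} {x x' : TermVar} {a : TyVar} {as : List TyVar}
      {c₁ c₂ : Constr} :
      x ≠ x' → .iv i ∉ c₁.fv →
      Rule env (.letr x a as c₁ (.exI i x' c₂)) (.exI i x' (.letr x a as c₁ c₂))
  | exists_inst_solve {i : InstVar} {x : TermVar} {c : Constr} :
      .iv i ∉ c.fv → Rule env (.exI i x c) c
  -- universal quantification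
  | all_conj {as bs : List TyVar} {c₁ c₂ : Constr} :
      as ≠ [] → Disjoint c₁.fv (tvs (as ++ bs)) →
      Rule env (.alls as (.exs bs (.and c₁ c₂))) (.and c₁ (.alls as (.exs bs c₂)))
  | exists_all {as bs gs l : List TyVar} {c : Constr} :
      as ≠ [] → gs ≠ [] → l.Perm (bs ++ gs) → gs.Disjoint (as ++ bs) →
      Determines (as ++ bs) c gs →
      Rule env (.alls as (.exs l c)) (.exs gs (.alls as (.exs bs c)))
  | all_escape {as bs : List TyVar} {a g : TyVar} {cs : List Constr} {es : List MultiEq} :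
      a ∈ as → a ∉ bs → g ≠ a → g ∉ bs →
      Relation.ReflTransGen (Constr.conj (es.map Constr.eqn)).Occurs a g →
      Rule env (.alls as (.exs bs (.conj (cs ++ es.map Constr.eqn)))) .fls
  | all_rigid {as bs : List TyVar} {a : TyVar} {cs : List Constr} {t : Typ} {e : MultiEq} :
      a ∈ as → a ∉ bs → ¬ t.IsVar →
      Rule env (.alls as (.exs bs (.conj (cs ++ [.eqn (.var a ::ₘ t ::ₘ e)])))) .fls
  | all_solve {as bs : List TyVar} {es : List MultiEq} :
      as ≠ [] → AlwaysSat bs es →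
      Rule env (.alls as (.exs bs (.conj (es.map Constr.eqn)))) .tru

/-- One step of the solver: a rule applied under an arbitrary constraint context, modulo
structural equivalence. -/
def Solve (env : LabelEnv) (c d : Constr) : Prop :=
  ∃ (C : Ctx) (c' d' : Constr), c.Equiv (C.fill c') ∧ Rule env c' d' ∧ (C.fill d').Equiv d

/-- There is no infinite rewriting sequence. -/
def Terminating {α : Type} (R : α → α → Prop) : Prop :=
  ¬ ∃ f : ℕ → α, ∀ n, R (f n) (f (n + 1))

end Omni

-- Every step decreases a constraint in a lexicographic order with four components: the number of
-- matches, the number of instantiations `x τ` and plain lets, a weight, and a number called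
-- `spread`. The first two components absorb the steps that release or create arbitrary material.
-- Discharging a match frees the body of a branch, expanding `x τ` creates an incremental
-- instantiation of unknown cost, and a plain let acquires a region.
--
-- The weight does the main work. It is a finite multiset of items (degree, potential, value,
-- depth), compared in the multiset order, so that one item pays for any number of smaller ones.
-- Each coordinate serves one family of rules. Depth counts the enclosing universals, let bodies and
-- binders `∃ i^x`, and drops when something is pulled out of them. Value measures types: a member
-- of size `n` of a multi-equation has value `3 + n`, and naming or decomposing a type replaces it
-- by smaller ones. Potential serves Copy. The potential of `i[β ↝ γ]` is the number of variables
-- lying below `β` in the definition of the region. Without a cycle it decreases strictly from `β`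
-- to the arguments of its shape (`Constr.pot_lt`). Equations have potential 0 and instantiations at
-- least 1, so Copy trades one item for smaller ones. Degree resolves the conflict that this
-- creates: potentials depend on the definition, so solving the definition may raise them in the
-- body. The definition is therefore placed at a degree above every item of the body
-- (`Constr.suppLt_wt`), and any progress in it outweighs the body (`letr_lt_of_def_lt`).
--
-- The delicate rule is Compress. Its substitution also acts on lets nested in the definition, where
-- it may identify two variables, close a cycle and raise potentials. For this reason each regional
-- let also counts the variables visible in its definition, by items just below the definition and
-- above the body. Either the substitution is injective on those variables and potentials do not
-- increase, or the count drops and pays for the body (`Constr.wt_subst_le`).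
--
-- Only the extension of an existential over a conjunct leaves the weight unchanged, and there
-- `spread` decreases. Finally, the order is invariant under structural equivalence
-- (`Constr.Equiv.same`) and stable under contexts (`Constr.Dec.fill`, by way of `Ctx.wt_fill_lt`),
-- and it is well-founded because the multiset order is.

namespace Omni

/-! ## Weights -/

/-- The elements that weights are made of, ordered lexicographically: a degree, a copying
potential, a value and a depth. -/
abbrev Item := ℕ ×ₗ ℕ∞ ×ₗ ℕ ×ₗ ℕ

def item (e : ℕ) (p : ℕ∞) (v k : ℕ) : Item := toLex (e, toLex (p, toLex (v, k)))

theorem item_lt_iff {e e' : ℕ} {p p' : ℕ∞} {v v' k k' : ℕ} :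
    item e p v k < item e' p' v' k' ↔
      e < e' ∨ e = e' ∧ (p < p' ∨ p = p' ∧ (v < v' ∨ v = v' ∧ k < k')) := by
  simp [item, Prod.Lex.toLex_lt_toLex]

theorem item_le_iff {e e' : ℕ} {p p' : ℕ∞} {v v' k k' : ℕ} :
    item e p v k ≤ item e' p' v' k' ↔
      e < e' ∨ e = e' ∧ (p < p' ∨ p = p' ∧ (v < v' ∨ v = v' ∧ k ≤ k')) := by
  simp [item, Prod.Lex.toLex_le_toLex]

theorem item_lt_of_degree_lt {e e' : ℕ} {p p' : ℕ∞} {v v' k k' : ℕ} (h : e < e') :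
    item e p v k < item e' p' v' k' :=
  item_lt_iff.2 (Or.inl h)

/-- Finite multisets of items in the multiset order. -/
abbrev Wt := Colex (Item →₀ ℕ)

noncomputable def unit (z : Item) : Wt := toColex (Finsupp.single z 1)

theorem unit_lt {y z : Item} (h : y < z) : unit y < unit z := Finsupp.Colex.single_strictMono h

theorem unit_le {y z : Item} (h : y ≤ z) : unit y ≤ unit z :=
  Finsupp.Colex.single_strictMono.monotone h

theorem wt_nonneg (w : Wt) : 0 ≤ w := zero_le

theorem unit_pos (z : Item) : 0 < unit z :=
  lt_of_le_of_ne (wt_nonneg _) fun h => by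
    have := congrArg (fun w : Wt => ofColex w z) h
    simp [unit] at this

/-- All items of the weight are below `z`. -/
def SuppLt (z : Item) (w : Wt) : Prop := ∀ y, z ≤ y → ofColex w y = 0

/-- All items of the weight are at least `z`. -/
def SuppGe (z : Item) (w : Wt) : Prop := ∀ y, y < z → ofColex w y = 0

theorem SuppLt.zero {z : Item} : SuppLt z 0 := fun _ _ => rfl

theorem SuppLt.add {z : Item} {u w : Wt} (hu : SuppLt z u) (hw : SuppLt z w) :
    SuppLt z (u + w) := fun y hy => by
  simp [hu y hy, hw y hy]

theorem SuppLt.unit {y z : Item} (h : y < z) : SuppLt z (unit y) := fun x hx => by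
  have : y ≠ x := (h.trans_le hx).ne
  simp [Omni.unit, this]

theorem SuppLt.nsmul {z : Item} {w : Wt} (n : ℕ) (h : SuppLt z w) : SuppLt z (n • w) := by
  induction n with
  | zero => rw [zero_nsmul]; exact SuppLt.zero
  | succ n ih => rw [succ_nsmul]; exact ih.add h

theorem SuppLt.mono {y z : Item} {w : Wt} (h : SuppLt y w) (hyz : y ≤ z) : SuppLt z w :=
  fun x hx => h x (hyz.trans hx)

theorem SuppLt.sum {z : Item} {s : Multiset Wt} (h : ∀ w ∈ s, SuppLt z w) : SuppLt z s.sum := by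
  induction s using Multiset.induction_on with
  | empty => exact SuppLt.zero
  | cons a s ih =>
    rw [Multiset.sum_cons]
    exact (h a (by simp)).add (ih fun w hw => h w (by simp [hw]))

theorem SuppGe.zero {z : Item} : SuppGe z 0 := fun _ _ => rfl

theorem SuppGe.add {z : Item} {u w : Wt} (hu : SuppGe z u) (hw : SuppGe z w) :
    SuppGe z (u + w) := fun y hy => by
  simp [hu y hy, hw y hy]

theorem SuppGe.unit {y z : Item} (h : z ≤ y) : SuppGe z (unit y) := fun x hx => by
  have : y ≠ x := (hx.trans_le h).ne'
  simp [Omni.unit, this]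

theorem SuppGe.nsmul {z : Item} {w : Wt} (n : ℕ) (h : SuppGe z w) : SuppGe z (n • w) := by
  induction n with
  | zero => rw [zero_nsmul]; exact SuppGe.zero
  | succ n ih => rw [succ_nsmul]; exact ih.add h

theorem SuppGe.mono {y z : Item} {w : Wt} (h : SuppGe z w) (hyz : y ≤ z) : SuppGe y w :=
  fun x hx => h x (hx.trans_le hyz)

theorem SuppGe.sum {z : Item} {s : Multiset Wt} (h : ∀ w ∈ s, SuppGe z w) : SuppGe z s.sum := by
  induction s using Multiset.induction_on with
  | empty => exact SuppGe.zero
  | cons a s ih =>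
    rw [Multiset.sum_cons]
    exact (h a (by simp)).add (ih fun w hw => h w (by simp [hw]))

/-- One item outweighs any number of smaller ones. Naming, decomposition and Copy all decrease for
this reason. -/
theorem SuppLt.lt_unit {z : Item} {w : Wt} (h : SuppLt z w) : w < Omni.unit z := by
  refine Finsupp.Colex.lt_iff.2 ⟨z, fun y hy => ?_, ?_⟩
  · rw [h y hy.le]
    simp [Omni.unit, hy.ne]
  · rw [h z le_rfl]
    simp [Omni.unit]

/-- A decrease above `z` outweighs anything below `z`. -/
theorem add_lt_of_suppLt {z : Item} {a a' b : Wt} (ha : SuppGe z a) (h : a' < a)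
    (hb : SuppLt z b) : a' + b < a := by
  obtain ⟨y, hy, hlt⟩ := Finsupp.Colex.lt_iff.1 h
  -- The largest item `y` at which the two weights differ has positive multiplicity in `a`, so it is
  -- at least `z` and `b` cannot disturb the comparison there or above.
  have hz : z ≤ y := by
    by_contra hyz
    rw [ha y (not_le.1 hyz)] at hlt
    exact absurd hlt (Nat.not_lt_zero _)
  refine Finsupp.Colex.lt_iff.2 ⟨y, fun x hx => ?_, ?_⟩
  · have := hb x (hz.trans hx.le)
    simp [hy x hx, this]
  · have := hb y hz
    simpa [this] using hlt

theorem nsmul_unit_lt {z : Item} {m n : ℕ} (h : m < n) : m • unit z < n • unit z :=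
  nsmul_lt_nsmul_left (unit_pos z) h

theorem nsmul_wt_le {u w : Wt} {m n : ℕ} (h : m ≤ n) (huw : u ≤ w) : m • u ≤ n • w :=
  (nsmul_le_nsmul_left (wt_nonneg u) h).trans (nsmul_le_nsmul_right huw n)

/-! ## Potentials of variables -/

/-- `a` lies below `b` in the preorder generated by `R`, with a step in `P` in between. -/
def RelBelow (R P : TyVar → TyVar → Prop) (a b : TyVar) : Prop :=
  ∃ u v, Relation.ReflTransGen R a u ∧ P u v ∧ Relation.ReflTransGen R v b

open Classical in
/-- The number of variables below `b`, or `⊤` if there is a cycle. -/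
noncomputable def relPot (R P : TyVar → TyVar → Prop) (b : TyVar) : ℕ∞ :=
  if ∃ a, RelBelow R P a a then ⊤ else {a | RelBelow R P a b}.encard

/-- Chains lift step by step: two consecutive lifted steps share their endpoint because preimages in
`V` are unique. -/
theorem RelBelow.push {R P R' P' : TyVar → TyVar → Prop} {f : TyVar → TyVar} {V : Set TyVar}
    (hR : ∀ a b, R' a b → ∃ a₀ ∈ V, ∃ b₀ ∈ V, R a₀ b₀ ∧ f a₀ = a ∧ f b₀ = b)
    (hP : ∀ a b, P' a b → ∃ a₀ ∈ V, ∃ b₀ ∈ V, P a₀ b₀ ∧ f a₀ = a ∧ f b₀ = b)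
    (hf : V.InjOn f) {a b : TyVar} (h : RelBelow R' P' a b) :
    ∃ a₀ ∈ V, ∃ b₀ ∈ V, RelBelow R P a₀ b₀ ∧ f a₀ = a ∧ f b₀ = b := by
  obtain ⟨u, v, hau, huv, hvb⟩ := h
  obtain ⟨u₀, hu₀, v₀, hv₀, h₀, rfl, rfl⟩ := hP _ _ huv
  have h1 : ∃ a₀ ∈ V, Relation.ReflTransGen R a₀ u₀ ∧ f a₀ = a := by
    induction hau using Relation.ReflTransGen.head_induction_on with
    | refl => exact ⟨u₀, hu₀, .refl, rfl⟩
    | head hac _ ih =>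
      obtain ⟨c₀, hc₀, hcu, rfl⟩ := ih
      obtain ⟨x, hx, y, hy, hxy, rfl, hyc⟩ := hR _ _ hac
      obtain rfl := hf hy hc₀ hyc
      exact ⟨x, hx, .head hxy hcu, rfl⟩
  have h2 : ∃ b₀ ∈ V, Relation.ReflTransGen R v₀ b₀ ∧ f b₀ = b := by
    induction hvb with
    | refl => exact ⟨v₀, hv₀, .refl, rfl⟩
    | tail _ hcb ih =>
      obtain ⟨c₀, hc₀, hvc, rfl⟩ := ih
      obtain ⟨x, hx, y, hy, hxy, hxc, rfl⟩ := hR _ _ hcb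
      obtain rfl := hf hx hc₀ hxc
      exact ⟨y, hy, .tail hvc hxy, rfl⟩
  obtain ⟨a₀, ha₀, hau₀, rfl⟩ := h1
  obtain ⟨b₀, hb₀, hvb₀, rfl⟩ := h2
  exact ⟨a₀, ha₀, b₀, hb₀, ⟨_, _, hau₀, h₀, hvb₀⟩, rfl, rfl⟩

/-- Cycles lift to cycles, and what lies below `b'` is in the image of what lies below `b`.
Injectivity is asked only on `V` so that this covers substitutions as well as renamings. -/
theorem relPot_push_le {R P R' P' : TyVar → TyVar → Prop} {f : TyVar → TyVar} {V : Set TyVar}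
    (hR : ∀ a b, R' a b → ∃ a₀ ∈ V, ∃ b₀ ∈ V, R a₀ b₀ ∧ f a₀ = a ∧ f b₀ = b)
    (hP : ∀ a b, P' a b → ∃ a₀ ∈ V, ∃ b₀ ∈ V, P a₀ b₀ ∧ f a₀ = a ∧ f b₀ = b)
    (hf : V.InjOn f) {b b' : TyVar} (hb : ∀ b₀ ∈ V, f b₀ = b' → b₀ = b) :
    relPot R' P' b' ≤ relPot R P b := by
  classical
  have hpush := @RelBelow.push R P R' P' f V hR hP hf
  by_cases hc : ∃ a, RelBelow R P a a
  · simp [relPot, hc]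
  · have hc' : ¬ ∃ a, RelBelow R' P' a a := by
      rintro ⟨a, ha⟩
      obtain ⟨a₀, ha₀, b₀, hb₀, h, rfl, hba⟩ := hpush ha
      obtain rfl := hf hb₀ ha₀ hba
      exact hc ⟨_, h⟩
    rw [relPot, relPot, if_neg hc, if_neg hc']
    refine (Set.encard_le_encard ?_).trans (Set.encard_image_le f _)
    intro a ha
    obtain ⟨a₀, ha₀, b₀, hb₀, h, rfl, hba⟩ := hpush ha
    obtain rfl := hb _ hb₀ hba
    exact ⟨a₀, h, rfl⟩

theorem relPot_mono {R P R' P' : TyVar → TyVar → Prop} (hR : ∀ a b, R' a b → R a b)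
    (hP : ∀ a b, P' a b → P a b) (b : TyVar) : relPot R' P' b ≤ relPot R P b :=
  relPot_push_le (f := id) (V := Set.univ)
    (fun a b h => ⟨a, trivial, b, trivial, hR _ _ h, rfl, rfl⟩)
    (fun a b h => ⟨a, trivial, b, trivial, hP _ _ h, rfl, rfl⟩)
    (Set.injOn_id _) (fun _ _ h => h)

/-- What lies below `a` lies below `b`, whereas `a` itself lies below `b` but, without cycles, not
below `a`. Finiteness turns this strict inclusion into a strict inequality of cardinals. -/
theorem relPot_lt {R P : TyVar → TyVar → Prop} (hPR : ∀ a b, P a b → R a b) {V : Set TyVar}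
    (hV : V.Finite) (hRV : ∀ a b, R a b → a ∈ V) (hc : ¬ ∃ a, RelBelow R P a a) {a b : TyVar}
    (h : P a b) : relPot R P a < relPot R P b := by
  classical
  rw [relPot, relPot, if_neg hc, if_neg hc]
  have hfin : {c | RelBelow R P c a}.Finite := by
    refine hV.subset ?_
    rintro c ⟨u, v, hcu, huv, -⟩
    rcases hcu.cases_head with rfl | ⟨d, hcd, -⟩
    · exact hRV _ _ (hPR _ _ huv)
    · exact hRV _ _ hcd
  refine hfin.encard_lt_encard ⟨?_, fun hsub => ?_⟩
  · rintro c ⟨u, v, hcu, huv, hva⟩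
    exact ⟨u, v, hcu, huv, hva.tail (hPR _ _ h)⟩
  · exact hc ⟨a, hsub ⟨a, b, .refl, h, .refl⟩⟩

/-- Induction on constraints that does not enter the branches of match constraints. -/
@[elab_as_elim]
theorem Constr.ind {motive : Constr → Prop} (tru : motive .tru) (fls : motive .fls)
    (and : ∀ c d, motive c → motive d → motive (.and c d))
    (ex : ∀ a c, motive c → motive (.ex a c)) (all : ∀ a c, motive c → motive (.all a c))
    (eqn : ∀ E, motive (.eqn E))
    (letc : ∀ x a c d, motive c → motive d → motive (.letc x a c d))
    (app : ∀ x t, motive (.app x t)) (mtch : ∀ t bs, motive (.mtch t bs))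
    (letr : ∀ x a as c d, motive c → motive d → motive (.letr x a as c d))
    (exI : ∀ i x c, motive c → motive (.exI i x c)) (inst : ∀ i b t, motive (.inst i b t))
    (labInst : ∀ l T t₁ t₂, motive (.labInst l T t₁ t₂))
    (domEq : ∀ T ls, motive (.domEq T ls)) (schLe : ∀ s t, motive (.schLe s t))
    (leSch : ∀ x s, motive (.leSch x s)) (c : Constr) : motive c :=
  Constr.rec (motive_1 := motive) (motive_2 := fun _ => True) tru fls and ex all eqn letc app
    (fun t bs _ => mtch t bs) letr exI inst labInst domEq schLe leSch trivial
    (fun _ _ _ _ _ => trivial) c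

/-! ## Sizes of types -/

/-- The number of nodes of a type, free variables excepted. -/
def Ty.size {V : Type} : {n : ℕ} → Ty V n → ℕ
  | _, .var _ => 0
  | _, .bvar _ => 1
  | _, .con _ args => 1 + ∑ i, (args i).size
  | _, .poly _ body => 1 + body.size

theorem Ty.size_mapB {V : Type} {m : ℕ} (t : Ty V m) :
    ∀ {n : ℕ} (ρ : Fin m → Fin n), (t.mapB ρ).size = t.size := by
  induction t with
  | var a => intros; rfl
  | bvar i => intros; rfl
  | con c args ih => intro n ρ; simp [Ty.mapB, Ty.size, ih]
  | poly k body ih => intro n ρ; simp [Ty.mapB, Ty.size, ih]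

theorem Ty.size_bind {V W : Type} (f : V → Ty W 0) {n : ℕ} (t : Ty V n) :
    (t.bind f).size = t.size + (t.occ.map fun a => (f a).size).sum := by
  induction t with
  | var a => simp [Ty.bind, Ty.size, Ty.occ, Ty.size_mapB]
  | bvar i => simp [Ty.bind, Ty.size, Ty.occ]
  | con c args ih =>
    simp only [Ty.bind, Ty.size, ih, Ty.occ, List.map_flatten, List.sum_flatten, List.map_ofFn,
      List.sum_ofFn, Finset.sum_add_distrib, Function.comp_def]
    ring
  | poly k body ih => simp [Ty.bind, Ty.size, Ty.occ, ih, add_assoc]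

theorem Ty.size_rename {V W : Type} (f : V → W) {n : ℕ} (t : Ty V n) :
    (t.rename f).size = t.size := by
  simp [Ty.rename, Ty.size_bind, Ty.size]

theorem Ty.occ_mapB {V : Type} {m : ℕ} (t : Ty V m) :
    ∀ {n : ℕ} (ρ : Fin m → Fin n), (t.mapB ρ).occ = t.occ := by
  induction t with
  | var a => intros; rfl
  | bvar i => intros; rfl
  | con c args ih => intro n ρ; simp [Ty.mapB, Ty.occ, ih]
  | poly k body ih => intro n ρ; simp [Ty.mapB, Ty.occ, ih]

theorem Ty.occ_rename {V W : Type} (f : V → W) {n : ℕ} (t : Ty V n) :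
    (t.rename f).occ = t.occ.map f := by
  unfold Ty.rename
  induction t with
  | var a => simp [Ty.bind, Ty.occ, Ty.mapB]
  | bvar i => simp [Ty.bind, Ty.occ]
  | con c args ih => simp [Ty.bind, Ty.occ, ih, List.map_flatten, List.map_ofFn, Function.comp_def]
  | poly k body ih => simp [Ty.bind, Ty.occ, ih]

theorem Ty.fv_rename {V W : Type} [DecidableEq V] [DecidableEq W] (f : V → W) {n : ℕ}
    (t : Ty V n) : (t.rename f).fv = t.fv.image f := by
  ext a
  simp [Ty.fv, Ty.occ_rename]

theorem Typ.rename_eq_var {f : TyVar → TyVar} {t : Typ} {b : TyVar} (h : t.rename f = .var b) :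
    ∃ a, t = .var a ∧ f a = b := by
  cases t <;> simp_all [Ty.rename, Ty.bind, Ty.mapB]

theorem Typ.isVar_rename {f : TyVar → TyVar} {t : Typ} :
    Typ.IsVar (t.rename f) ↔ Typ.IsVar t := by
  constructor
  · rintro ⟨b, hb⟩
    obtain ⟨a, rfl, -⟩ := Typ.rename_eq_var hb
    exact ⟨a, rfl⟩
  · rintro ⟨a, rfl⟩
    exact ⟨f a, rfl⟩

theorem Ty.one_le_size {V : Type} {t : Ty V 0} (h : ∀ a, t ≠ .var a) : 1 ≤ t.size := by
  cases t with
  | var a => exact absurd rfl (h a)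
  | bvar i => exact i.elim0
  | con c args => simp [Ty.size]
  | poly k body => simp [Ty.size]

theorem Typ.one_le_size {t : Typ} (h : ¬ Typ.IsVar t) : 1 ≤ t.size :=
  Ty.one_le_size fun a ha => h ⟨a, ha⟩

/-- Principal shapes are non-trivial, so peeling one off a type always removes at least one node. -/
theorem Shape.Canonical.one_le_size {s : Shape} (h : s.Canonical) : 1 ≤ s.body.size := by
  obtain ⟨t, ht⟩ := h
  exact Ty.one_le_size ht.1.1

theorem Shape.size_applyVars (s : Shape) (as : Fin s.arity → TyVar) :
    (s.applyVars as).size = s.body.size := by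
  simp [Shape.applyVars, Shape.apply, Ty.size_bind, Ty.size]

theorem Ty.fv_bind_of_mem {V W : Type} [DecidableEq V] [DecidableEq W] (f : V → Ty W 0) {n : ℕ}
    (t : Ty V n) {v : V} {w : W} (hv : v ∈ t.fv) (hw : w ∈ (f v).fv) : w ∈ (t.bind f).fv := by
  simp only [Ty.fv, List.mem_toFinset] at *
  induction t with
  | var a =>
    simp only [Ty.occ, List.mem_singleton] at hv
    subst hv
    simpa [Ty.bind, Ty.occ_mapB] using hw
  | bvar i => simp [Ty.occ] at hv
  | con c args ih =>
    simp only [Ty.occ, List.mem_flatten, List.mem_ofFn, Ty.bind] at *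
    obtain ⟨l, ⟨i, rfl⟩, hv⟩ := hv
    exact ⟨_, ⟨i, rfl⟩, ih i hv⟩
  | poly k body ih => exact ih hv

/-- The arguments of a shape and what remains when one of them is replaced by a variable are
smaller than the whole type. -/
theorem Shape.size_lt_apply {s : Shape} (hs : s.Canonical) (ts : Fin s.arity → Typ)
    (i : Fin s.arity) : (ts i).size < (s.apply ts).size := by
  have h := hs.one_le_size
  have hi : i ∈ s.body.occ := by simpa [Ty.fv] using s.all_used i
  have : (ts i).size ≤ (s.body.occ.map fun j => (ts j).size).sum :=
    List.single_le_sum (by simp) _ (List.mem_map_of_mem (f := fun j => (ts j).size) hi)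
  rw [Shape.apply, Ty.size_bind]
  omega

/-- Variables have size 0, so every copy of the argument that filled the hole disappears from the
count. There is at least one copy, as all holes of a shape are used. -/
theorem Shape.size_update_lt {s : Shape} (ts : Fin s.arity → Typ)
    (i : Fin s.arity) (hi : ¬ Typ.IsVar (ts i)) (a : TyVar) :
    (s.apply (Function.update ts i (.var a))).size < (s.apply ts).size := by
  have hmem : i ∈ s.body.occ := by simpa [Ty.fv] using s.all_used i
  have h1 := Typ.one_le_size hi
  rw [Shape.apply, Shape.apply, Ty.size_bind, Ty.size_bind]
  refine Nat.add_lt_add_left (List.sum_lt_sum _ _ (fun j _ => ?_) ⟨i, hmem, ?_⟩) _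
  · by_cases hj : j = i
    · subst hj
      simp [Ty.size]
    · simp [hj]
  · simpa [Ty.size, Nat.pos_iff_ne_zero, Nat.one_le_iff_ne_zero] using h1

/-! ## The visible part of a constraint -/

/-- `a` occurs in a member satisfying `Q` of a multi-equation on `b` that is visible, outside the
scope of binders of `a` and `b`, under conjunctions and existentials. -/
def Constr.Vis (Q : Typ → Prop) : Constr → TyVar → TyVar → Prop
  | .and c d, a, b => c.Vis Q a b ∨ d.Vis Q a b
  | .ex g c, a, b => a ≠ g ∧ b ≠ g ∧ c.Vis Q a b
  | .eqn E, a, b => ∃ t e, E = .var b ::ₘ t ::ₘ e ∧ a ∈ t.fv ∧ Q t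
  | _, _, _ => False

/-- The variables that are free in the visible multi-equations. -/
def Constr.vis : Constr → Finset TyVar
  | .and c d => c.vis ∪ d.vis
  | .ex a c => c.vis.erase a
  | .eqn E => E.fv
  | _ => ∅

theorem MultiEq.mem_fv {E : MultiEq} {a : TyVar} : a ∈ E.fv ↔ ∃ t ∈ E, a ∈ t.fv := by
  unfold MultiEq.fv
  induction E using Multiset.induction_on with
  | empty => simp
  | cons t E ih => simp [ih]

theorem Constr.Vis.mem_vis {Q : Typ → Prop} {c : Constr} {a b : TyVar} (h : c.Vis Q a b) :
    a ∈ c.vis ∧ b ∈ c.vis := by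
  induction c using Constr.ind generalizing a b with
  | and c d ihc ihd =>
    rcases h with h | h
    · simp [Constr.vis, ihc h]
    · simp [Constr.vis, ihd h]
  | ex g c ih => simp [Constr.vis, h.1, h.2.1, ih h.2.2]
  | eqn E =>
    obtain ⟨t, e, rfl, ha, -⟩ := h
    simp only [Constr.vis, MultiEq.mem_fv]
    exact ⟨⟨t, by simp, ha⟩, ⟨.var b, by simp, by simp [Ty.fv, Ty.occ]⟩⟩
  | _ => exact h.elim

theorem Constr.Vis.mono {Q Q' : Typ → Prop} (hQ : ∀ t, Q t → Q' t) {c : Constr} {a b : TyVar}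
    (h : c.Vis Q a b) : c.Vis Q' a b := by
  induction c using Constr.ind generalizing a b with
  | and c d ihc ihd => exact h.imp ihc ihd
  | ex g c ih => exact ⟨h.1, h.2.1, ih h.2.2⟩
  | eqn E =>
    obtain ⟨t, e, hE, ha, ht⟩ := h
    exact ⟨t, e, hE, ha, hQ t ht⟩
  | _ => exact h.elim

/-- With its analogue for proper occurrences, this links the recursive relation, convenient for
computing weights, to the inductive one in the side condition of Copy. One direction suffices to
transfer the absence of cycles. -/
theorem Constr.Vis.occurs {c : Constr} {a b : TyVar} (h : c.Vis (fun _ => True) a b) :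
    c.Occurs a b := by
  induction c using Constr.ind generalizing a b with
  | and c d ihc ihd => exact h.elim (fun h => .andL (ihc h)) (fun h => .andR (ihd h))
  | ex g c ih => exact .ex h.1 h.2.1 (ih h.2.2)
  | eqn E =>
    obtain ⟨t, e, rfl, ha, -⟩ := h
    exact .eqn ha
  | _ => exact h.elim

theorem Constr.Vis.occursProper {c : Constr} {a b : TyVar}
    (h : c.Vis (fun t => ¬ Typ.IsVar t) a b) : c.OccursProper a b := by
  induction c using Constr.ind generalizing a b with
  | and c d ihc ihd => exact h.elim (fun h => .andL (ihc h)) (fun h => .andR (ihd h))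
  | ex g c ih => exact .ex h.1 h.2.1 (ih h.2.2)
  | eqn E =>
    obtain ⟨t, e, rfl, ha, ht⟩ := h
    exact .eqn ha ht
  | _ => exact h.elim

/-- The copying potential of a variable in the definition `c` of a region. -/
noncomputable def Constr.pot (c : Constr) (b : TyVar) : ℕ∞ :=
  relPot (c.Vis fun _ => True) (c.Vis fun t => ¬ Typ.IsVar t) b

theorem Constr.pot_lt {c : Constr} (hc : ¬ c.Cyclic) {a b : TyVar}
    (h : c.Vis (fun t => ¬ Typ.IsVar t) a b) : c.pot a < c.pot b := by
  refine relPot_lt (fun _ _ h => h.mono fun _ _ => trivial) c.vis.finite_toSet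
    (fun _ _ h => h.mem_vis.1) ?_ h
  rintro ⟨d, u, v, hdu, huv, hvd⟩
  -- The cycle through `d` is rotated so as to start at its proper step from `u` to `v`.
  exact hc ⟨u, v, huv.occursProper,
    (hvd.trans hdu).lift id fun _ _ h => h.occurs⟩

/-- The potentials of the variables of the region `as` with definition `c`. -/
noncomputable def Constr.regionPot (as : List TyVar) (c : Constr) (b : TyVar) : ℕ∞ :=
  if b ∈ as then c.pot b else 0

/-! ## The weight of a constraint -/

/-- The number of let-constraints. -/
def Constr.lets : Constr → ℕ
  | .and c d => c.lets + d.lets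
  | .ex _ c => c.lets
  | .all _ c => c.lets
  | .letc _ _ c d => c.lets + d.lets + 1
  | .letr _ _ _ c d => c.lets + d.lets + 1
  | .exI _ _ c => c.lets
  | _ => 0

/-- Potentials of the domains of incremental instantiations, and of the variables in the regions
of term variables. -/
@[ext]
structure Env where
  inst : InstVar → TyVar → ℕ∞
  term : TermVar → TyVar → ℕ∞

open Classical in
/-- Rebinding of type variables. -/
noncomputable def Env.bind (as : List TyVar) (ρ : Env) : Env where
  -- With `⊤` as default, leaving the scope of a binder can only lower potentials, and replacing a
  -- bound variable by any other one is never a loss.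
  inst i b := if b ∈ as then ⊤ else ρ.inst i b
  term x b := if b ∈ as then ⊤ else ρ.term x b

/-- The instantiation variable inherits the potentials that its term variable has at the point where
`i` is bound. -/
def Env.setInst (i : InstVar) (x : TermVar) (ρ : Env) : Env where
  inst := Function.update ρ.inst i (ρ.term x)
  term := ρ.term

def Env.setTerm (x : TermVar) (p : TyVar → ℕ∞) (ρ : Env) : Env where
  inst := ρ.inst
  term := Function.update ρ.term x p

open Classical in
/-- `1` for types that are not variables. -/
noncomputable def Typ.nonVar (t : Typ) : ℕ := if Typ.IsVar t then 0 else 1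

/-- The weight of a constraint at degree `e` and depth `k`. -/
noncomputable def Constr.wt : Constr → ℕ → ℕ → Env → Wt
  | .and c d, e, k, ρ => c.wt e k ρ + d.wt e k ρ
  -- The depth stays the same here, unlike under `∀`: an existential may be extended over a
  -- neighbouring conjunct, which must not become heavier.
  | .ex a c, e, k, ρ => unit (item e 0 2 k) + c.wt e k (ρ.bind [a])
  | .all a c, e, k, ρ => c.wt e (k + 1) (ρ.bind [a])
  -- Value 2 marks existential binders and multi-equations, value 1 inert leaves, value 0 the
  -- counters of regions; members start at 3.
  | .eqn E, e, k, _ =>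
      unit (item e 0 2 k) + (E.map fun t => unit (item e 0 (3 + t.size) k)).sum
  -- Items of the body have degree at most `e + d.lets`, so the definition is one above them all;
  -- its depth can then restart at 0.
  | .letc x a c d, e, k, ρ =>
      c.wt (e + 1 + d.lets) 0 (ρ.bind [a]) + d.wt e (k + 1) (ρ.setTerm x 0)
  -- The counters have the degree of the definition and value 0: any progress in the definition
  -- outweighs them, and each of them outweighs the whole body. The variables of the region pay for
  -- Lower; the visible ones pay for identifications made by substitutions.
  | .letr x a as c d, e, k, ρ =>
      (c.vis.card + as.length) • unit (item (e + 1 + d.lets) 0 0 0) +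
        c.wt (e + 1 + d.lets) 0 (ρ.bind (a :: as)) +
        d.wt e (k + 1) ((ρ.bind (a :: as)).setTerm x (c.regionPot (a :: as)))
  | .exI i x c, e, k, ρ => unit (item e 0 2 k) + c.wt e (k + 1) (ρ.setInst i x)
  -- The added 1 makes an instantiation heavier than any equation of the same degree, even when `b`
  -- has potential 0.
  | .inst i b t, e, k, ρ => unit (item e (ρ.inst i b + 1) (Typ.nonVar t) k)
  | _, e, k, _ => unit (item e 0 1 k)

-- Bounds on weights and comparison across degrees

/-- Items of potential 0 have value at least 1. This leaves room for the counters of value 0 beneath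
the weight of a definition. -/
theorem Constr.suppGe_wt (c : Constr) (e k : ℕ) (ρ : Env) :
    SuppGe (item e 0 1 0) (c.wt e k ρ) := by
  induction c using Constr.ind generalizing e k ρ with
  | and c d ihc ihd => exact (ihc _ _ _).add (ihd _ _ _)
  | ex a c ih => exact (SuppGe.unit (by simp [item_le_iff])).add (ih _ _ _)
  | all a c ih => exact ih _ _ _
  | eqn E =>
    refine (SuppGe.unit (by simp [item_le_iff])).add (SuppGe.sum fun w hw => ?_)
    obtain ⟨t, -, rfl⟩ := Multiset.mem_map.1 hw
    exact SuppGe.unit (by simp [item_le_iff]; omega)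
  | letc x a c d ihc ihd =>
    exact ((ihc _ _ _).mono (by simp [item_le_iff]; omega)).add (ihd _ _ _)
  | letr x a as c d ihc ihd =>
    exact (((SuppGe.unit (by simp [item_le_iff]; omega)).nsmul _).add
      ((ihc _ _ _).mono (by simp [item_le_iff]; omega))).add (ihd _ _ _)
  | exI i x c ih => exact (SuppGe.unit (by simp [item_le_iff])).add (ih _ _ _)
  | inst i b t =>
    exact SuppGe.unit (item_le_iff.2 (Or.inr ⟨rfl, Or.inl (by simp)⟩))
  | _ => exact SuppGe.unit (by simp [item_le_iff])

/-- Each let adds at most one to the degrees in use, so the degree of a definition exceeds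
everything in its body. -/
theorem Constr.suppLt_wt (c : Constr) (e k : ℕ) (ρ : Env) :
    SuppLt (item (e + 1 + c.lets) 0 0 0) (c.wt e k ρ) := by
  induction c using Constr.ind generalizing e k ρ with
  | and c d ihc ihd =>
    exact ((ihc _ _ _).mono (by simp [item_le_iff, Constr.lets]; omega)).add
      ((ihd _ _ _).mono (by simp [item_le_iff, Constr.lets]; omega))
  | ex a c ih =>
    exact (SuppLt.unit (item_lt_of_degree_lt (by simp only [Constr.lets]; omega))).add (ih _ _ _)
  | all a c ih => exact ih _ _ _
  | eqn E =>
    refine (SuppLt.unit (item_lt_of_degree_lt (by simp only [Constr.lets]; omega))).add (SuppLt.sum fun w hw => ?_)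
    obtain ⟨t, -, rfl⟩ := Multiset.mem_map.1 hw
    exact SuppLt.unit (item_lt_of_degree_lt (by omega))
  | letc x a c d ihc ihd =>
    exact ((ihc _ _ _).mono (by simp [item_le_iff, Constr.lets]; omega)).add
      ((ihd _ _ _).mono (by simp [item_le_iff, Constr.lets]))
  | letr x a as c d ihc ihd =>
    exact (((SuppLt.unit (item_lt_of_degree_lt (by simp only [Constr.lets]; omega))).nsmul _).add
      ((ihc _ _ _).mono (by simp [item_le_iff, Constr.lets]; omega))).add
      ((ihd _ _ _).mono (by simp [item_le_iff, Constr.lets]))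
  | exI i x c ih => exact (SuppLt.unit (item_lt_of_degree_lt (by simp only [Constr.lets]; omega))).add (ih _ _ _)
  | _ => exact SuppLt.unit (item_lt_of_degree_lt (by omega))

theorem Constr.unit_le_wt (c : Constr) (e k : ℕ) (ρ : Env) :
    unit (item e 0 1 k) ≤ c.wt e k ρ := by
  have hle : ∀ {k}, unit (item e 0 1 k) ≤ unit (item e 0 2 k) := fun {k} =>
    unit_le (by simp [item_le_iff])
  have hk : ∀ {k}, unit (item e 0 1 k) ≤ unit (item e 0 1 (k + 1)) := fun {k} =>
    unit_le (by simp [item_le_iff])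
  induction c using Constr.ind generalizing k ρ with
  | and c d ihc ihd => exact le_add_of_le_of_nonneg (ihc ..) (wt_nonneg _)
  | ex a c ih => exact le_add_of_nonneg_of_le (wt_nonneg _) (ih ..)
  | all a c ih => exact hk.trans (ih ..)
  | eqn E => exact le_add_of_le_of_nonneg hle (wt_nonneg _)
  | letc x a c d ihc ihd => exact le_add_of_nonneg_of_le (wt_nonneg _) (hk.trans (ihd ..))
  | letr x a as c d ihc ihd => exact le_add_of_nonneg_of_le (wt_nonneg _) (hk.trans (ihd ..))
  | exI i x c ih => exact le_add_of_le_of_nonneg hle (wt_nonneg _)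
  | inst i b t => exact unit_le (item_le_iff.2 (Or.inr ⟨rfl, Or.inl (by simp)⟩))
  | _ => exact le_rfl

theorem Constr.wt_pos (c : Constr) (e k : ℕ) (ρ : Env) : 0 < c.wt e k ρ :=
  (unit_pos _).trans_le (c.unit_le_wt e k ρ)

/-- Degree is the leading coordinate, so every item drops whatever the potentials and depths become.
This is what pays when a conjunct leaves a definition. -/
theorem Constr.wt_lt_of_degree_lt (c : Constr) {e e' : ℕ} (he : e < e') (k k' : ℕ)
    (ρ ρ' : Env) : c.wt e k ρ < c.wt e' k' ρ' := by
  have hu : ∀ {e e'}, e < e' → ∀ {p p' v v' k k'},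
      unit (item e p v k) < unit (item e' p' v' k') :=
    fun h => unit_lt (item_lt_iff.2 (Or.inl h))
  induction c using Constr.ind generalizing e e' k k' ρ ρ' with
  | and c d ihc ihd => exact add_lt_add (ihc he ..) (ihd he ..)
  | ex a c ih => exact add_lt_add (hu he) (ih he ..)
  | all a c ih => exact ih he ..
  | eqn E =>
    refine add_lt_add_of_lt_of_le (hu he) ?_
    induction E using Multiset.induction_on with
    | empty => simp
    | cons t E ih => simpa using add_le_add (hu he).le ih
  | letc x a c d ihc ihd => exact add_lt_add (ihc (by omega) ..) (ihd he ..)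
  | letr x a as c d ihc ihd =>
    exact add_lt_add (add_lt_add_of_le_of_lt (nsmul_le_nsmul_right (hu (by omega)).le _)
      (ihc (by omega) ..)) (ihd he ..)
  | exI i x c ih => exact add_lt_add (hu he) (ih he ..)
  | _ => exact hu he

/-- Comparison of environments on a set of names. -/
structure EnvLe (S : Finset Name) (ρ ρ' : Env) : Prop where
  inst : ∀ i b, .iv i ∈ S → .tv b ∈ S → ρ.inst i b ≤ ρ'.inst i b
  term : ∀ x b, .tm x ∈ S → .tv b ∈ S → ρ.term x b ≤ ρ'.term x b

theorem EnvLe.refl (S : Finset Name) (ρ : Env) : EnvLe S ρ ρ :=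
  ⟨fun _ _ _ _ => le_rfl, fun _ _ _ _ => le_rfl⟩

theorem EnvLe.mono {S T : Finset Name} {ρ ρ' : Env} (h : EnvLe T ρ ρ') (hST : S ⊆ T) :
    EnvLe S ρ ρ' :=
  ⟨fun i b hi hb => h.inst i b (hST hi) (hST hb), fun x b hx hb => h.term x b (hST hx) (hST hb)⟩

theorem mem_tvs {as : List TyVar} {u : Name} : u ∈ tvs as ↔ ∃ a ∈ as, .tv a = u := by
  simp [tvs]

theorem EnvLe.bind {S T : Finset Name} {ρ ρ' : Env} {as : List TyVar} (h : EnvLe T ρ ρ')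
    (hST : S \ tvs as ⊆ T) : EnvLe S (ρ.bind as) (ρ'.bind as) := by
  constructor
  · intro i b hi hb
    by_cases hba : b ∈ as
    · simp [Env.bind, hba]
    · simpa [Env.bind, hba] using h.inst i b (hST (by simp [mem_tvs, hi]))
        (hST (by simp [mem_tvs, hb, hba]))
  · intro x b hx hb
    by_cases hba : b ∈ as
    · simp [Env.bind, hba]
    · simpa [Env.bind, hba] using h.term x b (hST (by simp [mem_tvs, hx]))
        (hST (by simp [mem_tvs, hb, hba]))

theorem EnvLe.setTerm {S T : Finset Name} {ρ ρ' : Env} {x : TermVar} {p p' : TyVar → ℕ∞}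
    (h : EnvLe T ρ ρ') (hp : ∀ b, p b ≤ p' b) (hST : S \ {.tm x} ⊆ T) :
    EnvLe S (ρ.setTerm x p) (ρ'.setTerm x p') := by
  constructor
  · intro i b hi hb
    exact h.inst i b (hST (by simp [hi])) (hST (by simp [hb]))
  · intro y b hy hb
    by_cases hyx : y = x
    · subst hyx
      simpa [Env.setTerm] using hp b
    · simpa [Env.setTerm, hyx] using h.term y b (hST (by simp [hy, hyx])) (hST (by simp [hb]))

theorem EnvLe.setInst {S T : Finset Name} {ρ ρ' : Env} {i : InstVar} {x : TermVar}
    (h : EnvLe T ρ ρ') (hx : .tm x ∈ T) (hST : S \ {.iv i} ⊆ T) :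
    EnvLe S (ρ.setInst i x) (ρ'.setInst i x) := by
  constructor
  · intro j b hj hb
    by_cases hji : j = i
    · subst hji
      simpa [Env.setInst] using h.term x b hx (hST (by simp [hb]))
    · simpa [Env.setInst, hji] using h.inst j b (hST (by simp [hj, hji])) (hST (by simp [hb]))
  · intro y b hy hb
    exact h.term y b (hST (by simp [hy])) (hST (by simp [hb]))

/-- The weight is monotone in the degree, the depth and the potentials of the free names, and
strictly monotone in the depth. -/
theorem Constr.wt_mono_aux (c : Constr) {e e' k k' : ℕ} {ρ ρ' : Env} (he : e ≤ e')
    (hk : k ≤ k') (h : EnvLe c.fv ρ ρ') :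
    c.wt e k ρ ≤ c.wt e' k' ρ' ∧ (k < k' → c.wt e k ρ < c.wt e' k' ρ') := by
  have hle : ∀ {e e'}, e ≤ e' → ∀ {p v k k'}, k ≤ k' → item e p v k ≤ item e' p v k' := by
    intro e e' h p v k k' h'
    rw [item_le_iff]
    rcases h.lt_or_eq with h | h
    · exact Or.inl h
    · exact Or.inr ⟨h, Or.inr ⟨rfl, Or.inr ⟨rfl, h'⟩⟩⟩
  have hlt : ∀ {e e'}, e ≤ e' → ∀ {p v k k'}, k < k' → item e p v k < item e' p v k' := by
    intro e e' h p v k k' h'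
    rw [item_lt_iff]
    rcases h.lt_or_eq with h | h
    · exact Or.inl h
    · exact Or.inr ⟨h, Or.inr ⟨rfl, Or.inr ⟨rfl, h'⟩⟩⟩
  induction c using Constr.ind generalizing e e' k k' ρ ρ' with
  | and c d ihc ihd =>
    have hc := ihc he hk (h.mono (by simp [Constr.fv]))
    have hd := ihd he hk (h.mono (by simp [Constr.fv]))
    exact ⟨add_le_add hc.1 hd.1, fun h => add_lt_add (hc.2 h) (hd.2 h)⟩
  | ex a c ih =>
    have hc := ih he hk (h.bind (as := [a]) (by simp [Constr.fv, tvs]))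
    exact ⟨add_le_add (unit_le (hle he hk)) hc.1,
      fun h => add_lt_add (unit_lt (hlt he h)) (hc.2 h)⟩
  | all a c ih =>
    have hc := ih he (Nat.succ_le_succ hk) (h.bind (as := [a]) (by simp [Constr.fv, tvs]))
    exact ⟨hc.1, fun h => hc.2 (Nat.succ_lt_succ h)⟩
  | eqn E =>
    have hE : (E.map fun t => unit (item e 0 (3 + t.size) k)).sum ≤
        (E.map fun t => unit (item e' 0 (3 + t.size) k')).sum := by
      induction E using Multiset.induction_on with
      | empty => simp
      | cons t E ih => simpa using add_le_add (unit_le (hle he hk)) (ih (EnvLe.mono h (by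
          intro u; simp only [Constr.fv, Finset.mem_image, MultiEq.mem_fv]
          rintro ⟨a, ⟨t, ht, hat⟩, rfl⟩
          exact ⟨a, ⟨t, by simp [ht], hat⟩, rfl⟩)))
    exact ⟨add_le_add (unit_le (hle he hk)) hE,
      fun h => add_lt_add_of_lt_of_le (unit_lt (hlt he h)) hE⟩
  | letc x a c d ihc ihd =>
    have hc := ihc (e := e + 1 + d.lets) (e' := e' + 1 + d.lets) (by omega) (le_refl 0)
      (h.bind (as := [a]) (by simp [Constr.fv, tvs]))
    have hd := ihd he (Nat.succ_le_succ hk) (h.setTerm (x := x) (p := 0) (fun _ => le_rfl)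
      (by simp [Constr.fv]))
    -- The definition is at depth 0 on both sides, so strictness has to come from the body.
    exact ⟨add_le_add hc.1 hd.1,
      fun h => add_lt_add_of_le_of_lt hc.1 (hd.2 (Nat.succ_lt_succ h))⟩
  | letr x a as c d ihc ihd =>
    have hc := ihc (e := e + 1 + d.lets) (e' := e' + 1 + d.lets) (by omega) (le_refl 0)
      (h.bind (as := a :: as) (by
        simp only [Constr.fv]; exact Finset.sdiff_subset_sdiff Finset.subset_union_left le_rfl))
    have hd := ihd he (Nat.succ_le_succ hk) (EnvLe.setTerm (x := x) (T := d.fv \ {.tm x})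
      (p := c.regionPot (a :: as)) (h.bind (as := a :: as) (by
        simp only [Constr.fv]; exact Finset.sdiff_subset_sdiff Finset.subset_union_right le_rfl))
      (fun _ => le_rfl) le_rfl)
    have h0 := add_le_add (nsmul_le_nsmul_right (unit_le (hle (e := e + 1 + d.lets)
      (e' := e' + 1 + d.lets) (by omega) (p := 0) (v := 0) (le_refl 0)))
      (c.vis.card + as.length)) hc.1
    exact ⟨add_le_add h0 hd.1, fun h => add_lt_add_of_le_of_lt h0 (hd.2 (Nat.succ_lt_succ h))⟩
  | exI i x c ih =>
    have hc := ih he (Nat.succ_le_succ hk) (h.setInst (i := i) (x := x) (by simp [Constr.fv])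
      (by simp only [Constr.fv]; exact Finset.subset_insert _ _))
    exact ⟨add_le_add (unit_le (hle he hk)) hc.1,
      fun h => add_lt_add (unit_lt (hlt he h)) (hc.2 (Nat.succ_lt_succ h))⟩
  | inst i b t =>
    have hp : ρ.inst i b + 1 ≤ ρ'.inst i b + 1 := by
      gcongr
      exact h.inst i b (by simp [Constr.fv]) (by simp [Constr.fv])
    rcases hp.lt_or_eq with hp | hp
    · have : item e (ρ.inst i b + 1) (Typ.nonVar t) k <
          item e' (ρ'.inst i b + 1) (Typ.nonVar t) k' := by
        rw [item_lt_iff]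
        rcases he.lt_or_eq with he | he
        · exact Or.inl he
        · exact Or.inr ⟨he, Or.inl hp⟩
      exact ⟨(unit_lt this).le, fun _ => unit_lt this⟩
    · simp only [Constr.wt, hp]
      exact ⟨unit_le (hle he hk), fun h => unit_lt (hlt he h)⟩
  | _ => exact ⟨unit_le (hle he hk), fun h => unit_lt (hlt he h)⟩

theorem Constr.wt_mono (c : Constr) {e e' k k' : ℕ} {ρ ρ' : Env} (he : e ≤ e')
    (hk : k ≤ k') (h : EnvLe c.fv ρ ρ') : c.wt e k ρ ≤ c.wt e' k' ρ' :=
  (c.wt_mono_aux he hk h).1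

theorem Constr.wt_lt_of_depth_lt (c : Constr) {e e' k k' : ℕ} {ρ ρ' : Env} (he : e ≤ e')
    (hk : k < k') (h : EnvLe c.fv ρ ρ') : c.wt e k ρ < c.wt e' k' ρ' :=
  (c.wt_mono_aux he hk.le h).2 hk

theorem Constr.wt_congr (c : Constr) {e k : ℕ} {ρ ρ' : Env}
    (hi : ∀ i b, .iv i ∈ c.fv → .tv b ∈ c.fv → ρ.inst i b = ρ'.inst i b)
    (ht : ∀ x b, .tm x ∈ c.fv → .tv b ∈ c.fv → ρ.term x b = ρ'.term x b) :
    c.wt e k ρ = c.wt e k ρ' :=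
  le_antisymm
    (c.wt_mono le_rfl le_rfl ⟨fun i b h h' => (hi i b h h').le, fun x b h h' => (ht x b h h').le⟩)
    (c.wt_mono le_rfl le_rfl ⟨fun i b h h' => (hi i b h h').ge, fun x b h h' => (ht x b h h').ge⟩)

theorem Constr.vis_subset_fv {c : Constr} {a : TyVar} (h : a ∈ c.vis) : .tv a ∈ c.fv := by
  induction c using Constr.ind generalizing a with
  | and c d ihc ihd =>
    rcases Finset.mem_union.1 h with h | h
    · simp [Constr.fv, ihc h]
    · simp [Constr.fv, ihd h]
  | ex g c ih =>
    simp only [Constr.vis, Finset.mem_erase] at h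
    simp [Constr.fv, ih h.2, h.1]
  | eqn E => simpa [Constr.fv, Constr.vis] using h
  | _ => simp [Constr.vis] at h

/-! ## Counting measures -/

mutual
/-- The number of match constraints. -/
def Constr.matches : Constr → ℕ
  | .and c d => c.matches + d.matches
  | .ex _ c => c.matches
  | .all _ c => c.matches
  | .letc _ _ c d => c.matches + d.matches
  | .letr _ _ _ c d => c.matches + d.matches
  | .exI _ _ c => c.matches
  | .mtch _ bs => bs.matches + 1
  | _ => 0

def Branches.matches : Branches → ℕ
  | .nil => 0
  | .cons _ c bs => c.matches + bs.matches
end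

/-- The number of instantiations and plain let-constraints outside of branches. -/
def Constr.apps : Constr → ℕ
  | .and c d => c.apps + d.apps
  | .ex _ c => c.apps
  | .all _ c => c.apps
  | .letc _ _ c d => c.apps + d.apps + 1
  | .letr _ _ _ c d => c.apps + d.apps
  | .exI _ _ c => c.apps
  | .app _ _ => 1
  | _ => 0

/-- A measure that decreases when the scope of an existential grows. -/
def Constr.spread : Constr → ℕ
  | .and c d => c.spread * d.spread
  | .ex _ c => c.spread + 1
  | .all _ c => c.spread
  | .letc _ _ c d => c.spread + d.spread
  | .letr _ _ _ c d => c.spread + d.spread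
  | .exI _ _ c => c.spread
  | _ => 2

/-- The inequality `m * n + 1 < (m + 1) * n`, which makes the extension of an existential decrease
`spread`, requires `2 ≤ n`; leaves count 2 for this reason. -/
theorem Constr.two_le_spread (c : Constr) : 2 ≤ c.spread := by
  induction c using Constr.ind with
  | and c d ihc ihd => exact (by norm_num : 2 ≤ 2 * 2).trans (Nat.mul_le_mul ihc ihd)
  | _ => simp only [Constr.spread]; omega

mutual
theorem Constr.matches_map (π : NameMap) : (c : Constr) → (c.map π).matches = c.matches
  | .and c d => by simp [Constr.map, Constr.matches, c.matches_map π, d.matches_map π]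
  | .ex _ c => by simp [Constr.map, Constr.matches, c.matches_map π]
  | .all _ c => by simp [Constr.map, Constr.matches, c.matches_map π]
  | .letc _ _ c d => by simp [Constr.map, Constr.matches, c.matches_map π, d.matches_map π]
  | .letr _ _ _ c d => by simp [Constr.map, Constr.matches, c.matches_map π, d.matches_map π]
  | .exI _ _ c => by simp [Constr.map, Constr.matches, c.matches_map π]
  | .mtch _ bs => by simp [Constr.map, Constr.matches, bs.matches_map π]
  | .tru => rfl
  | .fls => rfl
  | .eqn _ => rfl
  | .app _ _ => rfl
  | .inst _ _ _ => rfl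
  | .labInst _ _ _ _ => rfl
  | .domEq _ _ => rfl
  | .schLe _ _ => rfl
  | .leSch _ _ => rfl

theorem Branches.matches_map (π : NameMap) : (bs : Branches) → (bs.map π).matches = bs.matches
  | .nil => rfl
  | .cons _ c bs => by simp [Branches.map, Branches.matches, c.matches_map π, bs.matches_map π]
end

theorem Constr.apps_map (π : NameMap) (c : Constr) : (c.map π).apps = c.apps := by
  induction c using Constr.ind <;> simp_all [Constr.map, Constr.apps]

theorem Constr.lets_map (π : NameMap) (c : Constr) : (c.map π).lets = c.lets := by
  induction c using Constr.ind <;> simp_all [Constr.map, Constr.lets]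

theorem Constr.spread_map (π : NameMap) (c : Constr) : (c.map π).spread = c.spread := by
  induction c using Constr.ind <;> simp_all [Constr.map, Constr.spread]

theorem Constr.Equiv.counts_eq {c d : Constr} (h : c.Equiv d) :
    c.matches = d.matches ∧ c.apps = d.apps ∧ c.lets = d.lets ∧ c.spread = d.spread := by
  induction h <;>
    simp_all [Constr.matches, Branches.matches, Constr.apps, Constr.lets, Constr.spread,
      Constr.swap, Constr.matches_map, Constr.apps_map, Constr.lets_map, Constr.spread_map,
      Nat.add_comm, Nat.mul_comm, Nat.add_assoc, Nat.mul_assoc]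

/-! ## Renaming -/

/-- Only the sorts that the weight depends on are constrained; pattern variables never influence it.
-/
structure NameMap.Inj (π : NameMap) : Prop where
  tv : Function.Injective π.tv
  tm : Function.Injective π.tm
  iv : Function.Injective π.iv

theorem NameMap.inj_swap (u v : Name) : (NameMap.swap u v).Inj := by
  cases u <;> cases v <;>
    constructor <;> first | exact (_root_.Equiv.swap _ _).injective | exact fun _ _ h => h

/-- A property of types that does not depend on the names of variables. -/
def RenInv (Q : Typ → Prop) : Prop := ∀ (f : TyVar → TyVar) (t : Typ), Q (t.rename f) ↔ Q t

theorem renInv_true : RenInv fun _ => True := fun _ _ => Iff.rfl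

theorem renInv_proper : RenInv fun t => ¬ Typ.IsVar t := fun _ _ => not_congr Typ.isVar_rename

theorem Constr.vis_eqn_rename {Q : Typ → Prop} (hQ : RenInv Q) {f : TyVar → TyVar} {E : MultiEq}
    {a b : TyVar} : (Constr.eqn (E.map (Ty.rename f))).Vis Q a b ↔
      ∃ a₀ b₀, (Constr.eqn E).Vis Q a₀ b₀ ∧ f a₀ = a ∧ f b₀ = b := by
  classical
  constructor
  · rintro ⟨t, e, hE, ha, ht⟩
    obtain ⟨s, hs, hsb, hE⟩ := (Multiset.map_eq_cons _ _ _ _).2 hE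
    obtain ⟨r, hr, rfl, hE⟩ := (Multiset.map_eq_cons _ _ _ _).2 hE
    obtain ⟨b₀, rfl, rfl⟩ := Typ.rename_eq_var hsb
    rw [Ty.fv_rename, Finset.mem_image] at ha
    obtain ⟨a₀, ha₀, rfl⟩ := ha
    refine ⟨a₀, b₀, ⟨r, (E.erase (.var b₀)).erase r, ?_, ha₀, (hQ _ _).1 ht⟩, rfl, rfl⟩
    rw [Multiset.cons_erase hr, Multiset.cons_erase hs]
  · rintro ⟨a₀, b₀, ⟨t, e, rfl, ha, ht⟩, rfl, rfl⟩
    refine ⟨t.rename f, e.map (Ty.rename f), ?_, ?_, (hQ _ _).2 ht⟩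
    · simp [Ty.rename, Ty.bind, Ty.mapB]
    · rw [Ty.fv_rename]
      exact Finset.mem_image_of_mem _ ha

theorem MultiEq.fv_rename (f : TyVar → TyVar) (E : MultiEq) :
    MultiEq.fv (E.map (Ty.rename f)) = E.fv.image f := by
  ext a
  simp only [MultiEq.mem_fv, Finset.mem_image, Multiset.mem_map]
  constructor
  · rintro ⟨_, ⟨t, ht, rfl⟩, ha⟩
    rw [Ty.fv_rename, Finset.mem_image] at ha
    obtain ⟨b, hb, rfl⟩ := ha
    exact ⟨b, ⟨t, ht, hb⟩, rfl⟩
  · rintro ⟨b, ⟨t, ht, hb⟩, rfl⟩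
    exact ⟨_, ⟨t, ht, rfl⟩, by rw [Ty.fv_rename]; exact Finset.mem_image_of_mem _ hb⟩

theorem Constr.vis_map {π : NameMap} (hπ : π.Inj) (c : Constr) :
    (c.map π).vis = c.vis.image π.tv := by
  induction c using Constr.ind with
  | and c d ihc ihd => simp [Constr.map, Constr.vis, ihc, ihd, Finset.image_union]
  | ex a c ih => simp [Constr.map, Constr.vis, ih, Finset.image_erase hπ.tv]
  | eqn E => exact MultiEq.fv_rename _ _
  | _ => rfl

theorem Constr.Vis_map {Q : Typ → Prop} (hQ : RenInv Q) {π : NameMap} (hπ : π.Inj) (c : Constr)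
    {a b : TyVar} :
    (c.map π).Vis Q a b ↔ ∃ a₀ b₀, c.Vis Q a₀ b₀ ∧ π.tv a₀ = a ∧ π.tv b₀ = b := by
  induction c using Constr.ind generalizing a b with
  | and c d ihc ihd =>
    simp only [Constr.map, Constr.Vis, ihc, ihd]
    constructor
    · rintro (⟨a₀, b₀, h, h'⟩ | ⟨a₀, b₀, h, h'⟩)
      · exact ⟨a₀, b₀, Or.inl h, h'⟩
      · exact ⟨a₀, b₀, Or.inr h, h'⟩
    · rintro ⟨a₀, b₀, h | h, h'⟩
      · exact Or.inl ⟨a₀, b₀, h, h'⟩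
      · exact Or.inr ⟨a₀, b₀, h, h'⟩
  | ex g c ih =>
    simp only [Constr.map, Constr.Vis, ih]
    constructor
    · rintro ⟨ha, hb, a₀, b₀, h, rfl, rfl⟩
      exact ⟨a₀, b₀, ⟨fun h => ha (h ▸ rfl), fun h => hb (h ▸ rfl), h⟩, rfl, rfl⟩
    · rintro ⟨a₀, b₀, ⟨ha, hb, h⟩, rfl, rfl⟩
      exact ⟨hπ.tv.ne ha, hπ.tv.ne hb, a₀, b₀, h, rfl, rfl⟩
  | eqn E => exact Constr.vis_eqn_rename hQ
  | _ => simp [Constr.map, Constr.Vis]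

/-- Both inequalities push a relation forward, the second one along a left inverse of the renaming,
which is injective on its range. -/
theorem Constr.pot_map {π : NameMap} (hπ : π.Inj) (c : Constr) (b : TyVar) :
    (c.map π).pot (π.tv b) = c.pot b := by
  have key : ∀ {Q}, RenInv Q → ∀ a b, (c.map π).Vis Q a b →
      ∃ a₀ ∈ Set.univ, ∃ b₀ ∈ Set.univ, c.Vis Q a₀ b₀ ∧ π.tv a₀ = a ∧ π.tv b₀ = b := by
    intro Q hQ a b h
    obtain ⟨a₀, b₀, h⟩ := (c.Vis_map hQ hπ).1 h
    exact ⟨a₀, trivial, b₀, trivial, h⟩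
  have hinv : Function.LeftInverse (Function.invFun π.tv) π.tv := Function.leftInverse_invFun hπ.tv
  refine le_antisymm (relPot_push_le (key renInv_true) (key renInv_proper) hπ.tv.injOn
    fun b₀ _ h => hπ.tv h) ?_
  have key' : ∀ {Q}, RenInv Q → ∀ a b, c.Vis Q a b → ∃ a₀ ∈ Set.range π.tv, ∃ b₀ ∈ Set.range π.tv,
      (c.map π).Vis Q a₀ b₀ ∧ Function.invFun π.tv a₀ = a ∧ Function.invFun π.tv b₀ = b :=
    fun hQ a b h => ⟨π.tv a, ⟨a, rfl⟩, π.tv b, ⟨b, rfl⟩,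
      (c.Vis_map hQ hπ).2 ⟨a, b, h, rfl, rfl⟩, hinv a, hinv b⟩
  refine relPot_push_le (key' renInv_true) (key' renInv_proper) ?_ ?_
  · rintro _ ⟨a, rfl⟩ _ ⟨a', rfl⟩ h
    rw [hinv, hinv] at h
    rw [h]
  · rintro _ ⟨a, rfl⟩ h
    rw [hinv] at h
    rw [h]

theorem Typ.nonVar_rename (f : TyVar → TyVar) (t : Typ) :
    Typ.nonVar (t.rename f) = Typ.nonVar t := by
  by_cases h : Typ.IsVar t
  · rw [Typ.nonVar, Typ.nonVar, if_pos h, if_pos (Typ.isVar_rename.2 h)]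
  · rw [Typ.nonVar, Typ.nonVar, if_neg h, if_neg fun h' => h (Typ.isVar_rename.1 h')]

def Env.comap (π : NameMap) (ρ : Env) : Env where
  inst i b := ρ.inst (π.iv i) (π.tv b)
  term x b := ρ.term (π.tm x) (π.tv b)

theorem Env.comap_bind {π : NameMap} (hπ : π.Inj) (ρ : Env) (as : List TyVar) :
    (ρ.bind (as.map π.tv)).comap π = (ρ.comap π).bind as := by
  ext <;> simp [Env.comap, Env.bind, hπ.tv.eq_iff]

theorem Env.comap_setInst {π : NameMap} (hπ : π.Inj) (ρ : Env) (i : InstVar) (x : TermVar) :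
    (ρ.setInst (π.iv i) (π.tm x)).comap π = (ρ.comap π).setInst i x := by
  ext j b
  · simp only [Env.comap, Env.setInst, Function.update_apply, hπ.iv.eq_iff]
    split <;> rfl
  · rfl

theorem Env.comap_setTerm {π : NameMap} (hπ : π.Inj) (ρ : Env) (x : TermVar)
    {p p' : TyVar → ℕ∞} (hp : ∀ b, p (π.tv b) = p' b) :
    (ρ.setTerm (π.tm x) p).comap π = (ρ.comap π).setTerm x p' := by
  ext j b
  · rfl
  · simp only [Env.comap, Env.setTerm, Function.update_apply, hπ.tm.eq_iff]
    split <;> simp [hp]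

theorem Constr.regionPot_map {π : NameMap} (hπ : π.Inj) (as : List TyVar) (c : Constr)
    (b : TyVar) : (c.map π).regionPot (as.map π.tv) (π.tv b) = c.regionPot as b := by
  simp [Constr.regionPot, hπ.tv.eq_iff, Constr.pot_map hπ]

/-- Sizes and counts ignore names, and potentials follow an injective renaming; the only trace that
remains is in the environment, which is pulled back. -/
theorem Constr.wt_map {π : NameMap} (hπ : π.Inj) (c : Constr) (e k : ℕ) (ρ : Env) :
    (c.map π).wt e k ρ = c.wt e k (ρ.comap π) := by
  induction c using Constr.ind generalizing e k ρ with
  | and c d ihc ihd => simp [Constr.map, Constr.wt, ihc, ihd]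
  | ex a c ih =>
    simp only [Constr.map, Constr.wt, ih]
    rw [← Env.comap_bind hπ]; rfl
  | all a c ih =>
    simp only [Constr.map, Constr.wt, ih]
    rw [← Env.comap_bind hπ]; rfl
  | eqn E => simp [Constr.map, Constr.wt, Ty.size_rename]
  | letc x a c d ihc ihd =>
    simp only [Constr.map, Constr.wt, ihc, ihd, Constr.lets_map]
    rw [← Env.comap_bind hπ, ← Env.comap_setTerm hπ (p := 0) (p' := 0) _ _ fun _ => rfl]; rfl
  | letr x a as c d ihc ihd =>
    simp only [Constr.map, Constr.wt, ihc, ihd, Constr.lets_map, Constr.vis_map hπ,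
      Finset.card_image_of_injective _ hπ.tv, List.length_map]
    rw [← Env.comap_bind hπ, ← Env.comap_setTerm hπ _ _ (Constr.regionPot_map hπ _ _)]; rfl
  | exI i x c ih =>
    simp only [Constr.map, Constr.wt, ih]
    rw [← Env.comap_setInst hπ]
  | inst i b t => simp only [Constr.map, Constr.wt, Env.comap, Typ.nonVar_rename]
  | _ => rfl

/-! ## Structural equivalence -/

/-- Constraints that the weight cannot tell apart. -/
structure Constr.Same (c d : Constr) : Prop where
  lets : c.lets = d.lets
  vis : c.vis = d.vis
  rel : ∀ Q, RenInv Q → ∀ a b, c.Vis Q a b ↔ d.Vis Q a b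
  wt : ∀ e k ρ, c.wt e k ρ = d.wt e k ρ

/-- The occurrence relations belong to `Same` for this purpose: the weight of a let body depends on
them through the potentials of the region. -/
theorem Constr.Same.regionPot {c d : Constr} (h : c.Same d) (as : List TyVar) :
    c.regionPot as = d.regionPot as := by
  funext b
  have h1 : (c.Vis fun _ => True) = d.Vis fun _ => True := by
    funext a b; exact propext (h.rel _ renInv_true a b)
  have h2 : (c.Vis fun t => ¬ Typ.IsVar t) = d.Vis fun t => ¬ Typ.IsVar t := by
    funext a b; exact propext (h.rel _ renInv_proper a b)
  simp [Constr.regionPot, Constr.pot, h1, h2]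

theorem Constr.Same.refl (c : Constr) : c.Same c :=
  ⟨rfl, rfl, fun _ _ _ _ => Iff.rfl, fun _ _ _ => rfl⟩

theorem Constr.Same.symm {c d : Constr} (h : c.Same d) : d.Same c :=
  ⟨h.lets.symm, h.vis.symm, fun Q hQ a b => (h.rel Q hQ a b).symm, fun e k ρ => (h.wt e k ρ).symm⟩

theorem Constr.Same.trans {c d e : Constr} (h : c.Same d) (h' : d.Same e) : c.Same e :=
  ⟨h.lets.trans h'.lets, h.vis.trans h'.vis,
    fun Q hQ a b => (h.rel Q hQ a b).trans (h'.rel Q hQ a b),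
    fun e k ρ => (h.wt e k ρ).trans (h'.wt e k ρ)⟩

theorem Constr.Same.and {c c' d d' : Constr} (h : c.Same c') (h' : d.Same d') :
    (Constr.and c d).Same (.and c' d') :=
  ⟨by simp [Constr.lets, h.lets, h'.lets], by simp [Constr.vis, h.vis, h'.vis],
    fun Q hQ a b => or_congr (h.rel Q hQ a b) (h'.rel Q hQ a b),
    fun e k ρ => by simp [Constr.wt, h.wt, h'.wt]⟩

theorem Constr.Same.ex {a : TyVar} {c c' : Constr} (h : c.Same c') :
    (Constr.ex a c).Same (.ex a c') :=
  ⟨h.lets, by simp [Constr.vis, h.vis],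
    fun Q hQ _ _ => and_congr Iff.rfl (and_congr Iff.rfl (h.rel Q hQ _ _)),
    fun e k ρ => by simp [Constr.wt, h.wt]⟩

theorem Constr.Same.all {a : TyVar} {c c' : Constr} (h : c.Same c') :
    (Constr.all a c).Same (.all a c') :=
  ⟨h.lets, rfl, fun _ _ _ _ => Iff.rfl, fun e k ρ => by simp [Constr.wt, h.wt]⟩

theorem Constr.Same.letc {x : TermVar} {a : TyVar} {c c' d d' : Constr} (h : c.Same c')
    (h' : d.Same d') : (Constr.letc x a c d).Same (.letc x a c' d') :=
  ⟨by simp [Constr.lets, h.lets, h'.lets], rfl, fun _ _ _ _ => Iff.rfl,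
    fun e k ρ => by simp [Constr.wt, h.wt, h'.wt, h'.lets]⟩

theorem Constr.Same.letr {x : TermVar} {a : TyVar} {as : List TyVar} {c c' d d' : Constr}
    (h : c.Same c') (h' : d.Same d') : (Constr.letr x a as c d).Same (.letr x a as c' d') :=
  ⟨by simp [Constr.lets, h.lets, h'.lets], rfl, fun _ _ _ _ => Iff.rfl,
    fun e k ρ => by simp [Constr.wt, h.wt, h'.wt, h'.lets, h.vis, h.regionPot]⟩

theorem Constr.Same.exI {i : InstVar} {x : TermVar} {c c' : Constr} (h : c.Same c') :
    (Constr.exI i x c).Same (.exI i x c') :=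
  ⟨h.lets, rfl, fun _ _ _ _ => Iff.rfl, fun e k ρ => by simp [Constr.wt, h.wt]⟩

/-- To the weight a suspended match is a leaf, so nothing done to its branches is visible. -/
theorem Constr.Same.mtch (t : Typ) (bs : Branches) (t' : Typ) (bs' : Branches) :
    (Constr.mtch t bs).Same (.mtch t' bs') :=
  ⟨rfl, rfl, fun _ _ _ _ => Iff.rfl, fun _ _ _ => rfl⟩

theorem swap_tv_eq (u v : TyVar) : (NameMap.swap (.tv u) (.tv v)).tv = Equiv.swap u v := rfl

/-- Renaming a rebound variable does not change the weight. -/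
theorem Constr.wt_swap_bind {c : Constr} {u v : TyVar} {as : List TyVar} (hu : u ∈ as)
    (hv : .tv v ∉ c.fv) (e k : ℕ) (ρ : Env) :
    (c.swap (.tv u) (.tv v)).wt e k (ρ.bind (as.map (Equiv.swap u v))) = c.wt e k (ρ.bind as) := by
  rw [Constr.swap, Constr.wt_map (NameMap.inj_swap _ _), ← swap_tv_eq,
    Env.comap_bind (NameMap.inj_swap _ _)]
  -- Variables of `as` get `⊤` on both sides. A free variable outside `as` is neither `u` nor `v`,
  -- so the transposition fixes it.
  have hne : ∀ b, b ∉ as → .tv b ∈ c.fv → Equiv.swap u v b = b := fun b hb hbc =>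
    Equiv.swap_apply_of_ne_of_ne (fun h => hb (h ▸ hu)) (fun h => hv (h ▸ hbc))
  refine c.wt_congr (fun i b _ hb => ?_) (fun i b _ hb => ?_)
  all_goals
    by_cases hba : b ∈ as
    · simp [Env.bind, hba]
    · simp [Env.bind, hba, Env.comap, hne b hba hb, NameMap.swap]

theorem Constr.Same.alpha_ex {a b : TyVar} {c : Constr} (h : .tv b ∉ c.fv) :
    (Constr.ex a c).Same (.ex b (c.swap (.tv a) (.tv b))) := by
  have hb : b ∉ c.vis := fun hb => h (Constr.vis_subset_fv hb)
  have hne : ∀ x ∈ c.vis, x ≠ a → Equiv.swap a b x = x := fun x hx hxa =>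
    Equiv.swap_apply_of_ne_of_ne hxa (fun h => hb (h ▸ hx))
  have hsw : ∀ x ∈ c.vis, Equiv.swap a b x ≠ b → x ≠ a := by
    rintro x hx hxb rfl
    exact hxb (Equiv.swap_apply_left _ _)
  refine ⟨(c.lets_map _).symm, ?_, fun Q hQ x y => ?_, fun e k ρ => ?_⟩
  · simp only [Constr.vis, Constr.swap, Constr.vis_map (NameMap.inj_swap _ _), swap_tv_eq]
    ext x
    simp only [Finset.mem_erase, Finset.mem_image]
    constructor
    · rintro ⟨hx, hxc⟩
      exact ⟨fun h => hb (h ▸ hxc), x, hxc, hne x hxc hx⟩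
    · rintro ⟨hx, y, hy, rfl⟩
      have := hsw y hy hx
      rw [hne y hy this]
      exact ⟨this, hy⟩
  · simp only [Constr.Vis, Constr.swap, Constr.Vis_map hQ (NameMap.inj_swap _ _), swap_tv_eq]
    constructor
    · rintro ⟨hx, hy, hxy⟩
      obtain ⟨hxc, hyc⟩ := hxy.mem_vis
      exact ⟨fun h => hb (h ▸ hxc), fun h => hb (h ▸ hyc), x, y, hxy, hne x hxc hx, hne y hyc hy⟩
    · rintro ⟨hx, hy, x₀, y₀, hxy, rfl, rfl⟩
      obtain ⟨hxc, hyc⟩ := hxy.mem_vis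
      have hx' := hsw _ hxc hx
      have hy' := hsw _ hyc hy
      rw [hne _ hxc hx', hne _ hyc hy']
      exact ⟨hx', hy', hxy⟩
  · have := Constr.wt_swap_bind (u := a) (as := [a]) (by simp) h e k ρ
    simp only [List.map_cons, List.map_nil, Equiv.swap_apply_left] at this
    simp only [Constr.wt, this]

theorem Constr.Same.alpha_all {a b : TyVar} {c : Constr} (h : .tv b ∉ c.fv) :
    (Constr.all a c).Same (.all b (c.swap (.tv a) (.tv b))) := by
  refine ⟨(c.lets_map _).symm, rfl, fun _ _ _ _ => Iff.rfl, fun e k ρ => ?_⟩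
  have := Constr.wt_swap_bind (u := a) (as := [a]) (by simp) h e (k + 1) ρ
  simp only [List.map_cons, List.map_nil, Equiv.swap_apply_left] at this
  simp only [Constr.wt, this]

/-- Renaming a rebound term variable does not change the weight. -/
theorem Constr.wt_swap_setTerm {d : Constr} {x y : TermVar} (hy : .tm y ∉ d.fv) (e k : ℕ)
    (ρ : Env) (p : TyVar → ℕ∞) :
    (d.swap (.tm x) (.tm y)).wt e k (ρ.setTerm y p) = d.wt e k (ρ.setTerm x p) := by
  rw [Constr.swap, Constr.wt_map (NameMap.inj_swap _ _)]
  refine d.wt_congr (fun i b _ hb => rfl) (fun z b hz hb => ?_)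
  have hzy : z ≠ y := fun h => hy (h ▸ hz)
  by_cases hzx : z = x
  · subst hzx
    simp [Env.comap, Env.setTerm, NameMap.swap]
  · simp [Env.comap, Env.setTerm, NameMap.swap, Equiv.swap_apply_of_ne_of_ne hzx hzy, hzx, hzy]

/-- The region is bound in the body too, so the potentials recorded for `x` have to follow the
transposition of the definition; all others are `⊤` on the region and unaffected elsewhere. -/
theorem Constr.Same.alpha_letr_tv {x : TermVar} {a u v : TyVar} {as : List TyVar}
    {c d : Constr} (hu : u ∈ a :: as) (hc : .tv v ∉ c.fv) (hd : .tv v ∉ d.fv) :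
    (Constr.letr x a as c d).Same (.letr x (Equiv.swap u v a) (as.map (Equiv.swap u v))
      (c.swap (.tv u) (.tv v)) (d.swap (.tv u) (.tv v))) := by
  refine ⟨?_, rfl, fun _ _ _ _ => Iff.rfl, fun e k ρ => ?_⟩
  · simp [Constr.lets, Constr.swap, Constr.lets_map]
  have hπ := NameMap.inj_swap (.tv u) (.tv v)
  have h1 := Constr.wt_swap_bind hu hc (e + 1 + d.lets) 0 ρ
  simp only [List.map_cons] at h1
  have hl : (d.swap (.tv u) (.tv v)).lets = d.lets := d.lets_map _
  have hvis : (c.swap (.tv u) (.tv v)).vis.card = c.vis.card := by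
    rw [Constr.swap, Constr.vis_map hπ, Finset.card_image_of_injective _ hπ.tv]
  simp only [Constr.wt, hl, hvis, h1, List.length_map]
  congr 1
  have hreg := Constr.regionPot_map hπ (a :: as) c
  simp only [swap_tv_eq, List.map_cons] at hreg
  simp only [Constr.swap]
  rw [Constr.wt_map hπ,
    show x = (NameMap.swap (.tv u) (.tv v)).tm x from rfl, Env.comap_setTerm hπ _ _ hreg,
    ← List.map_cons, ← swap_tv_eq, Env.comap_bind hπ]
  have hne : ∀ b, b ∉ a :: as → .tv b ∈ d.fv → Equiv.swap u v b = b := fun b hb hbc =>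
    Equiv.swap_apply_of_ne_of_ne (fun h => hb (h ▸ hu)) (fun h => hd (h ▸ hbc))
  refine d.wt_congr (fun i b _ hb => ?_) (fun y b _ hb => ?_)
  · by_cases hba : b ∈ a :: as
    · simp only [Env.setTerm, Env.bind, if_pos hba]
    · simp only [Env.setTerm, Env.bind, if_neg hba, Env.comap, swap_tv_eq, hne b hba hb]
      rfl
  · by_cases hyx : y = x
    · subst hyx
      simp [Env.setTerm, NameMap.swap]
    · by_cases hba : b ∈ a :: as
      · simp only [Env.setTerm, Env.bind, NameMap.swap, id, Function.update_of_ne hyx, if_pos hba]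
      · simp only [Env.setTerm, Env.bind, NameMap.swap, id, Function.update_of_ne hyx, if_neg hba,
          Env.comap, hne b hba hb]

/-- Rewriting modulo structural equivalence costs nothing: each generating equation preserves the
weight and all the data from which the weight of an enclosing let is computed. -/
theorem Constr.Equiv.same {c d : Constr} (h : c.Equiv d) : c.Same d := by
  induction h with
  | refl c => exact .refl c
  | symm _ ih => exact ih.symm
  | trans _ _ ih ih' => exact ih.trans ih'
  | and_comm c d =>
    exact ⟨Nat.add_comm _ _, Finset.union_comm _ _, fun _ _ _ _ => or_comm,
      fun _ _ _ => add_comm _ _⟩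
  | and_assoc c d e =>
    exact ⟨Nat.add_assoc _ _ _, Finset.union_assoc _ _ _, fun _ _ _ _ => or_assoc,
      fun _ _ _ => add_assoc _ _ _⟩
  | @region_perm x a as bs c d h =>
    refine ⟨rfl, rfl, fun _ _ _ _ => Iff.rfl, fun e k ρ => ?_⟩
    have hmem : ∀ b, b ∈ a :: as ↔ b ∈ a :: bs := fun b => (h.cons a).mem_iff
    have h1 : ρ.bind (a :: as) = ρ.bind (a :: bs) := by
      simp only [Env.bind, hmem]
    have h2 : c.regionPot (a :: as) = c.regionPot (a :: bs) := by
      funext b; simp only [Constr.regionPot, hmem]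
    simp only [Constr.wt, h1, h2, h.length_eq]
  | alpha_ex h => exact .alpha_ex h
  | alpha_all h => exact .alpha_all h
  | @alpha_letc_tv x a b c d h =>
    refine ⟨by simp [Constr.lets, Constr.swap, Constr.lets_map], rfl, fun _ _ _ _ => Iff.rfl,
      fun e k ρ => ?_⟩
    have := Constr.wt_swap_bind (u := a) (as := [a]) (by simp) h (e + 1 + d.lets) 0 ρ
    simp only [List.map_cons, List.map_nil, Equiv.swap_apply_left] at this
    simp only [Constr.wt, this]
  | @alpha_letc_tm x y a c d h =>
    have hl : (d.swap (.tm x) (.tm y)).lets = d.lets := d.lets_map _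
    exact ⟨by simp [Constr.lets, hl], rfl, fun _ _ _ _ => Iff.rfl,
      fun e k ρ => by simp only [Constr.wt, hl, Constr.wt_swap_setTerm h]⟩
  | alpha_letr_tv hu _ hc hd => exact .alpha_letr_tv hu hc hd
  | @alpha_letr_tm x y a as c d h =>
    have hl : (d.swap (.tm x) (.tm y)).lets = d.lets := d.lets_map _
    exact ⟨by simp [Constr.lets, hl], rfl, fun _ _ _ _ => Iff.rfl,
      fun e k ρ => by simp only [Constr.wt, hl, Constr.wt_swap_setTerm h]⟩
  | @alpha_exI i j x c h =>
    refine ⟨(c.lets_map _).symm, rfl, fun _ _ _ _ => Iff.rfl, fun e k ρ => ?_⟩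
    simp only [Constr.wt, Constr.swap, Constr.wt_map (NameMap.inj_swap _ _)]
    congr 1
    refine c.wt_congr (fun l b hl hb => ?_) (fun z b hz hb => rfl)
    have hlj : l ≠ j := fun h' => h (h' ▸ hl)
    by_cases hli : l = i
    · subst hli
      simp [Env.comap, Env.setInst, NameMap.swap]
    · simp [Env.comap, Env.setInst, NameMap.swap, Equiv.swap_apply_of_ne_of_ne hli hlj, hli, hlj]
  | alpha_pat _ _ => exact .mtch ..
  | and _ _ ih ih' => exact ih.and ih'
  | ex _ ih => exact ih.ex
  | all _ ih => exact ih.all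
  | letc _ _ ih ih' => exact ih.letc ih'
  | letr _ _ ih ih' => exact ih.letr ih'
  | exI _ ih => exact ih.exI
  | br_head _ _ => exact .mtch ..
  | br_tail _ _ => exact .mtch ..

/-! ## Iterated conjunctions and quantifiers -/

theorem Constr.conj_cons_ne {c : Constr} {cs : List Constr} (h : cs ≠ []) :
    Constr.conj (c :: cs) = .and c (Constr.conj cs) := by
  cases cs with
  | nil => exact absurd rfl h
  | cons d cs => rfl

theorem Constr.wt_conj {cs : List Constr} (h : cs ≠ []) (e k : ℕ) (ρ : Env) :
    (Constr.conj cs).wt e k ρ = (cs.map fun c => c.wt e k ρ).sum := by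
  induction cs with
  | nil => exact absurd rfl h
  | cons c cs ih =>
    by_cases hcs : cs = []
    · simp [hcs, Constr.conj]
    · rw [Constr.conj_cons_ne hcs, Constr.wt, ih hcs, List.map_cons, List.sum_cons]

theorem Constr.wt_conj_snoc (cs : List Constr) (c : Constr) (e k : ℕ) (ρ : Env) :
    (Constr.conj (cs ++ [c])).wt e k ρ = (cs.map fun c => c.wt e k ρ).sum + c.wt e k ρ := by
  rw [Constr.wt_conj (by simp), List.map_append, List.sum_append]
  simp

theorem Constr.matches_conj (cs : List Constr) :
    (Constr.conj cs).matches = (cs.map Constr.matches).sum := by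
  induction cs with
  | nil => rfl
  | cons c cs ih =>
    by_cases hcs : cs = []
    · simp [hcs, Constr.conj]
    · simp [Constr.conj_cons_ne hcs, Constr.matches, ih]

theorem Constr.apps_conj (cs : List Constr) :
    (Constr.conj cs).apps = (cs.map Constr.apps).sum := by
  induction cs with
  | nil => rfl
  | cons c cs ih =>
    by_cases hcs : cs = []
    · simp [hcs, Constr.conj]
    · simp [Constr.conj_cons_ne hcs, Constr.apps, ih]

theorem Constr.lets_conj (cs : List Constr) :
    (Constr.conj cs).lets = (cs.map Constr.lets).sum := by
  induction cs with
  | nil => rfl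
  | cons c cs ih =>
    by_cases hcs : cs = []
    · simp [hcs, Constr.conj]
    · simp [Constr.conj_cons_ne hcs, Constr.lets, ih]

theorem Constr.subst_conj (b g : TyVar) (cs : List Constr) :
    (Constr.conj cs).subst b g = Constr.conj (cs.map (Constr.subst b g)) := by
  induction cs with
  | nil => simp [Constr.conj, Constr.subst]
  | cons c cs ih =>
    by_cases hcs : cs = []
    · simp [hcs, Constr.conj]
    · rw [Constr.conj_cons_ne hcs, Constr.subst, ih, List.map_cons,
        Constr.conj_cons_ne (by simpa using hcs)]

theorem Constr.bn_conj_snoc_eqn (cs : List Constr) (E : MultiEq) :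
    (Constr.conj (cs ++ [.eqn E])).bn = (Constr.conj cs).bn := by
  induction cs with
  | nil => simp [Constr.conj, Constr.bn]
  | cons c cs ih =>
    rw [List.cons_append, Constr.conj_cons_ne (by simp), Constr.bn, ih]
    by_cases hcs : cs = []
    · simp [hcs, Constr.conj, Constr.bn]
    · rw [Constr.conj_cons_ne hcs, Constr.bn]

theorem Constr.Vis_conj_snoc {Q : Typ → Prop} {cs : List Constr} {c : Constr} {a b : TyVar}
    (h : c.Vis Q a b) : (Constr.conj (cs ++ [c])).Vis Q a b := by
  induction cs with
  | nil => exact h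
  | cons d cs ih =>
    rw [List.cons_append, Constr.conj_cons_ne (by simp)]
    exact Or.inr ih

theorem Env.bind_bind (ρ : Env) (as bs : List TyVar) :
    (ρ.bind as).bind bs = ρ.bind (as ++ bs) := by
  ext <;> simp only [Env.bind, List.mem_append] <;> split_ifs <;> simp_all

theorem Env.bind_congr (ρ : Env) {as bs : List TyVar} (h : ∀ b, b ∈ as ↔ b ∈ bs) :
    ρ.bind as = ρ.bind bs := by
  simp only [Env.bind, h]

theorem Env.bind_nil (ρ : Env) : ρ.bind [] = ρ := by
  simp [Env.bind]

theorem Constr.wt_exs (as : List TyVar) (c : Constr) (e k : ℕ) (ρ : Env) :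
    (Constr.exs as c).wt e k ρ = as.length • unit (item e 0 2 k) + c.wt e k (ρ.bind as) := by
  induction as generalizing ρ with
  | nil => simp [Constr.exs, Env.bind_nil]
  | cons a as ih =>
    simp only [Constr.exs, List.foldr_cons, Constr.wt] at ih ⊢
    rw [ih, Env.bind_bind, List.length_cons, succ_nsmul', add_assoc, List.singleton_append]

theorem Constr.wt_alls (as : List TyVar) (c : Constr) (e k : ℕ) (ρ : Env) :
    (Constr.alls as c).wt e k ρ = c.wt e (k + as.length) (ρ.bind as) := by
  induction as generalizing ρ k with
  | nil => simp [Constr.alls, Env.bind_nil]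
  | cons a as ih =>
    simp only [Constr.alls, List.foldr_cons, Constr.wt] at ih ⊢
    rw [ih, Env.bind_bind, List.length_cons, List.singleton_append, Nat.add_right_comm,
      Nat.add_assoc]

theorem Constr.matches_exs (as : List TyVar) (c : Constr) :
    (Constr.exs as c).matches = c.matches := by
  induction as with
  | nil => rfl
  | cons a as ih => exact ih

theorem Constr.apps_exs (as : List TyVar) (c : Constr) : (Constr.exs as c).apps = c.apps := by
  induction as with
  | nil => rfl
  | cons a as ih => exact ih

theorem Constr.lets_exs (as : List TyVar) (c : Constr) : (Constr.exs as c).lets = c.lets := by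
  induction as with
  | nil => rfl
  | cons a as ih => exact ih

theorem Constr.matches_alls (as : List TyVar) (c : Constr) :
    (Constr.alls as c).matches = c.matches := by
  induction as with
  | nil => rfl
  | cons a as ih => exact ih

theorem Constr.apps_alls (as : List TyVar) (c : Constr) : (Constr.alls as c).apps = c.apps := by
  induction as with
  | nil => rfl
  | cons a as ih => exact ih

theorem Constr.lets_alls (as : List TyVar) (c : Constr) : (Constr.alls as c).lets = c.lets := by
  induction as with
  | nil => rfl
  | cons a as ih => exact ih

/-! ## Contexts -/

theorem Ctx.matches_fill (C : Ctx) : ∃ n, ∀ c, (C.fill c).matches = n + c.matches := by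
  induction C with
  | hole => exact ⟨0, fun c => (Nat.zero_add _).symm⟩
  | andL C d ih => obtain ⟨n, h⟩ := ih; exact ⟨n + d.matches, fun c => by
      simp only [Ctx.fill, Constr.matches, h]; omega⟩
  | andR d C ih => obtain ⟨n, h⟩ := ih; exact ⟨n + d.matches, fun c => by
      simp only [Ctx.fill, Constr.matches, h]; omega⟩
  | letcL x a C d ih => obtain ⟨n, h⟩ := ih; exact ⟨n + d.matches, fun c => by
      simp only [Ctx.fill, Constr.matches, h]; omega⟩
  | letcR x a d C ih => obtain ⟨n, h⟩ := ih; exact ⟨n + d.matches, fun c => by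
      simp only [Ctx.fill, Constr.matches, h]; omega⟩
  | letrL x a as C d ih => obtain ⟨n, h⟩ := ih; exact ⟨n + d.matches, fun c => by
      simp only [Ctx.fill, Constr.matches, h]; omega⟩
  | letrR x a as d C ih => obtain ⟨n, h⟩ := ih; exact ⟨n + d.matches, fun c => by
      simp only [Ctx.fill, Constr.matches, h]; omega⟩
  | _ => assumption

theorem Ctx.apps_fill (C : Ctx) : ∃ n, ∀ c, (C.fill c).apps = n + c.apps := by
  induction C with
  | hole => exact ⟨0, fun c => (Nat.zero_add _).symm⟩
  | andL C d ih => obtain ⟨n, h⟩ := ih; exact ⟨n + d.apps, fun c => by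
      simp only [Ctx.fill, Constr.apps, h]; omega⟩
  | andR d C ih => obtain ⟨n, h⟩ := ih; exact ⟨n + d.apps, fun c => by
      simp only [Ctx.fill, Constr.apps, h]; omega⟩
  | letcL x a C d ih => obtain ⟨n, h⟩ := ih; exact ⟨n + d.apps + 1, fun c => by
      simp only [Ctx.fill, Constr.apps, h]; omega⟩
  | letcR x a d C ih => obtain ⟨n, h⟩ := ih; exact ⟨n + d.apps + 1, fun c => by
      simp only [Ctx.fill, Constr.apps, h]; omega⟩
  | letrL x a as C d ih => obtain ⟨n, h⟩ := ih; exact ⟨n + d.apps, fun c => by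
      simp only [Ctx.fill, Constr.apps, h]; omega⟩
  | letrR x a as d C ih => obtain ⟨n, h⟩ := ih; exact ⟨n + d.apps, fun c => by
      simp only [Ctx.fill, Constr.apps, h]; omega⟩
  | _ => assumption

theorem Ctx.lets_fill (C : Ctx) : ∃ n, ∀ c, (C.fill c).lets = n + c.lets := by
  induction C with
  | hole => exact ⟨0, fun c => (Nat.zero_add _).symm⟩
  | andL C d ih => obtain ⟨n, h⟩ := ih; exact ⟨n + d.lets, fun c => by
      simp only [Ctx.fill, Constr.lets, h]; omega⟩
  | andR d C ih => obtain ⟨n, h⟩ := ih; exact ⟨n + d.lets, fun c => by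
      simp only [Ctx.fill, Constr.lets, h]; omega⟩
  | letcL x a C d ih => obtain ⟨n, h⟩ := ih; exact ⟨n + d.lets + 1, fun c => by
      simp only [Ctx.fill, Constr.lets, h]; omega⟩
  | letcR x a d C ih => obtain ⟨n, h⟩ := ih; exact ⟨n + d.lets + 1, fun c => by
      simp only [Ctx.fill, Constr.lets, h]; omega⟩
  | letrL x a as C d ih => obtain ⟨n, h⟩ := ih; exact ⟨n + d.lets + 1, fun c => by
      simp only [Ctx.fill, Constr.lets, h]; omega⟩
  | letrR x a as d C ih => obtain ⟨n, h⟩ := ih; exact ⟨n + d.lets + 1, fun c => by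
      simp only [Ctx.fill, Constr.lets, h]; omega⟩
  | _ => assumption

theorem Ctx.spread_fill_lt (C : Ctx) {c d : Constr} (h : d.spread < c.spread) :
    (C.fill d).spread < (C.fill c).spread := by
  induction C with
  | hole => exact h
  | andL C u ih => exact Nat.mul_lt_mul_of_pos_right ih (by have := u.two_le_spread; omega)
  | andR u C ih => exact Nat.mul_lt_mul_of_pos_left ih (by have := u.two_le_spread; omega)
  | _ => simp only [Ctx.fill, Constr.spread]; omega

theorem Ctx.same_fill (C : Ctx) {c d : Constr} (h : c.Same d) : (C.fill c).Same (C.fill d) := by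
  induction C with
  | hole => exact h
  | andL C u ih => exact ih.and (.refl u)
  | andR u C ih => exact (Constr.Same.refl u).and ih
  | ex a C ih => exact ih.ex
  | all a C ih => exact ih.all
  | letcL x a C u ih => exact ih.letc (.refl u)
  | letcR x a u C ih => exact (Constr.Same.refl u).letc ih
  | letrL x a as C u ih => exact ih.letr (.refl u)
  | letrR x a as u C ih => exact (Constr.Same.refl u).letr ih
  | exI i x C ih => exact ih.exI

/-- The environment at the hole. -/
noncomputable def Ctx.env : Ctx → Env → Env
  | .hole, ρ => ρ
  | .andL C _, ρ => C.env ρ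
  | .andR _ C, ρ => C.env ρ
  | .ex a C, ρ => C.env (ρ.bind [a])
  | .all a C, ρ => C.env (ρ.bind [a])
  | .letcL _ a C _, ρ => C.env (ρ.bind [a])
  | .letcR x _ _ C, ρ => C.env (ρ.setTerm x 0)
  | .letrL _ a as C _, ρ => C.env (ρ.bind (a :: as))
  | .letrR x a as c C, ρ => C.env ((ρ.bind (a :: as)).setTerm x (c.regionPot (a :: as)))
  | .exI i x C, ρ => C.env (ρ.setInst i x)

/-- A decrease of the definition of a region outweighs the rest of the let-constraint. -/
theorem letr_lt_of_def_lt {E n n' : ℕ} {A A' B B' : Wt} (hA : SuppGe (item E 0 1 0) A)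
    (h : A' < A) (hB : SuppLt (item E 0 0 0) B') :
    n' • unit (item E 0 0 0) + A' + B' < n • unit (item E 0 0 0) + A + B := by
  have h0 : item E 0 0 0 < item E 0 1 0 := by simp [item_lt_iff]
  have h1 : A' + (n' • unit (item E 0 0 0) + B') < A :=
    add_lt_of_suppLt hA h (((SuppLt.unit h0).nsmul n').add (hB.mono h0.le))
  calc n' • unit (item E 0 0 0) + A' + B' = A' + (n' • unit (item E 0 0 0) + B') := by
        rw [add_comm _ A', add_assoc]
    _ < A := h1
    _ ≤ n • unit (item E 0 0 0) + A := le_add_of_nonneg_left (wt_nonneg _)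
    _ ≤ n • unit (item E 0 0 0) + A + B := le_add_of_nonneg_right (wt_nonneg _)

/-- A decrease of the number of variables of a region outweighs the body of the let-constraint. -/
theorem letr_lt_of_card_lt {E n n' : ℕ} {A A' B B' : Wt} (hn : n' < n) (hA : A' ≤ A)
    (hB : SuppLt (item E 0 0 0) B') :
    n' • unit (item E 0 0 0) + A' + B' < n • unit (item E 0 0 0) + A + B := by
  have h1 : n' • unit (item E 0 0 0) + B' < n • unit (item E 0 0 0) :=
    add_lt_of_suppLt ((SuppGe.unit le_rfl).nsmul n) (nsmul_unit_lt hn) hB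
  calc n' • unit (item E 0 0 0) + A' + B' = n' • unit (item E 0 0 0) + B' + A' := by
        rw [add_right_comm]
    _ < n • unit (item E 0 0 0) + A := add_lt_add_of_lt_of_le h1 hA
    _ ≤ n • unit (item E 0 0 0) + A + B := le_add_of_nonneg_right (wt_nonneg _)

/-- The decrease is required only in the environment at the hole, since Copy decreases nowhere else.
The bound on the number of lets keeps the degrees of definitions from rising when the hole is in a
let body. -/
theorem Ctx.wt_fill_lt (C : Ctx) {c d : Constr} (hl : d.lets ≤ c.lets) {e k : ℕ} {ρ : Env}
    (h : ∀ e k, d.wt e k (C.env ρ) < c.wt e k (C.env ρ)) :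
    (C.fill d).wt e k ρ < (C.fill c).wt e k ρ := by
  have hfill : ∀ C : Ctx, (C.fill d).lets ≤ (C.fill c).lets := fun C => by
    obtain ⟨n, hn⟩ := C.lets_fill
    rw [hn, hn]
    omega
  induction C generalizing e k ρ with
  | hole => exact h e k
  | andL C u ih => exact add_lt_add_of_lt_of_le (ih h) le_rfl
  | andR u C ih => exact add_lt_add_of_le_of_lt le_rfl (ih h)
  | ex a C ih => exact add_lt_add_of_le_of_lt le_rfl (ih h)
  | all a C ih => exact ih h
  | letcL x a C u ih => exact add_lt_add_of_lt_of_le (ih h) le_rfl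
  | letcR x a u C ih =>
    exact add_lt_add_of_le_of_lt
      (u.wt_mono (by have := hfill C; omega) le_rfl (EnvLe.refl _ _)) (ih h)
  | letrL x a as C u ih =>
    -- Potentials in the body `u` and the counters may change arbitrarily here; both lie below the
    -- definition.
    exact letr_lt_of_def_lt (Constr.suppGe_wt _ _ _ _) (ih h) (u.suppLt_wt _ _ _)
  | letrR x a as u C ih =>
    have hE : e + 1 + (C.fill d).lets ≤ e + 1 + (C.fill c).lets := by have := hfill C; omega
    refine add_lt_add_of_le_of_lt (add_le_add (nsmul_le_nsmul_right (unit_le ?_) _)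
      (u.wt_mono hE le_rfl (EnvLe.refl _ _))) (ih h)
    rw [item_le_iff]
    rcases hE.lt_or_eq with hE | hE
    · exact Or.inl hE
    · exact Or.inr ⟨hE, by simp⟩
  | exI i x C ih => exact add_lt_add_of_le_of_lt le_rfl (ih h)

theorem Ctx.env_inst_of_owner_none (C : Ctx) {i : InstVar} {b : TyVar} {ρ : Env}
    (ho : C.owner i = none) (hb : .tv b ∉ C.bvs) : (C.env ρ).inst i b = ρ.inst i b := by
  induction C generalizing ρ with
  | hole => rfl
  | andL C u ih => exact ih ho hb
  | andR u C ih => exact ih ho hb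
  | exI j y C ih =>
    simp only [Ctx.owner, Option.or_eq_none_iff] at ho
    have hji : i ≠ j := by
      rintro rfl
      simp at ho
    rw [Ctx.env, ih ho.1 (fun h => hb (by simp [Ctx.bvs, h]))]
    simp [Env.setInst, hji]
  | _ =>
    simp only [Ctx.owner] at ho
    simp only [Ctx.bvs, Finset.mem_insert, Finset.mem_union, mem_tvs, not_or, Name.tv.injEq,
      List.mem_cons, exists_eq_right] at hb
    rename_i ih
    rw [Ctx.env, ih ho (by simp_all)]
    simp_all [Env.bind, Env.setTerm]

/-- At the hole the potentials for an instantiation variable of `x` are those of `x`. -/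
theorem Ctx.env_inst_of_owner (C : Ctx) {i : InstVar} {x : TermVar} {b : TyVar} {ρ : Env}
    (ho : C.owner i = some x) (hx : .tm x ∉ C.bvs) (hb : .tv b ∉ C.bvs) :
    (C.env ρ).inst i b = ρ.term x b := by
  induction C generalizing ρ with
  | hole => simp [Ctx.owner] at ho
  | andL C u ih => exact ih ho hx hb
  | andR u C ih => exact ih ho hx hb
  | exI j y C ih =>
    have hx' : .tm x ∉ C.bvs := fun h => hx (by simp [Ctx.bvs, h])
    have hb' : .tv b ∉ C.bvs := fun h => hb (by simp [Ctx.bvs, h])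
    simp only [Ctx.owner, Option.or_eq_some_iff] at ho
    rcases ho with ho | ⟨ho, hj⟩
    · exact ih ho hx' hb'
    -- No binder of `i` lies further inside, so the potentials recorded at this binder are still in
    -- force at the hole.
    · rw [Ctx.env, C.env_inst_of_owner_none ho hb']
      by_cases hji : j = i
      · subst hji
        rw [if_pos rfl, Option.some_inj] at hj
        subst hj
        simp [Env.setInst]
      · simp [hji] at hj
  | _ =>
    simp only [Ctx.owner] at ho
    simp only [Ctx.bvs, Finset.mem_insert, Finset.mem_union, mem_tvs, not_or, Name.tv.injEq,
      Name.tm.injEq, List.mem_cons, exists_eq_right] at hb hx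
    rename_i ih
    rw [Ctx.env, ih ho (by simp_all) (by simp_all)]
    simp_all [Env.bind, Env.setTerm]

/-! ## Substitution of variables -/

/-- The renaming of `b` to `g`. -/
def single (b g : TyVar) (a : TyVar) : TyVar := if a = b then g else a

theorem single_ne {b g a : TyVar} (h : a ≠ b) : single b g a = a := if_neg h

theorem single_self (b g : TyVar) : single b g b = g := if_pos rfl

theorem single_eq_iff_of_ne {b g a x : TyVar} (hb : a ≠ b) (hg : a ≠ g) :
    single b g x = a ↔ x = a := by
  unfold single
  split_ifs with h
  · subst h
    exact ⟨fun h => absurd h.symm hg, fun h => absurd h.symm hb⟩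
  · rfl

theorem Ty.subst1_eq_rename (b g : TyVar) : Ty.subst1 b g = Ty.rename (n := 0) (single b g) := rfl

mutual
theorem Constr.matches_subst (b g : TyVar) : (c : Constr) → (c.subst b g).matches = c.matches
  | .and c d => by simp [Constr.subst, Constr.matches, c.matches_subst b g, d.matches_subst b g]
  | .ex a c => by
    simp only [Constr.subst, Constr.matches]; split <;> simp [c.matches_subst b g]
  | .all a c => by
    simp only [Constr.subst, Constr.matches]; split <;> simp [c.matches_subst b g]
  | .letc _ _ c d => by
    simp only [Constr.subst, Constr.matches]
    split <;> simp [c.matches_subst b g, d.matches_subst b g]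
  | .letr _ _ _ c d => by
    simp only [Constr.subst]
    split <;> simp [Constr.matches, c.matches_subst b g, d.matches_subst b g]
  | .exI _ _ c => by simp [Constr.subst, Constr.matches, c.matches_subst b g]
  | .mtch _ bs => by simp [Constr.subst, Constr.matches, bs.matches_subst b g]
  | .tru => rfl
  | .fls => rfl
  | .eqn _ => rfl
  | .app _ _ => rfl
  | .inst _ _ _ => rfl
  | .labInst _ _ _ _ => rfl
  | .domEq _ _ => rfl
  | .schLe _ _ => rfl
  | .leSch _ _ => rfl

theorem Branches.matches_subst (b g : TyVar) :
    (bs : Branches) → (bs.subst b g).matches = bs.matches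
  | .nil => rfl
  | .cons _ c bs => by
    simp only [Branches.subst, Branches.matches, bs.matches_subst b g]
    split <;> simp [c.matches_subst b g]
end

theorem Constr.apps_subst (b g : TyVar) (c : Constr) : (c.subst b g).apps = c.apps := by
  induction c using Constr.ind <;> simp only [Constr.subst] <;> try split
  all_goals simp_all [Constr.apps]

theorem Constr.lets_subst (b g : TyVar) (c : Constr) : (c.subst b g).lets = c.lets := by
  induction c using Constr.ind <;> simp only [Constr.subst] <;> try split
  all_goals simp_all [Constr.lets]

theorem Constr.vis_subst {b g : TyVar} {c : Constr} (hg : .tv g ∉ c.bn) {a : TyVar}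
    (h : a ∈ (c.subst b g).vis) : a ∈ c.vis.image (single b g) := by
  induction c using Constr.ind generalizing a with
  | and c d ihc ihd =>
    simp only [Constr.bn, Finset.mem_union, not_or] at hg
    rw [Constr.vis, Finset.image_union, Finset.mem_union]
    exact (Finset.mem_union.1 h).imp (ihc hg.1) (ihd hg.2)
  | ex y c ih =>
    simp only [Constr.bn, Finset.mem_insert, Name.tv.injEq, not_or] at hg
    simp only [Constr.subst, Constr.vis, Finset.mem_erase] at h
    simp only [Constr.vis, Finset.mem_image, Finset.mem_erase]
    by_cases hy : y = b
    · subst hy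
      rw [if_pos rfl] at h
      exact ⟨a, h, single_ne h.1⟩
    · rw [if_neg hy] at h
      obtain ⟨x, hx, rfl⟩ := Finset.mem_image.1 (ih hg.2 h.2)
      refine ⟨x, ⟨?_, hx⟩, rfl⟩
      rintro rfl
      exact h.1 (single_ne hy)
  | eqn E =>
    rwa [Constr.subst, Constr.vis, Ty.subst1_eq_rename, MultiEq.fv_rename] at h
  | letr x y as c d _ _ =>
    simp only [Constr.subst] at h
    split at h <;> simp [Constr.vis] at h
  | _ => simp [Constr.subst, Constr.vis] at h

theorem Constr.Vis_subst {Q : Typ → Prop} (hQ : RenInv Q) {b g : TyVar} {c : Constr}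
    (hg : .tv g ∉ c.bn) {x y : TyVar} (h : (c.subst b g).Vis Q x y) :
    ∃ x₀ y₀, c.Vis Q x₀ y₀ ∧ single b g x₀ = x ∧ single b g y₀ = y := by
  induction c using Constr.ind generalizing x y with
  | and c d ihc ihd =>
    simp only [Constr.bn, Finset.mem_union, not_or] at hg
    rcases h with h | h
    · obtain ⟨x₀, y₀, h, h'⟩ := ihc hg.1 h
      exact ⟨x₀, y₀, Or.inl h, h'⟩
    · obtain ⟨x₀, y₀, h, h'⟩ := ihd hg.2 h
      exact ⟨x₀, y₀, Or.inr h, h'⟩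
  | ex a c ih =>
    simp only [Constr.bn, Finset.mem_insert, Name.tv.injEq, not_or] at hg
    simp only [Constr.subst, Constr.Vis] at h
    by_cases ha : a = b
    · subst ha
      rw [if_pos rfl] at h
      exact ⟨x, y, h, single_ne h.1, single_ne h.2.1⟩
    · rw [if_neg ha] at h
      obtain ⟨x₀, y₀, h', rfl, rfl⟩ := ih hg.2 h.2.2
      refine ⟨x₀, y₀, ⟨?_, ?_, h'⟩, rfl, rfl⟩
      · rintro rfl
        exact h.1 (single_ne ha)
      · rintro rfl
        exact h.2.1 (single_ne ha)
  | eqn E => exact (Constr.vis_eqn_rename hQ).1 h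
  | letr u a as c d _ _ =>
    simp only [Constr.subst] at h
    split at h <;> exact h.elim
  | _ => exact h.elim

/-- A substitution that does not identify visible variables does not increase potentials. -/
theorem Constr.pot_subst_le {b g : TyVar} {c : Constr} (hg : .tv g ∉ c.bn)
    (hinj : Set.InjOn (single b g) c.vis) {a : TyVar} (hab : a ≠ b) (hag : a ≠ g) :
    (c.subst b g).pot a ≤ c.pot a := by
  have key : ∀ {Q}, RenInv Q → ∀ x y, (c.subst b g).Vis Q x y →
      ∃ x₀ ∈ (c.vis : Set TyVar), ∃ y₀ ∈ (c.vis : Set TyVar),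
        c.Vis Q x₀ y₀ ∧ single b g x₀ = x ∧ single b g y₀ = y := by
    intro Q hQ x y h
    obtain ⟨x₀, y₀, h, h'⟩ := Constr.Vis_subst hQ hg h
    exact ⟨x₀, h.mem_vis.1, y₀, h.mem_vis.2, h, h'⟩
  exact relPot_push_le (key renInv_true) (key renInv_proper) hinj
    fun x _ h => (single_eq_iff_of_ne hab hag).1 h

/-- Comparison of environments along the substitution of `g` for `b`. -/
structure EnvSubst (b g : TyVar) (ρ' ρ : Env) : Prop where
  inst : ∀ i h, ρ'.inst i (single b g h) ≤ ρ.inst i h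
  term : ∀ x h, ρ'.term x (single b g h) ≤ ρ.term x h

/-- The substitution stops at a binder of `b`, so from there on the same constraint is compared in
two environments. -/
theorem EnvSubst.bind_of_mem {b g : TyVar} {ρ' ρ : Env} (h : EnvSubst b g ρ' ρ)
    {as : List TyVar} (hb : b ∈ as) (S : Finset Name) : EnvLe S (ρ'.bind as) (ρ.bind as) := by
  constructor
  · intro i a _ _
    by_cases ha : a ∈ as
    · simp [Env.bind, ha]
    · have := h.inst i a
      rw [single_ne fun h' : a = b => ha (h' ▸ hb)] at this
      simpa [Env.bind, ha] using this
  · intro i a _ _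
    by_cases ha : a ∈ as
    · simp [Env.bind, ha]
    · have := h.term i a
      rw [single_ne fun h' : a = b => ha (h' ▸ hb)] at this
      simpa [Env.bind, ha] using this

theorem EnvSubst.bind {b g : TyVar} {ρ' ρ : Env} (h : EnvSubst b g ρ' ρ)
    {as : List TyVar} (hg : g ∉ as) : EnvSubst b g (ρ'.bind as) (ρ.bind as) := by
  have hs : ∀ a, a ∉ as → single b g a ∉ as := by
    intro a ha
    unfold single
    split <;> assumption
  constructor
  · intro i a
    by_cases ha : a ∈ as
    · simp [Env.bind, ha]
    · simpa [Env.bind, ha, hs a ha] using h.inst i a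
  · intro i a
    by_cases ha : a ∈ as
    · simp [Env.bind, ha]
    · simpa [Env.bind, ha, hs a ha] using h.term i a

theorem EnvSubst.setInst {b g : TyVar} {ρ' ρ : Env} (h : EnvSubst b g ρ' ρ) (i : InstVar)
    (x : TermVar) : EnvSubst b g (ρ'.setInst i x) (ρ.setInst i x) := by
  refine ⟨fun j a => ?_, h.term⟩
  by_cases hj : j = i
  · subst hj
    simpa [Env.setInst] using h.term x a
  · simpa [Env.setInst, hj] using h.inst j a

theorem EnvSubst.setTerm {b g : TyVar} {ρ' ρ : Env} (h : EnvSubst b g ρ' ρ) (x : TermVar)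
    {p' p : TyVar → ℕ∞} (hp : ∀ a, p' (single b g a) ≤ p a) :
    EnvSubst b g (ρ'.setTerm x p') (ρ.setTerm x p) := by
  refine ⟨h.inst, fun y a => ?_⟩
  by_cases hy : y = x
  · subst hy
    simpa [Env.setTerm] using hp a
  · simpa [Env.setTerm, hy] using h.term y a

/-- Sizes of types do not change and the environments are comparable by assumption, so the only
danger is a nested region whose potentials rise because two of its visible variables become equal.
Its count of visible variables then drops, which outweighs its whole body. -/
theorem Constr.wt_subst_le {b g : TyVar} {c : Constr} (hg : .tv g ∉ c.bn) {e k : ℕ}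
    {ρ' ρ : Env} (h : EnvSubst b g ρ' ρ) : (c.subst b g).wt e k ρ' ≤ c.wt e k ρ := by
  induction c using Constr.ind generalizing e k ρ' ρ with
  | and c d ihc ihd =>
    simp only [Constr.bn, Finset.mem_union, not_or] at hg
    exact add_le_add (ihc hg.1 h) (ihd hg.2 h)
  | ex a c ih =>
    simp only [Constr.bn, Finset.mem_insert, Name.tv.injEq, not_or] at hg
    simp only [Constr.subst, Constr.wt]
    gcongr
    by_cases ha : a = b
    · rw [if_pos ha]
      exact c.wt_mono le_rfl le_rfl (h.bind_of_mem (by simp [ha]) _)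
    · rw [if_neg ha]
      exact ih hg.2 (h.bind (by simpa using hg.1))
  | all a c ih =>
    simp only [Constr.bn, Finset.mem_insert, Name.tv.injEq, not_or] at hg
    simp only [Constr.subst, Constr.wt]
    by_cases ha : a = b
    · rw [if_pos ha]
      exact c.wt_mono le_rfl le_rfl (h.bind_of_mem (by simp [ha]) _)
    · rw [if_neg ha]
      exact ih hg.2 (h.bind (by simpa using hg.1))
  | eqn E => simp [Constr.subst, Constr.wt, Ty.subst1_eq_rename, Ty.size_rename]
  | letc x a c d ihc ihd =>
    simp only [Constr.bn, Finset.mem_union, Finset.mem_insert, Finset.mem_singleton,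
      Name.tv.injEq, not_or, reduceCtorEq, not_false_eq_true, true_and] at hg
    simp only [Constr.subst, Constr.wt, Constr.lets_subst]
    refine add_le_add ?_ (ihd hg.2 (h.setTerm x fun _ => le_rfl))
    by_cases ha : a = b
    · rw [if_pos ha]
      exact c.wt_mono le_rfl le_rfl (h.bind_of_mem (by simp [ha]) _)
    · rw [if_neg ha]
      exact ihc hg.1.2 (h.bind (by simpa using hg.1.1))
  | letr x a as c d ihc ihd =>
    simp only [Constr.bn, Finset.mem_union, Finset.mem_insert, mem_tvs, not_or, reduceCtorEq,
      Name.tv.injEq, exists_eq_right] at hg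
    obtain ⟨⟨⟨-, hga⟩, hgc⟩, hgd⟩ := hg
    simp only [Constr.subst]
    by_cases hb : b ∈ a :: as
    · rw [if_pos hb]
      have hbind := fun S => h.bind_of_mem hb S
      refine add_le_add (add_le_add le_rfl (c.wt_mono le_rfl le_rfl (hbind _)))
        (d.wt_mono le_rfl le_rfl ((hbind _).setTerm (fun _ => le_rfl) Finset.sdiff_subset))
    · rw [if_neg hb]
      have hbind := h.bind hga
      have hc := ihc hgc (e := e + 1 + d.lets) (k := 0) hbind
      simp only [Constr.wt, Constr.lets_subst]
      have hsub : (c.subst b g).vis ⊆ c.vis.image (single b g) := fun a ha =>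
        Constr.vis_subst hgc ha
      -- Either two visible variables are identified and the counter pays, or the substitution is
      -- injective on them and potentials do not increase.
      rcases (Finset.card_image_le (s := c.vis) (f := single b g)).lt_or_eq with hcard | hcard
      · refine (letr_lt_of_card_lt ?_ hc ?_).le
        · have := Finset.card_le_card hsub
          omega
        · have := (d.subst b g).suppLt_wt e (k + 1)
          rw [Constr.lets_subst] at this
          exact this _
      · have hinj := Finset.card_image_iff.1 hcard
        refine add_le_add (add_le_add (nsmul_wt_le ?_ le_rfl) hc) (ihd hgd (hbind.setTerm x ?_))
        · have := Finset.card_le_card hsub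
          omega
        · intro y
          by_cases hy : y = b
          -- The variable `g` is outside the region, where potentials are 0 by convention.
          · rw [hy, single_self, Constr.regionPot, if_neg hga]
            exact zero_le
          · rw [single_ne hy]
            unfold Constr.regionPot
            split_ifs with hya
            · exact Constr.pot_subst_le hgc hinj hy fun h => hga (h ▸ hya)
            · exact le_rfl
  | exI i x c ih =>
    simp only [Constr.bn, Finset.mem_insert, reduceCtorEq, false_or] at hg
    exact add_le_add le_rfl (ih hg (h.setInst i x))
  | inst i a t =>
    have h1 : Typ.nonVar (t.subst1 b g) = Typ.nonVar t := Typ.nonVar_rename _ _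
    simp only [Constr.subst, Constr.wt, h1]
    refine unit_le ?_
    rw [item_le_iff]
    have h2 : ρ'.inst i (if a = b then g else a) + 1 ≤ ρ.inst i a + 1 := by
      gcongr
      exact h.inst i a
    rcases h2.lt_or_eq with h2 | h2
    · exact Or.inr ⟨rfl, Or.inl h2⟩
    · exact Or.inr ⟨rfl, Or.inr ⟨h2, by simp⟩⟩
  | _ => exact le_rfl

/-! ## The termination order -/

/-- `d` is smaller than `c` in the termination order, in every context. -/
inductive Constr.Dec (c d : Constr) : Prop
  | of_matches (hm : d.matches < c.matches)
  | of_apps (hm : d.matches ≤ c.matches) (ha : d.apps < c.apps)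
  | of_wt (hm : d.matches ≤ c.matches) (ha : d.apps ≤ c.apps) (hl : d.lets ≤ c.lets)
      (hw : ∀ e k ρ, d.wt e k ρ < c.wt e k ρ)
  | of_spread (hm : d.matches ≤ c.matches) (ha : d.apps ≤ c.apps) (hs : d.Same c)
      (hp : d.spread < c.spread)

theorem Constr.Dec.fill {c d : Constr} (h : c.Dec d) (C : Ctx) : (C.fill c).Dec (C.fill d) := by
  obtain ⟨m, hm⟩ := C.matches_fill
  obtain ⟨n, hn⟩ := C.apps_fill
  obtain ⟨l, hl⟩ := C.lets_fill
  cases h with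
  | of_matches h1 => exact .of_matches (by rw [hm, hm]; omega)
  | of_apps h1 h2 => exact .of_apps (by rw [hm, hm]; omega) (by rw [hn, hn]; omega)
  | of_wt h1 h2 h3 h4 =>
    exact .of_wt (by rw [hm, hm]; omega) (by rw [hn, hn]; omega) (by rw [hl, hl]; omega)
      fun e k ρ => C.wt_fill_lt h3 fun e k => h4 e k _
  | of_spread h1 h2 h3 h4 =>
    exact .of_spread (by rw [hm, hm]; omega) (by rw [hn, hn]; omega) (C.same_fill h3)
      (C.spread_fill_lt h4)

theorem Constr.Dec.congr {c c' d d' : Constr} (hc : c.Equiv c') (h : c'.Dec d')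
    (hd : d'.Equiv d) : c.Dec d := by
  obtain ⟨c1, c2, c3, c4⟩ := hc.counts_eq
  obtain ⟨d1, d2, d3, d4⟩ := hd.counts_eq
  cases h with
  | of_matches h1 => exact .of_matches (by omega)
  | of_apps h1 h2 => exact .of_apps (by omega) (by omega)
  | of_wt h1 h2 h3 h4 =>
    exact .of_wt (by omega) (by omega) (by omega) fun e k ρ => by
      rw [hc.same.wt, ← hd.same.wt]
      exact h4 e k ρ
  | of_spread h1 h2 h3 h4 =>
    exact .of_spread (by omega) (by omega) (hd.same.symm.trans (h3.trans hc.same.symm)) (by omega)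

/-- The measure of a constraint. -/
noncomputable def Constr.measure (c : Constr) : ℕ ×ₗ ℕ ×ₗ Wt ×ₗ ℕ :=
  toLex (c.matches, toLex (c.apps, toLex (c.wt 0 0 ⟨0, 0⟩, c.spread)))

theorem Constr.Dec.measure_lt {c d : Constr} (h : c.Dec d) : d.measure < c.measure := by
  simp only [Constr.measure, Prod.Lex.toLex_lt_toLex]
  cases h with
  | of_matches h1 => exact Or.inl h1
  | of_apps h1 h2 =>
    exact h1.lt_or_eq.imp_right fun h1 => ⟨h1, Or.inl h2⟩
  | of_wt h1 h2 h3 h4 =>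
    exact h1.lt_or_eq.imp_right fun h1 => ⟨h1, h2.lt_or_eq.imp_right fun h2 =>
      ⟨h2, Or.inl (h4 _ _ _)⟩⟩
  | of_spread h1 h2 h3 h4 =>
    exact h1.lt_or_eq.imp_right fun h1 => ⟨h1, h2.lt_or_eq.imp_right fun h2 =>
      ⟨h2, Or.inr ⟨h3.wt _ _ _, h4⟩⟩⟩

theorem terminating_of_dec {R : Constr → Constr → Prop} (h : ∀ c d, R c d → c.Dec d) :
    Terminating R := by
  rintro ⟨f, hf⟩
  have hwf : WellFounded fun c d : ℕ ×ₗ ℕ ×ₗ Wt ×ₗ ℕ => c < d := wellFounded_lt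
  exact (wellFounded_iff_isEmpty_descending_chain.1 hwf).false
    ⟨fun n => (f n).measure, fun n => (h _ _ (hf n)).measure_lt⟩

/-! ## Auxiliary facts on weights -/

theorem SuppLt.list_sum {z : Item} {s : List Wt} (h : ∀ w ∈ s, SuppLt z w) :
    SuppLt z s.sum := by
  rw [← Multiset.sum_coe]
  exact SuppLt.sum h

theorem Constr.wt_eqn_cons (t : Typ) (E : MultiEq) (e k : ℕ) (ρ : Env) :
    (Constr.eqn (t ::ₘ E)).wt e k ρ =
      unit (item e 0 (3 + t.size) k) + (Constr.eqn E).wt e k ρ := by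
  simp only [Constr.wt, Multiset.map_cons, Multiset.sum_cons]
  exact add_left_comm _ _ _

theorem Constr.wt_eq (t t' : Typ) (e k : ℕ) (ρ : Env) :
    (Constr.eq t t').wt e k ρ = unit (item e 0 2 k) +
      (unit (item e 0 (3 + t.size) k) + unit (item e 0 (3 + t'.size) k)) := by
  simp [Constr.eq, Constr.wt]

theorem Constr.suppLt_wt_eq {t t' : Typ} {e k v k' : ℕ} {p : ℕ∞} {ρ : Env}
    (h : p ≠ 0 ∨ t.size < v ∧ t'.size < v) :
    SuppLt (item e p (3 + v) k') ((Constr.eq t t').wt e k ρ) := by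
  rw [Constr.wt_eq]
  rcases h with h | h
  · refine (SuppLt.unit ?_).add ((SuppLt.unit ?_).add (SuppLt.unit ?_)) <;>
      exact item_lt_iff.2 (Or.inr ⟨rfl, Or.inl (pos_iff_ne_zero.2 h)⟩)
  · by_cases hp : p = 0
    · subst hp
      refine (SuppLt.unit ?_).add ((SuppLt.unit ?_).add (SuppLt.unit ?_)) <;>
        exact item_lt_iff.2 (Or.inr ⟨rfl, Or.inr ⟨rfl, Or.inl (by omega)⟩⟩)
    · refine (SuppLt.unit ?_).add ((SuppLt.unit ?_).add (SuppLt.unit ?_)) <;>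
        exact item_lt_iff.2 (Or.inr ⟨rfl, Or.inl (pos_iff_ne_zero.2 hp)⟩)

theorem unit_depth_lt {e v k k' : ℕ} {p : ℕ∞} (h : k < k') :
    unit (item e p v k) < unit (item e p v k') :=
  unit_lt (item_lt_iff.2 (Or.inr ⟨rfl, Or.inr ⟨rfl, Or.inr ⟨rfl, h⟩⟩⟩))

theorem Ctx.leaf_lt_wt_fill {C : Ctx} (h : C ≠ .hole) (c : Constr) (e k : ℕ) (ρ : Env) :
    unit (item e 0 1 k) < (C.fill c).wt e k ρ := by
  have hk : unit (item e 0 1 k) < unit (item e 0 1 (k + 1)) := unit_depth_lt (Nat.lt_succ_self k)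
  cases C with
  | hole => exact absurd rfl h
  | andL C u => exact (Constr.unit_le_wt _ _ _ _).trans_lt (lt_add_of_pos_right _ (u.wt_pos _ _ _))
  | andR u C => exact (Constr.unit_le_wt _ _ _ _).trans_lt (lt_add_of_pos_left _ (u.wt_pos _ _ _))
  | ex a C => exact (Constr.unit_le_wt _ _ _ _).trans_lt (lt_add_of_pos_left _ (unit_pos _))
  | all a C => exact hk.trans_le (Constr.unit_le_wt _ _ _ _)
  | letcL x a C u =>
    exact hk.trans_le (le_add_of_nonneg_of_le (wt_nonneg _) (Constr.unit_le_wt _ _ _ _))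
  | letcR x a u C =>
    exact hk.trans_le (le_add_of_nonneg_of_le (wt_nonneg _) (Constr.unit_le_wt _ _ _ _))
  | letrL x a as C u =>
    exact hk.trans_le (le_add_of_nonneg_of_le (wt_nonneg _) (Constr.unit_le_wt _ _ _ _))
  | letrR x a as u C =>
    exact hk.trans_le (le_add_of_nonneg_of_le (wt_nonneg _) (Constr.unit_le_wt _ _ _ _))
  | exI i x C =>
    exact hk.trans_le (le_add_of_nonneg_of_le (wt_nonneg _) (Constr.unit_le_wt _ _ _ _))

/-- A proper occurrence exhibits a multi-equation, and a multi-equation alone outweighs a leaf. -/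
theorem Constr.OccursProper.leaf_lt_wt {c : Constr} {a b : TyVar} (h : c.OccursProper a b)
    (e k : ℕ) (ρ : Env) : unit (item e 0 1 k) < c.wt e k ρ := by
  induction h generalizing ρ with
  | eqn _ _ =>
    exact lt_add_of_lt_of_nonneg (unit_lt (by simp [item_lt_iff])) (wt_nonneg _)
  | andL _ ih => exact lt_add_of_lt_of_nonneg (ih ρ) (wt_nonneg _)
  | andR _ ih => exact lt_add_of_nonneg_of_lt (wt_nonneg _) (ih ρ)
  | ex _ _ _ ih => exact lt_add_of_nonneg_of_lt (wt_nonneg _) (ih _)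

/-- Since rebound names get `⊤`, a constraint moved out of a scope never becomes heavier, without
any freshness condition. -/
theorem EnvLe.le_bind (S : Finset Name) (ρ : Env) (as : List TyVar) : EnvLe S ρ (ρ.bind as) := by
  constructor <;> intro i b _ _ <;> simp only [Env.bind] <;> split_ifs <;> simp

theorem EnvLe.trans {S : Finset Name} {ρ₁ ρ₂ ρ₃ : Env} (h : EnvLe S ρ₁ ρ₂) (h' : EnvLe S ρ₂ ρ₃) :
    EnvLe S ρ₁ ρ₃ :=
  ⟨fun i b hi hb => (h.inst i b hi hb).trans (h'.inst i b hi hb),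
    fun i b hi hb => (h.term i b hi hb).trans (h'.term i b hi hb)⟩

theorem EnvLe.le_setTerm {S : Finset Name} {x : TermVar} (hx : .tm x ∉ S) (ρ : Env)
    (p : TyVar → ℕ∞) : EnvLe S ρ (ρ.setTerm x p) := by
  refine ⟨fun _ _ _ _ => le_rfl, fun y b hy _ => ?_⟩
  have : y ≠ x := fun h => hx (h ▸ hy)
  simp [Env.setTerm, this]

theorem EnvLe.le_setInst {S : Finset Name} {i : InstVar} (hi : .iv i ∉ S) (ρ : Env)
    (x : TermVar) : EnvLe S ρ (ρ.setInst i x) := by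
  refine ⟨fun j b hj _ => ?_, fun _ _ _ _ => le_rfl⟩
  have : j ≠ i := fun h => hi (h ▸ hj)
  simp [Env.setInst, this]

theorem EnvLe.setInst_le {S : Finset Name} {i : InstVar} (hi : .iv i ∉ S) (ρ : Env)
    (x : TermVar) : EnvLe S (ρ.setInst i x) ρ := by
  refine ⟨fun j b hj _ => ?_, fun _ _ _ _ => le_rfl⟩
  have : j ≠ i := fun h => hi (h ▸ hj)
  simp [Env.setInst, this]

theorem EnvLe.setTerm_le_setTerm (S : Finset Name) {ρ : Env} {x : TermVar} {p p' : TyVar → ℕ∞}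
    (h : ∀ b, p b ≤ p' b) : EnvLe S (ρ.setTerm x p) (ρ.setTerm x p') :=
  (EnvLe.refl S ρ).setTerm h Finset.sdiff_subset

theorem EnvLe.bind_le {S : Finset Name} {as : List TyVar} (h : ∀ a ∈ as, .tv a ∉ S) (ρ : Env) :
    EnvLe S (ρ.bind as) ρ := by
  constructor <;> intro i b _ hb <;>
    simp [Env.bind, show b ∉ as from fun hba => h b hba hb]

theorem EnvLe.bind_same {S : Finset Name} {ρ ρ' : Env} (h : EnvLe S ρ ρ') (as : List TyVar) :
    EnvLe S (ρ.bind as) (ρ'.bind as) :=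
  h.bind Finset.sdiff_subset

/-! ## The rules of the unifier -/

theorem Constr.Dec.to_leaf {c : Constr} (h : ∀ e k ρ, unit (item e 0 1 k) < c.wt e k ρ) :
    c.Dec .fls ∧ c.Dec .tru :=
  ⟨.of_wt (Nat.zero_le _) (Nat.zero_le _) (Nat.zero_le _) h,
    .of_wt (Nat.zero_le _) (Nat.zero_le _) (Nat.zero_le _) h⟩

theorem Constr.Dec.and_tru (c : Constr) : (Constr.and c .tru).Dec c :=
  .of_wt le_rfl le_rfl le_rfl fun _ _ _ => lt_add_of_pos_right _ (unit_pos _)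

/-- The weight is the same on both sides, because an existential adds no depth and `d` does not see
`a`. Only `spread` decreases, from `(m + 1) * n` to `m * n + 1`. -/
theorem Constr.Dec.exists_conj {a : TyVar} {c d : Constr} (h : .tv a ∉ d.fv) :
    (Constr.and (.ex a c) d).Dec (.ex a (.and c d)) := by
  have hd : a ∉ d.vis := fun ha => h (Constr.vis_subset_fv ha)
  refine .of_spread le_rfl le_rfl ⟨rfl, ?_, fun Q hQ x y => ?_, fun e k ρ => ?_⟩ ?_
  · simp only [Constr.vis, Finset.erase_union_distrib, Finset.erase_eq_of_notMem hd]
  · simp only [Constr.Vis]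
    constructor
    · rintro ⟨hx, hy, hc | hd⟩
      · exact Or.inl ⟨hx, hy, hc⟩
      · exact Or.inr hd
    · rintro (⟨hx, hy, hc⟩ | hxy)
      · exact ⟨hx, hy, Or.inl hc⟩
      · exact ⟨fun hx => hd (hx ▸ hxy.mem_vis.1), fun hy => hd (hy ▸ hxy.mem_vis.2), Or.inr hxy⟩
  · have : d.wt e k (ρ.bind [a]) = d.wt e k ρ :=
      le_antisymm (d.wt_mono le_rfl le_rfl (EnvLe.bind_le (by simpa using h) ρ))
        (d.wt_mono le_rfl le_rfl (EnvLe.le_bind _ ρ _))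
    simp only [Constr.wt, this, add_assoc]
  · have := d.two_le_spread
    simp only [Constr.spread, Nat.add_mul, Nat.one_mul]
    omega

theorem URule.dec {u v : Constr} (h : URule u v) : u.Dec v := by
  cases h with
  | exists_ h => exact .exists_conj h
  | cycle h =>
    obtain ⟨a, b, hab, -⟩ := h
    exact (Constr.Dec.to_leaf fun e k ρ => hab.leaf_lt_wt e k ρ).1
  | true_ => exact .and_tru _
  | false_ h => exact (Constr.Dec.to_leaf fun e k ρ => Ctx.leaf_lt_wt_fill h _ e k ρ).1
  | @merge a e₁ e₂ =>
    refine .of_wt le_rfl le_rfl le_rfl fun e k ρ => ?_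
    simp only [Constr.wt, Multiset.map_cons, Multiset.sum_cons, Multiset.map_add,
      Multiset.sum_add]
    -- One multi-equation and one copy of `a` disappear.
    refine lt_of_lt_of_eq (lt_add_of_pos_right _ (add_pos (unit_pos (item e 0 2 k))
      (unit_pos (item e 0 (3 + (Ty.var a : Typ).size) k)))) ?_
    abel
  | stutter =>
    refine .of_wt le_rfl le_rfl le_rfl fun e k ρ => ?_
    rw [Constr.wt_eqn_cons _ (_ ::ₘ _)]
    exact lt_add_of_pos_left _ (unit_pos _)
  | @name s ts i a E hs hi _ _ =>
    refine .of_wt le_rfl le_rfl le_rfl fun e k ρ => ?_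
    rw [Constr.wt, Constr.wt, Constr.wt_eqn_cons, Constr.wt_eqn_cons, ← add_assoc, ← add_assoc]
    -- The item of the original type pays for everything new: a binder, an equation, the extracted
    -- argument and the remaining type. Weights of equations ignore names, so a capture of `a` would
    -- not matter.
    refine add_lt_add_of_lt_of_le (SuppLt.lt_unit ?_) le_rfl
    have h1 := Shape.size_lt_apply hs ts i
    have h2 := Shape.size_update_lt ts i hi a
    refine ((SuppLt.unit ?_).add (Constr.suppLt_wt_eq (Or.inr ⟨?_, h1⟩))).add (SuppLt.unit ?_)
    · exact item_lt_iff.2 (Or.inr ⟨rfl, Or.inr ⟨rfl, Or.inl (by omega)⟩⟩)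
    · simp only [Ty.size]; omega
    · exact item_lt_iff.2 (Or.inr ⟨rfl, Or.inr ⟨rfl, Or.inl (by omega)⟩⟩)
  | @decomp s as bs E hs =>
    refine .of_wt ?_ ?_ ?_ fun e k ρ => ?_
    · simp [Constr.matches_conj, Constr.matches, Constr.eq, List.map_ofFn, Function.comp_def]
    · simp [Constr.apps_conj, Constr.apps, Constr.eq, List.map_ofFn, Function.comp_def]
    · simp [Constr.lets_conj, Constr.lets, Constr.eq, List.map_ofFn, Function.comp_def]
    rw [Constr.wt_conj (by simp), List.map_cons, List.sum_cons, Multiset.cons_swap,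
      Constr.wt_eqn_cons (s.applyVars bs), add_comm]
    -- The removed member has value at least 4, while equations between variables consist of items
    -- of value at most 3.
    refine add_lt_add_of_lt_of_le (SuppLt.lt_unit (SuppLt.list_sum ?_)) le_rfl
    simp only [List.map_ofFn, List.mem_ofFn]
    rintro _ ⟨j, rfl⟩
    have := hs.one_le_size
    refine Constr.suppLt_wt_eq (ρ := ρ) (Or.inr ?_)
    rw [Shape.size_applyVars]
    simp only [Ty.size]
    omega
  | clash _ _ _ =>
    exact (Constr.Dec.to_leaf fun e k ρ => lt_add_of_lt_of_nonneg
      (unit_lt (by simp [item_lt_iff])) (wt_nonneg _)).1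
  | trivial _ =>
    exact (Constr.Dec.to_leaf fun e k ρ => lt_add_of_lt_of_nonneg
      (unit_lt (by simp [item_lt_iff])) (wt_nonneg _)).2

theorem Unif.dec {u v : Constr} (h : Unif u v) : u.Dec v := by
  obtain ⟨-, U, u', v', hu, huv, hv⟩ := h
  exact (huv.dec.fill U).congr hu hv

/-! ## Suspended match constraints -/

theorem matches_labInstOf (env : LabelEnv) (l : Label) (T : RecName) (t₁ t₂ : Typ) :
    (labInstOf env l T t₁ t₂).matches = 0 := by
  unfold labInstOf
  split
  · rfl
  · simp [Constr.matches_exs, Constr.matches, Constr.eq]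

theorem matches_domEqOf (env : LabelEnv) (T : RecName) (ls : Finset Label) :
    (domEqOf env T ls).matches = 0 := by
  unfold domEqOf
  split <;> rfl

theorem matches_schLeOf (σ : Scheme) (t : Typ) : (schLeOf σ t).matches = 0 := by
  simp [schLeOf, Constr.matches_exs, Constr.matches, Constr.eq]

theorem matches_leSchOf (x : TermVar) (σ : Scheme) : (leSchOf x σ).matches = 0 := by
  simp [leSchOf, Constr.matches_alls, Constr.matches]

mutual
theorem Constr.matches_substRec (env : LabelEnv) (R : RecVar) (T : RecName) :
    (c : Constr) → (c.substRec env R T).matches = c.matches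
  | .and c d => by
    simp [Constr.substRec, Constr.matches, c.matches_substRec env R T, d.matches_substRec env R T]
  | .ex _ c => by simp [Constr.substRec, Constr.matches, c.matches_substRec env R T]
  | .all _ c => by simp [Constr.substRec, Constr.matches, c.matches_substRec env R T]
  | .letc _ _ c d => by
    simp [Constr.substRec, Constr.matches, c.matches_substRec env R T, d.matches_substRec env R T]
  | .letr _ _ _ c d => by
    simp [Constr.substRec, Constr.matches, c.matches_substRec env R T, d.matches_substRec env R T]
  | .exI _ _ c => by simp [Constr.substRec, Constr.matches, c.matches_substRec env R T]
  | .mtch _ bs => by simp [Constr.substRec, Constr.matches, bs.matches_substRec env R T]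
  | .labInst _ _ _ _ => by
    simp only [Constr.substRec]; split
    · exact matches_labInstOf ..
    · rfl
  | .domEq _ _ => by
    simp only [Constr.substRec]; split
    · exact matches_domEqOf ..
    · rfl
  | .tru => rfl
  | .fls => rfl
  | .eqn _ => rfl
  | .app _ _ => rfl
  | .inst _ _ _ => rfl
  | .schLe _ _ => rfl
  | .leSch _ _ => rfl

theorem Branches.matches_substRec (env : LabelEnv) (R : RecVar) (T : RecName) :
    (bs : Branches) → (bs.substRec env R T).matches = bs.matches
  | .nil => rfl
  | .cons _ c bs => by
    simp only [Branches.substRec, Branches.matches, bs.matches_substRec env R T]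
    split <;> simp [c.matches_substRec env R T]
end

mutual
theorem Constr.matches_substSch (S : SchVar) (σ : Scheme) :
    (c : Constr) → (c.substSch S σ).matches = c.matches
  | .and c d => by
    simp [Constr.substSch, Constr.matches, c.matches_substSch S σ, d.matches_substSch S σ]
  | .ex _ c => by simp [Constr.substSch, Constr.matches, c.matches_substSch S σ]
  | .all _ c => by simp [Constr.substSch, Constr.matches, c.matches_substSch S σ]
  | .letc _ _ c d => by
    simp [Constr.substSch, Constr.matches, c.matches_substSch S σ, d.matches_substSch S σ]
  | .letr _ _ _ c d => by
    simp [Constr.substSch, Constr.matches, c.matches_substSch S σ, d.matches_substSch S σ]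
  | .exI _ _ c => by simp [Constr.substSch, Constr.matches, c.matches_substSch S σ]
  | .mtch _ bs => by simp [Constr.substSch, Constr.matches, bs.matches_substSch S σ]
  | .schLe _ _ => by
    simp only [Constr.substSch]; split
    · exact matches_schLeOf ..
    · rfl
  | .leSch _ _ => by
    simp only [Constr.substSch]; split
    · exact matches_leSchOf ..
    · rfl
  | .tru => rfl
  | .fls => rfl
  | .eqn _ => rfl
  | .app _ _ => rfl
  | .inst _ _ _ => rfl
  | .labInst _ _ _ _ => rfl
  | .domEq _ _ => rfl

theorem Branches.matches_substSch (S : SchVar) (σ : Scheme) :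
    (bs : Branches) → (bs.substSch S σ).matches = bs.matches
  | .nil => rfl
  | .cons _ c bs => by
    simp only [Branches.substSch, Branches.matches, bs.matches_substSch S σ]
    split <;> simp [c.matches_substSch S σ]
end

theorem PatMatch.matches_eq {env : LabelEnv} {s : Shape} {as : Fin s.arity → TyVar} {p : Pat}
    {c d : Constr} (h : PatMatch env s as p c d) : d.matches = c.matches := by
  cases h with
  | wild => rfl
  | prod _ => exact c.matches_subst _ _
  | rcd _ => exact c.matches_substRec _ _ _
  | poly _ => exact c.matches_substSch _ _

theorem BranchMatch.matches_le {env : LabelEnv} {s : Shape} {as : Fin s.arity → TyVar}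
    {bs : Branches} {d : Constr} (h : BranchMatch env s as bs d) : d.matches ≤ bs.matches := by
  induction h with
  | head h => rw [h.matches_eq]; exact Nat.le_add_right _ _
  | tail _ ih => exact ih.trans (Nat.le_add_left _ _)

/-- Matches inside branches are counted, so the released body was already paid for and the match
itself disappears. Expanding pattern variables creates no match. -/
theorem Discharge.matches_lt {env : LabelEnv} {t : Typ} {s : Shape} {bs : Branches} {d : Constr}
    (h : Discharge env t s bs d) : d.matches < (Constr.mtch t bs).matches := by
  cases h with
  | some _ _ h =>
    have := h.matches_le
    simp only [Constr.matches_exs, Constr.matches, Constr.eq]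
    omega
  | none _ => exact Nat.succ_pos _

/-! ## The rules of the solver -/

/-- Replacing an instantiation inside the body of a let-constraint. -/
theorem Constr.Dec.letr_fill {x : TermVar} {a : TyVar} {as : List TyVar} {c : Constr} {C : Ctx}
    {u v : Constr} (hm : v.matches = 0) (ha : v.apps = 0) (hl : v.lets = 0)
    (h : ∀ e k ρ, v.wt e k ((Ctx.letrR x a as c C).env ρ) <
      u.wt e k ((Ctx.letrR x a as c C).env ρ)) :
    (Constr.letr x a as c (C.fill u)).Dec (.letr x a as c (C.fill v)) := by
  obtain ⟨m, hm'⟩ := (Ctx.letrR x a as c C).matches_fill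
  obtain ⟨n, hn'⟩ := (Ctx.letrR x a as c C).apps_fill
  obtain ⟨l, hl'⟩ := (Ctx.letrR x a as c C).lets_fill
  simp only [Ctx.fill] at hm' hn' hl'
  exact .of_wt (by rw [hm', hm']; omega) (by rw [hn', hn']; omega) (by rw [hl', hl']; omega)
    fun e k ρ => (Ctx.letrR x a as c C).wt_fill_lt (by omega) fun e k => h e k ρ

theorem Constr.leaf_lt_wt_inst (i : InstVar) (b : TyVar) (t : Typ) (e k : ℕ) (ρ : Env) :
    unit (item e 0 1 k) < (Constr.inst i b t).wt e k ρ :=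
  unit_lt (item_lt_iff.2 (Or.inr ⟨rfl, Or.inl (by simp)⟩))

/-- An instantiation has potential at least 1 and an equation only 0. This settles the rules that
turn the former into the latter, independently of the environments. -/
theorem Constr.wt_eq_lt_wt_inst (t₁ t₂ : Typ) (i : InstVar) (b : TyVar) (t : Typ) (e k : ℕ)
    (ρ ρ' : Env) : (Constr.eq t₁ t₂).wt e k ρ < (Constr.inst i b t).wt e k ρ' := by
  refine SuppLt.lt_unit ?_
  rw [Constr.wt_eq]
  refine (SuppLt.unit ?_).add ((SuppLt.unit ?_).add (SuppLt.unit ?_)) <;>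
    exact item_lt_iff.2 (Or.inr ⟨rfl, Or.inl (by simp)⟩)

theorem Constr.leaf_lt_wt_alls {as : List TyVar} (has : as ≠ []) (c : Constr) (e k : ℕ)
    (ρ : Env) : unit (item e 0 1 k) < (Constr.alls as c).wt e k ρ := by
  rw [Constr.wt_alls]
  have := List.length_pos_of_ne_nil has
  exact (unit_depth_lt (by omega)).trans_le (Constr.unit_le_wt _ _ _ _)

theorem Constr.Dec.inst_name {i : InstVar} {b g : TyVar} {t : Typ} (ht : ¬ Typ.IsVar t)
    (hg : g ≠ b) :
    (Constr.inst i b t).Dec (.ex g (.and (.eq (.var g) t) (.inst i b (.var g)))) := by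
  refine .of_wt le_rfl le_rfl le_rfl fun e k ρ => SuppLt.lt_unit ?_
  have hp : ∀ p : ℕ∞, 0 < p + 1 := fun p => by simp
  refine (SuppLt.unit (item_lt_iff.2 (Or.inr ⟨rfl, Or.inl (hp _)⟩))).add (.add ?_ ?_)
  · rw [Constr.wt_eq]
    refine (SuppLt.unit ?_).add ((SuppLt.unit ?_).add (SuppLt.unit ?_)) <;>
      exact item_lt_iff.2 (Or.inr ⟨rfl, Or.inl (hp _)⟩)
  · refine SuppLt.unit (item_lt_iff.2 (Or.inr ⟨rfl, Or.inr ⟨?_, Or.inl ?_⟩⟩))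
    -- As `g` differs from `b`, the new binder does not send the potential of `b` to `⊤`; the strict
    -- decrease comes from the value, which goes from 1 to 0.
    · simp [Env.bind, hg.symm]
    · rw [Typ.nonVar, Typ.nonVar, if_pos ⟨g, rfl⟩, if_neg ht]
      exact Nat.zero_lt_one

/-- The new instantiations concern arguments of a proper type equated with `b` in an acyclic
definition, hence variables of smaller potential. The single item of the copied instantiation
outweighs all of them, together with the binders and the equation, which have potential 0. -/
theorem Constr.Dec.inst_copy {x : TermVar} {a b g : TyVar} {as : List TyVar} {cs : List Constr}
    {s : Shape} {bs bs' : Fin s.arity → TyVar} {E : MultiEq} {i : InstVar} {c : Constr} {C : Ctx}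
    (hc : c = .conj (cs ++ [.eqn (.var b ::ₘ s.applyVars bs ::ₘ E)])) (hs : s.Canonical)
    (hb : b ∈ a :: as) (hcyc : ¬ c.Cyclic) (hbs : ∀ j k, bs' j ≠ bs k)
    (ho : C.owner i = some x) (hx : .tm x ∉ C.bvs) (hbC : .tv b ∉ C.bvs)
    (hbsC : ∀ j, .tv (bs j) ∉ C.bvs) :
    (Constr.letr x a as c (C.fill (.inst i b (.var g)))).Dec
      (.letr x a as c (C.fill (.exs (List.ofFn bs')
        (.conj (.eq (.var g) (s.applyVars bs') ::
          List.ofFn fun j => Constr.inst i (bs j) (.var (bs' j))))))) := by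
  have hnv : ¬ Typ.IsVar (s.applyVars bs) := by
    rintro ⟨v, hv⟩
    have h1 := hs.one_le_size
    rw [← Shape.size_applyVars s bs, hv] at h1
    simp [Ty.size] at h1
  have hpot : ∀ j, c.pot (bs j) < c.pot b := by
    intro j
    refine Constr.pot_lt hcyc ?_
    rw [hc]
    refine Constr.Vis_conj_snoc ⟨s.applyVars bs, E, rfl, ?_, hnv⟩
    exact Ty.fv_bind_of_mem _ _ (s.all_used j) (by simp [Ty.fv, Ty.occ])
  refine .letr_fill ?_ ?_ ?_ fun e k ρ => SuppLt.lt_unit ?_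
  · simp [Constr.matches_exs, Constr.matches_conj, Constr.matches, Constr.eq, List.map_ofFn,
      Function.comp_def]
  · simp [Constr.apps_exs, Constr.apps_conj, Constr.apps, Constr.eq, List.map_ofFn,
      Function.comp_def]
  · simp [Constr.lets_exs, Constr.lets_conj, Constr.lets, Constr.eq, List.map_ofFn,
      Function.comp_def]
  -- At the hole, `i` still sees the potentials of the region of `x`.
  have henv : ∀ d, .tv d ∉ C.bvs →
      ((Ctx.letrR x a as c C).env ρ).inst i d = c.regionPot (a :: as) d := fun d hd => by
    rw [Ctx.env, Ctx.env_inst_of_owner C ho hx hd]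
    simp [Env.setTerm]
  have hp : ∀ p : ℕ∞, 0 < p + 1 := fun p => by simp
  rw [Constr.wt_exs, Constr.wt_conj (by simp)]
  refine ((SuppLt.unit (item_lt_iff.2 (Or.inr ⟨rfl, Or.inl (hp _)⟩))).nsmul _).add
    (SuppLt.list_sum ?_)
  simp only [List.map_cons, List.map_ofFn, List.mem_cons, List.mem_ofFn]
  rintro _ (rfl | ⟨j, rfl⟩)
  · rw [Constr.wt_eq]
    refine (SuppLt.unit ?_).add ((SuppLt.unit ?_).add (SuppLt.unit ?_)) <;>
      exact item_lt_iff.2 (Or.inr ⟨rfl, Or.inl (hp _)⟩)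
  · refine SuppLt.unit (item_lt_iff.2 (Or.inr ⟨rfl, Or.inl ?_⟩))
    -- If a new binder captured `bs j`, its potential would become `⊤`.
    have hmem : bs j ∉ List.ofFn bs' := by
      rw [List.mem_ofFn]
      rintro ⟨l, hl⟩
      exact hbs l j hl
    have h1 : (((Ctx.letrR x a as c C).env ρ).bind (List.ofFn bs')).inst i (bs j) =
        c.regionPot (a :: as) (bs j) := by
      rw [← henv _ (hbsC j)]
      exact if_neg hmem
    rw [h1, henv b hbC]
    -- An argument may lie outside the region, in which case its recorded potential is 0.
    have h2 : c.regionPot (a :: as) (bs j) ≤ c.pot (bs j) := by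
      unfold Constr.regionPot
      split_ifs
      · exact le_rfl
      · exact zero_le
    have h3 : c.regionPot (a :: as) b = c.pot b := if_pos hb
    rw [h3]
    exact (ENat.add_lt_add_iff_right (by simp)).2 (h2.trans_lt (hpot j))

-- Regions, instantiation binders and universals

/-- The binder of value 2 disappears from the definition. It pays for the additional variable of the
region, of value 0, and for any change of potentials in the body. -/
theorem Constr.Dec.let_exists_left {x : TermVar} {a b : TyVar} {as : List TyVar}
    {c d : Constr} : (Constr.letr x a as (.ex b c) d).Dec (.letr x a (as ++ [b]) c d) := by
  refine .of_wt le_rfl le_rfl le_rfl fun e k ρ =>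
    letr_lt_of_def_lt (Constr.suppGe_wt _ _ _ _) ?_ (d.suppLt_wt _ _ _)
  rw [Constr.wt, Env.bind_bind, List.cons_append]
  exact lt_add_of_pos_left _ (unit_pos _)

/-- The existential leaves the body and loses one level of depth; nothing else becomes heavier. -/
theorem Constr.Dec.let_exists_right {x : TermVar} {a b : TyVar} {as : List TyVar}
    {c d : Constr} (hb : .tv b ∉ c.fv) :
    (Constr.letr x a as c (.ex b d)).Dec (.ex b (.letr x a as c d)) := by
  refine .of_wt le_rfl le_rfl le_rfl fun e k ρ => ?_
  have henv : (ρ.bind [b]).bind (a :: as) = (ρ.bind (a :: as)).bind [b] := by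
    rw [Env.bind_bind, Env.bind_bind]
    exact ρ.bind_congr fun y => by simp only [List.mem_append, List.mem_cons]; tauto
  have h1 : c.wt (e + 1 + d.lets) 0 ((ρ.bind [b]).bind (a :: as)) ≤
      c.wt (e + 1 + d.lets) 0 (ρ.bind (a :: as)) :=
    c.wt_mono le_rfl le_rfl ((EnvLe.bind_le (by simpa using hb) ρ).bind_same _)
  have h2 : d.wt e (k + 1) (((ρ.bind [b]).bind (a :: as)).setTerm x (c.regionPot (a :: as))) ≤
      d.wt e (k + 1) (((ρ.bind (a :: as)).setTerm x (c.regionPot (a :: as))).bind [b]) := by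
    refine d.wt_mono le_rfl le_rfl ?_
    rw [henv]
    -- The two environments can differ only in the potential of `x` at `b`: formerly `⊤`, as `b` was
    -- bound after `x`, and now the one given by the region.
    refine ⟨fun i y _ _ => le_rfl, fun z y _ _ => ?_⟩
    by_cases hz : z = x
    · subst hz
      simp only [Env.setTerm, Env.bind, Function.update_self]
      split_ifs <;> simp
    · simp [Env.setTerm, Env.bind, hz]
  calc _ = unit (item e 0 2 k) + ((c.vis.card + as.length) • unit (item (e + 1 + d.lets) 0 0 0) +
          c.wt (e + 1 + d.lets) 0 ((ρ.bind [b]).bind (a :: as)) +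
          d.wt e (k + 1) (((ρ.bind [b]).bind (a :: as)).setTerm x (c.regionPot (a :: as)))) := rfl
    _ < unit (item e 0 2 (k + 1)) +
          ((c.vis.card + as.length) • unit (item (e + 1 + d.lets) 0 0 0) +
          c.wt (e + 1 + d.lets) 0 (ρ.bind (a :: as)) +
          d.wt e (k + 1) (((ρ.bind (a :: as)).setTerm x (c.regionPot (a :: as))).bind [b])) :=
        add_lt_add_of_lt_of_le (unit_depth_lt (Nat.lt_succ_self k))
          (add_le_add (add_le_add le_rfl h1) h2)
    _ = _ := add_left_comm _ _ _

/-- The extruded conjunct falls to the lower degree of the surroundings. What remains has fewer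
visible variables and occurrences, so neither counters nor potentials increase. -/
theorem Constr.Dec.let_conj_left {x : TermVar} {a : TyVar} {as : List TyVar}
    {c₁ c₂ c₃ : Constr} :
    (Constr.letr x a as (.and c₁ c₂) c₃).Dec (.and c₁ (.letr x a as c₂ c₃)) := by
  refine .of_wt ?_ ?_ ?_ fun e k ρ => ?_
  · simp only [Constr.matches]; omega
  · simp only [Constr.apps]; omega
  · simp only [Constr.lets]; omega
  have h1 : c₁.wt e k ρ < c₁.wt (e + 1 + c₃.lets) 0 (ρ.bind (a :: as)) :=
    c₁.wt_lt_of_degree_lt (by omega) _ _ _ _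
  have h2 : c₂.vis.card ≤ (Constr.and c₁ c₂).vis.card :=
    Finset.card_le_card Finset.subset_union_right
  have h3 : ∀ y, c₂.regionPot (a :: as) y ≤ (Constr.and c₁ c₂).regionPot (a :: as) y := by
    intro y
    unfold Constr.regionPot
    split_ifs
    · exact relPot_mono (fun _ _ h => Or.inr h) (fun _ _ h => Or.inr h) y
    · exact le_rfl
  have h4 := c₃.wt_mono (le_refl e) (le_refl (k + 1))
    (EnvLe.setTerm_le_setTerm c₃.fv (ρ := ρ.bind (a :: as)) (x := x) h3)
  calc _ = c₁.wt e k ρ + ((c₂.vis.card + as.length) • unit (item (e + 1 + c₃.lets) 0 0 0) +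
          c₂.wt (e + 1 + c₃.lets) 0 (ρ.bind (a :: as)) +
          c₃.wt e (k + 1) ((ρ.bind (a :: as)).setTerm x (c₂.regionPot (a :: as)))) := rfl
    _ < c₁.wt (e + 1 + c₃.lets) 0 (ρ.bind (a :: as)) +
          (((Constr.and c₁ c₂).vis.card + as.length) • unit (item (e + 1 + c₃.lets) 0 0 0) +
          c₂.wt (e + 1 + c₃.lets) 0 (ρ.bind (a :: as)) +
          c₃.wt e (k + 1)
            ((ρ.bind (a :: as)).setTerm x ((Constr.and c₁ c₂).regionPot (a :: as)))) :=
        add_lt_add_of_lt_of_le h1 (add_le_add (add_le_add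
          (nsmul_wt_le (Nat.add_le_add_right h2 _) le_rfl) le_rfl) h4)
    _ = _ := by
        simp only [Constr.wt]
        abel

/-- The extruded conjunct loses one level of depth. The body may lose lets, which can only lower the
degree of the definition. -/
theorem Constr.Dec.let_conj_right {x : TermVar} {a : TyVar} {as : List TyVar}
    {c₁ c₂ c₃ : Constr} (hx : .tm x ∉ c₂.fv) :
    (Constr.letr x a as c₁ (.and c₂ c₃)).Dec (.and c₂ (.letr x a as c₁ c₃)) := by
  refine .of_wt ?_ ?_ ?_ fun e k ρ => ?_
  · simp only [Constr.matches]; omega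
  · simp only [Constr.apps]; omega
  · simp only [Constr.lets]; omega
  have hl : (Constr.and c₂ c₃).lets = c₂.lets + c₃.lets := rfl
  have h1 : c₂.wt e k ρ <
      c₂.wt e (k + 1) ((ρ.bind (a :: as)).setTerm x (c₁.regionPot (a :: as))) :=
    c₂.wt_lt_of_depth_lt le_rfl (Nat.lt_succ_self k)
      ((EnvLe.le_bind _ _ _).trans (EnvLe.le_setTerm hx _ _))
  have h2 : item (e + 1 + c₃.lets) 0 0 0 ≤ item (e + 1 + (Constr.and c₂ c₃).lets) 0 0 0 := by
    rw [hl, item_le_iff]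
    rcases Nat.eq_zero_or_pos c₂.lets with h | h
    · exact Or.inr ⟨by omega, by simp⟩
    · exact Or.inl (by omega)
  calc _ = c₂.wt e k ρ + ((c₁.vis.card + as.length) • unit (item (e + 1 + c₃.lets) 0 0 0) +
          c₁.wt (e + 1 + c₃.lets) 0 (ρ.bind (a :: as)) +
          c₃.wt e (k + 1) ((ρ.bind (a :: as)).setTerm x (c₁.regionPot (a :: as)))) := rfl
    _ < c₂.wt e (k + 1) ((ρ.bind (a :: as)).setTerm x (c₁.regionPot (a :: as))) +
          ((c₁.vis.card + as.length) • unit (item (e + 1 + (Constr.and c₂ c₃).lets) 0 0 0) +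
          c₁.wt (e + 1 + (Constr.and c₂ c₃).lets) 0 (ρ.bind (a :: as)) +
          c₃.wt e (k + 1) ((ρ.bind (a :: as)).setTerm x (c₁.regionPot (a :: as)))) :=
        add_lt_add_of_lt_of_le h1 (add_le_add (add_le_add
          (nsmul_le_nsmul_right (unit_le h2) _)
          (c₁.wt_mono (by omega) le_rfl (EnvLe.refl _ _))) le_rfl)
    _ = _ := by
        simp only [Constr.wt]
        abel

/-- Substituting in the old definition gives the new one with one redundant copy of `g`, so the
weight of the definition decreases strictly and outweighs any effect on the body. -/
theorem Constr.Dec.compress {x : TermVar} {a b g : TyVar} {as : List TyVar} {cs : List Constr}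
    {E : MultiEq} {d : Constr} (hg : .tv g ∉ (Constr.conj cs).bn) :
    (Constr.letr x a (as ++ [b]) (.conj (cs ++ [.eqn (.var b ::ₘ .var g ::ₘ E)])) d).Dec
      (.letr x a as (.conj (cs.map (Constr.subst b g) ++
        [.eqn (.var g ::ₘ Multiset.map (Ty.subst1 b g) E)])) (d.subst b g)) := by
  refine .of_wt ?_ ?_ ?_ fun e k ρ => ?_
  · simp [Constr.matches, Constr.matches_conj, Constr.matches_subst, Function.comp_def]
  · simp [Constr.apps, Constr.apps_conj, Constr.apps_subst, Function.comp_def]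
  · simp [Constr.lets, Constr.lets_conj, Constr.lets_subst, Function.comp_def]
  have hbn : .tv g ∉ (Constr.conj (cs ++ [.eqn (.var b ::ₘ .var g ::ₘ E)])).bn := by
    rwa [Constr.bn_conj_snoc_eqn]
  -- Being bound by the region, `b` has potential `⊤`, so whatever `g` has is acceptable.
  have henv : EnvSubst b g (ρ.bind (a :: as)) (ρ.bind (a :: (as ++ [b]))) := by
    constructor <;> intro i y <;> by_cases hy : y = b
    · simp [Env.bind, hy]
    · simp [Env.bind, hy, single_ne]
    · simp [Env.bind, hy]
    · simp [Env.bind, hy, single_ne]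
  have hsub := Constr.wt_subst_le hbn (e := e + 1 + d.lets) (k := 0) henv
  have hvar : Multiset.map (Ty.subst1 b g) (.var b ::ₘ .var g ::ₘ E) =
      .var g ::ₘ .var g ::ₘ Multiset.map (Ty.subst1 b g) E := by
    have h1 : Ty.subst1 b g (.var b) = .var g := by simp [Ty.subst1, Ty.rename, Ty.bind, Ty.mapB]
    have h2 : Ty.subst1 b g (.var g) = .var g := by simp [Ty.subst1, Ty.rename, Ty.bind, Ty.mapB]
    rw [Multiset.map_cons, Multiset.map_cons, h1, h2]
  rw [Constr.subst_conj, List.map_append, List.map_cons, List.map_nil, Constr.subst, hvar,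
    Constr.wt_conj_snoc, Constr.wt_eqn_cons] at hsub
  simp only [Constr.wt, Constr.lets_subst]
  refine letr_lt_of_def_lt (Constr.suppGe_wt _ _ _ _) (lt_of_lt_of_le ?_ hsub) ?_
  · rw [Constr.wt_conj_snoc]
    exact add_lt_add_of_le_of_lt le_rfl (lt_add_of_pos_left _ (unit_pos _))
  · have := (d.subst b g).suppLt_wt e (k + 1)
    rw [Constr.lets_subst] at this
    exact this _

/-- The definition loses a member; as above, this outweighs the effect on the body. -/
theorem Constr.Dec.gc {x : TermVar} {a b : TyVar} {as : List TyVar} {cs : List Constr}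
    {E : MultiEq} {d : Constr} :
    (Constr.letr x a (as ++ [b]) (.conj (cs ++ [.eqn (.var b ::ₘ E)])) d).Dec
      (.letr x a as (.conj (cs ++ [.eqn E])) d) := by
  refine .of_wt ?_ ?_ ?_ fun e k ρ => letr_lt_of_def_lt (Constr.suppGe_wt _ _ _ _)
    (lt_of_le_of_lt (b := (Constr.conj (cs ++ [.eqn E])).wt (e + 1 + d.lets) 0
      (ρ.bind (a :: (as ++ [b])))) (Constr.wt_mono _ le_rfl le_rfl ?_) ?_) (d.suppLt_wt _ _ _)
  · simp [Constr.matches, Constr.matches_conj]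
  · simp [Constr.apps, Constr.apps_conj]
  · simp [Constr.lets, Constr.lets_conj]
  · rw [← List.cons_append, ← Env.bind_bind]
    exact EnvLe.le_bind _ _ _
  · rw [Constr.wt_conj_snoc, Constr.wt_conj_snoc, Constr.wt_eqn_cons]
    exact add_lt_add_of_le_of_lt le_rfl (lt_add_of_pos_left _ (unit_pos _))

/-- The shorter region loses counters at the degree of the definition; they pay for the new
existentials, which are at the lower degree `e`. -/
theorem Constr.Dec.exists_lower {x : TermVar} {a : TyVar} {as bs : List TyVar} {c d : Constr}
    (hbs : bs ≠ []) :
    (Constr.letr x a (as ++ bs) c d).Dec (.exs bs (.letr x a as c d)) := by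
  refine .of_wt ?_ ?_ ?_ fun e k ρ => ?_
  · rw [Constr.matches_exs]; exact le_rfl
  · rw [Constr.apps_exs]; exact le_rfl
  · rw [Constr.lets_exs]; exact le_rfl
  have hlen := List.length_pos_of_ne_nil hbs
  have henv : (ρ.bind bs).bind (a :: as) = ρ.bind (a :: (as ++ bs)) := by
    rw [Env.bind_bind]
    exact ρ.bind_congr fun y => by simp only [List.mem_append, List.mem_cons]; tauto
  rw [Constr.wt_exs]
  simp only [Constr.wt]
  rw [henv, add_comm, add_assoc]
  refine letr_lt_of_card_lt (by rw [List.length_append]; omega) le_rfl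
    ((d.suppLt_wt _ _ _).add (SuppLt.nsmul _ (SuppLt.unit (item_lt_of_degree_lt (by omega)))))

theorem Constr.Dec.let_solve {x : TermVar} {a : TyVar} {as : List TyVar} {c d : Constr}
    (hx : .tm x ∉ d.fv) : (Constr.letr x a as c d).Dec d := by
  refine .of_wt ?_ ?_ ?_ fun e k ρ => ?_
  · simp only [Constr.matches]; omega
  · simp only [Constr.apps]; omega
  · simp only [Constr.lets]; omega
  refine lt_add_of_nonneg_of_lt (wt_nonneg _) (d.wt_lt_of_depth_lt le_rfl (Nat.lt_succ_self k) ?_)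
  exact (EnvLe.le_bind _ _ _).trans (EnvLe.le_setTerm hx _ _)

theorem Constr.Dec.exists_exists_inst {i : InstVar} {x : TermVar} {a : TyVar} {c : Constr} :
    (Constr.exI i x (.ex a c)).Dec (.ex a (.exI i x c)) := by
  refine .of_wt le_rfl le_rfl le_rfl fun e k ρ => ?_
  have henv : (ρ.bind [a]).setInst i x = (ρ.setInst i x).bind [a] := by
    ext j b
    · by_cases hj : j = i
      · subst hj; simp [Env.bind, Env.setInst]
      · simp [Env.bind, Env.setInst, hj]
    · rfl
  simp only [Constr.wt, henv]
  exact add_lt_add_of_le_of_lt le_rfl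
    (add_lt_add_of_lt_of_le (unit_depth_lt (Nat.lt_succ_self k)) le_rfl)

theorem Constr.Dec.exists_inst_conj {i : InstVar} {x : TermVar} {c d : Constr}
    (hi : .iv i ∉ c.fv) : (Constr.exI i x (.and c d)).Dec (.and c (.exI i x d)) := by
  refine .of_wt le_rfl le_rfl le_rfl fun e k ρ => ?_
  simp only [Constr.wt]
  rw [add_left_comm (unit _)]
  exact add_lt_add_of_lt_of_le
    (c.wt_lt_of_depth_lt le_rfl (Nat.lt_succ_self k) (EnvLe.le_setInst hi _ _)) le_rfl

theorem Constr.Dec.exists_inst_let {i : InstVar} {x x' : TermVar} {a : TyVar} {as : List TyVar}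
    {c d : Constr} (hx : x ≠ x') (hi : .iv i ∉ c.fv) :
    (Constr.letr x a as c (.exI i x' d)).Dec (.exI i x' (.letr x a as c d)) := by
  refine .of_wt le_rfl le_rfl le_rfl fun e k ρ => ?_
  have h1 : c.wt (e + 1 + d.lets) 0 ((ρ.setInst i x').bind (a :: as)) ≤
      c.wt (e + 1 + d.lets) 0 (ρ.bind (a :: as)) :=
    c.wt_mono le_rfl le_rfl ((EnvLe.setInst_le hi ρ x').bind_same _)
  -- The two bindings commute because `i` takes its potentials from `x'`, which differs from `x`.
  have h2 : ((ρ.setInst i x').bind (a :: as)).setTerm x (c.regionPot (a :: as)) =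
      ((ρ.bind (a :: as)).setTerm x (c.regionPot (a :: as))).setInst i x' := by
    ext j b
    · by_cases hj : j = i
      · subst hj; simp [Env.bind, Env.setInst, Env.setTerm, hx.symm]
      · simp [Env.bind, Env.setInst, Env.setTerm, hj]
    · rfl
  calc _ = unit (item e 0 2 k) + ((c.vis.card + as.length) • unit (item (e + 1 + d.lets) 0 0 0) +
          c.wt (e + 1 + d.lets) 0 ((ρ.setInst i x').bind (a :: as)) +
          d.wt e (k + 1 + 1)
            (((ρ.setInst i x').bind (a :: as)).setTerm x (c.regionPot (a :: as)))) := rfl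
    _ < unit (item e 0 2 (k + 1)) +
          ((c.vis.card + as.length) • unit (item (e + 1 + d.lets) 0 0 0) +
          c.wt (e + 1 + d.lets) 0 (ρ.bind (a :: as)) +
          d.wt e (k + 1 + 1)
            (((ρ.bind (a :: as)).setTerm x (c.regionPot (a :: as))).setInst i x')) :=
        add_lt_add_of_lt_of_le (unit_depth_lt (Nat.lt_succ_self k))
          (add_le_add (add_le_add le_rfl h1) (by rw [h2]))
    _ = _ := add_left_comm _ _ _

theorem Constr.Dec.exists_inst_solve {i : InstVar} {x : TermVar} {c : Constr}
    (hi : .iv i ∉ c.fv) : (Constr.exI i x c).Dec c :=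
  .of_wt le_rfl le_rfl le_rfl fun _ k _ => lt_add_of_nonneg_of_lt (wt_nonneg _)
    (c.wt_lt_of_depth_lt le_rfl (Nat.lt_succ_self k) (EnvLe.le_setInst hi _ _))

theorem Constr.Dec.all_conj {as bs : List TyVar} {c d : Constr} (has : as ≠ []) :
    (Constr.alls as (.exs bs (.and c d))).Dec (.and c (.alls as (.exs bs d))) := by
  refine .of_wt ?_ ?_ ?_ fun e k ρ => ?_
  · simp [Constr.matches_alls, Constr.matches_exs, Constr.matches]
  · simp [Constr.apps_alls, Constr.apps_exs, Constr.apps]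
  · simp [Constr.lets_alls, Constr.lets_exs, Constr.lets]
  have := List.length_pos_of_ne_nil has
  rw [Constr.wt, Constr.wt_alls, Constr.wt_alls, Constr.wt_exs, Constr.wt_exs, Constr.wt]
  refine lt_of_lt_of_eq (add_lt_add_of_lt_of_le
    (c.wt_lt_of_depth_lt le_rfl (by omega) ?_) le_rfl) (add_left_comm _ _ _)
  exact (EnvLe.le_bind _ _ _).trans (EnvLe.le_bind _ _ _)

/-- The existentials `gs` come out of at least one universal, so their depth drops, while everything
else keeps its depth and environment. -/
theorem Constr.Dec.exists_all {as bs gs l : List TyVar} {c : Constr} (has : as ≠ [])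
    (hgs : gs ≠ []) (hl : l.Perm (bs ++ gs)) :
    (Constr.alls as (.exs l c)).Dec (.exs gs (.alls as (.exs bs c))) := by
  refine .of_wt ?_ ?_ ?_ fun e k ρ => ?_
  · simp [Constr.matches_alls, Constr.matches_exs]
  · simp [Constr.apps_alls, Constr.apps_exs]
  · simp [Constr.lets_alls, Constr.lets_exs]
  have h1 := List.length_pos_of_ne_nil has
  have h2 := List.length_pos_of_ne_nil hgs
  have henv : ((ρ.bind gs).bind as).bind bs = (ρ.bind as).bind l := by
    rw [Env.bind_bind, Env.bind_bind, Env.bind_bind]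
    exact ρ.bind_congr fun y => by simp only [List.mem_append, hl.mem_iff]; tauto
  rw [Constr.wt_exs, Constr.wt_alls, Constr.wt_exs, Constr.wt_alls, Constr.wt_exs, henv,
    hl.length_eq, List.length_append, Nat.add_comm bs.length, add_nsmul, add_assoc]
  exact add_lt_add_of_lt_of_le (nsmul_lt_nsmul_right (by omega) (unit_depth_lt (by omega))) le_rfl

theorem Rule.dec {env : LabelEnv} {u v : Constr} (h : Rule env u v) : u.Dec v := by
  cases h with
  | unif h => exact h.dec
  | true_ => exact .and_tru _
  | false_ h => exact (Constr.Dec.to_leaf fun e k ρ => Ctx.leaf_lt_wt_fill h _ e k ρ).1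
  -- Plain lets are included in `apps` because becoming regional can make them heavier.
  | let_ _ => exact .of_apps le_rfl (Nat.lt_succ_self _)
  | exists_conj h => exact .exists_conj h
  | let_exists_left _ _ => exact .let_exists_left
  | let_exists_right _ h => exact .let_exists_right h
  | let_conj_left _ => exact .let_conj_left
  | let_conj_right h _ => exact .let_conj_right h
  | match_ctx _ h => exact Constr.Dec.fill (.of_matches h.matches_lt) _
  | inst_name ht hg _ => exact .inst_name ht hg
  -- The new instantiation may have any potential, even `⊤`, so the decrease has to come before the
  -- weight, from `apps`.
  | @let_appR x a g as i c C t _ _ _ _ =>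
    exact Constr.Dec.fill (c := .app x t)
      (d := .ex g (.exI i x (.and (.inst i a (.var g)) (.eq (.var g) t)))) (.of_apps le_rfl Nat.zero_lt_one) (.letrR x a as c C)
  | inst_copy hc hs hb hcyc _ hbs ho hx hbC hbsC =>
    exact .inst_copy hc hs hb hcyc (fun j k => (hbs j).2.2 k) ho hx hbC hbsC
  | inst_unify =>
    exact .of_wt le_rfl le_rfl le_rfl fun e k ρ =>
      add_lt_add_of_le_of_lt le_rfl (Constr.wt_eq_lt_wt_inst ..)
  | inst_poly _ _ _ _ _ _ _ =>
    exact .letr_fill rfl rfl rfl fun e k ρ => Constr.leaf_lt_wt_inst ..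
  | inst_mono _ _ _ _ =>
    exact .letr_fill rfl rfl rfl fun e k ρ => Constr.wt_eq_lt_wt_inst ..
  | let_solve _ hx _ => exact .let_solve hx
  | compress _ hg _ => exact .compress hg
  | gc _ _ _ => exact .gc
  | exists_lower hbs _ => exact .exists_lower hbs
  | exists_exists_inst => exact .exists_exists_inst
  | exists_inst_conj hi => exact .exists_inst_conj hi
  | exists_inst_let hx hi => exact .exists_inst_let hx hi
  | exists_inst_solve hi => exact .exists_inst_solve hi
  | all_conj has _ => exact .all_conj has
  | exists_all has hgs hl _ _ => exact .exists_all has hgs hl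
  | all_escape ha _ _ _ _ =>
    exact (Constr.Dec.to_leaf fun e k ρ =>
      Constr.leaf_lt_wt_alls (List.ne_nil_of_mem ha) _ e k ρ).1
  | all_rigid ha _ _ =>
    exact (Constr.Dec.to_leaf fun e k ρ =>
      Constr.leaf_lt_wt_alls (List.ne_nil_of_mem ha) _ e k ρ).1
  | all_solve has _ =>
    exact (Constr.Dec.to_leaf fun e k ρ => Constr.leaf_lt_wt_alls has _ e k ρ).2

theorem Solve.dec {env : LabelEnv} {u v : Constr} (h : Solve env u v) : u.Dec v := by
  obtain ⟨C, u', v', hu, huv, hv⟩ := h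
  exact (huv.dec.fill C).congr hu hv

end Omni

theorem mainTheorem5 (env : Omni.LabelEnv) :
    Omni.Terminating (Omni.Solve env) ∧ Omni.Terminating Omni.Unif :=
  ⟨Omni.terminating_of_dec fun _ _ h => h.dec, Omni.terminating_of_dec fun _ _ h => h.dec⟩
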